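/- **Setting (mother-quake model).** Let $E$ be a measurable space with a $\sigma$-finite reference measure $\nu$, let $p\in[0,1]$, $q=1-p$, and let $\gamma(u,s)$, $\varepsilon(u,s)$, $\lambda(u,s,y)$ be nonnegative, finite, jointly measurable functions ($u\in E$, $s\ge 0$, $y\in E\times[0,\infty)$). Put $a(y,s)=\int_E\lambda(u,s,y)\,\nu(du)$ and $\varepsilon(s)=\int_E\varepsilon(u,s)\,\nu(du)$, and assume that $\int_0^T\!\int_E\gamma(u,s)\,\nu(du)\,ds$, $\int_0^T\varepsilon(s)\,ds$ and, for every $y=(v,r)$, $\int_{(r,T]}a(y,s)\,ds$ are finite for all $T$. Quakes $y_i=(u_i,\tau_i)$, $i=1,2,\dots$, with marks $u_i\in E$, occur at times $0=\tau_0<\tau_1<\tau_2<\cdots$ with $\tau_i\to\infty$ ($\tau_i=\infty$ if there are fewer than $i$ quakes). Each is either a single quake or a cluster quake; these labels are not observed. Let $N$ and $C$ be the counting measures on $E\times[0,\infty)$ of the single and of the cluster quakes. No cluster is active at time $0$. A cluster quake that occurs when no cluster is active starts a new cluster and is its mother quake; a cluster quake that occurs when a cluster is active is an offspring, and the cluster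 then dies out with probability $p$, independently of all previous history. Let $D_t\in\{0,1\}$ indicate whether a cluster is active at time $t$, let $\alpha=D_t$, and let $\theta_0(y_i)$ be the indicator that $y_i$ is the mother quake of the currently active cluster (so $\theta_0(y_i)=0$ if none is active). Under the probability $P$: * $N$ is a Poisson random measure with mean measure $\gamma(u,s)\,\nu(du)\,ds$, its increments after any time $t$ are independent of the full history up to $t$, and $N$ is independent of $(C,D)$; * $C$ has, with respect to the full history, the predictable intensity (relative to $\nu(du)\,dt$) $$D_{t-}\sum_{i:\,\tau_i<t}\lambda(u,t,y_i)\,\theta_0(y_i)+(1-D_{t-})\,\varepsilon(u,t),$$ where $\theta_0(y_i)$ is evaluated at $t-$. Let $\mathcal F^O_t$ be generated by the times and marks of the quakes observed up to time $t$, and let $\pi(Z,t)=E^P[Z_t\mid\mathcal F^O_t]$, always taken as a càdlàg version in $t$. **Theorem.** For each $i$ the process $t\mapsto\pi(\theta_0(y_i)\alpha,t)$ has a càdlàg version, and for any such versions the following holds almost surely. (a) For all $k\ge 0$, all $t$ with $\tau_k\le t<\tau_{k+1}$ and all $1\le i\le k$, $$\pi(\theta_0(y_i)\alpha,t)=\pi(\theta_0(y_i)\alpha,\tau_k)\,e^{-\int_{\tau_k}^t(a(y_i,s)-\varepsilon(s))\,ds}\,b_k(t),$$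 $$b_k(t)=\frac1{\sum_{j=1}^k\pi(\theta_0(y_j)\alpha,\tau_k)\,e^{-\int_{\tau_k}^t(a(y_j,s)-\varepsilon(s))\,ds}+1-\sum_{j=1}^k\pi(\theta_0(y_j)\alpha,\tau_k)},$$ the denominator of $b_k(t)$ being positive. (b) For all $k\ge0$ with $\tau_{k+1}<\infty$, put $\gamma_{k+1}=\gamma(u_{k+1},\tau_{k+1})$, $\lambda_{k+1,i}=\lambda(u_{k+1},\tau_{k+1},y_i)$, $\varepsilon_{k+1}=\varepsilon(u_{k+1},\tau_{k+1})$ and $$d_{k+1}=\sum_{j=1}^k(\lambda_{k+1,j}-\varepsilon_{k+1})\,\pi(\theta_0(y_j)\alpha,\tau_{k+1}-)+\varepsilon_{k+1}+\gamma_{k+1}.$$ Then $d_{k+1}>0$ and $$\pi(\theta_0(y_i)\alpha,\tau_{k+1})=\frac{\pi(\theta_0(y_i)\alpha,\tau_{k+1}-)\,(\gamma_{k+1}+q\lambda_{k+1,i})}{d_{k+1}}\qquad(1\le i<k+1),$$ $$\pi(\theta_0(y_{k+1})\alpha,\tau_{k+1})=\frac{\varepsilon_{k+1}-\sum_{j=1}^k\varepsilon_{k+1}\,\pi(\theta_0(y_j)\alpha,\tau_{k+1}-)}{d_{k+1}}.$$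 -/

import Mathlib

open MeasureTheory ProbabilityTheory Set Filter Topology
open scoped NNReal ENNReal

noncomputable section

/-- Lebesgue measure on `[0, ∞)`. -/
def lebesgueNN : Measure ℝ≥0 := (volume : Measure ℝ).comap ((↑) : ℝ≥0 → ℝ)

/-- A labelled marked point process on `[0, ∞)` with marks in `E`. Quakes are numbered `0, 1, 2, …` in
order of occurrence; `time n = ∞` means that there are at most `n` quakes. Quake `n` has the mark
`mark n`, the hidden label `inCluster n` (`true`: cluster quake, `false`: single quake) and carries
a hidden coin `kill n`, which matters only if the quake is an offspring in an active cluster. -/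
structure QuakeProcess (Ω E : Type*) [MeasurableSpace Ω] [MeasurableSpace E] where
  time : ℕ → Ω → ℝ≥0∞
  mark : ℕ → Ω → E
  inCluster : ℕ → Ω → Bool
  kill : ℕ → Ω → Bool
  measurable_time : ∀ n, Measurable (time n)
  measurable_mark : ∀ n, Measurable (mark n)
  measurable_inCluster : ∀ n, Measurable (inCluster n)
  measurable_kill : ∀ n, Measurable (kill n)
  time_pos : ∀ ω, 0 < time 0 ω
  time_mono : ∀ n ω, time n ω ≤ time (n + 1) ω
  time_lt : ∀ n ω, time n ω ≠ ∞ → time n ω < time (n + 1) ω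
  tendsto_time : ∀ ω, Tendsto (fun n => time n ω) atTop (𝓝 ∞)

/-- The filtration generated by a marked point process with times `T n` and marks `X n`: at time `t`
one knows, for all `n`, `r ≤ t` and `A`, whether point `n` occurred by time `r` with mark in `A`. -/
def pointHistory {Ω S : Type*} [mΩ : MeasurableSpace Ω] [MeasurableSpace S]
    (T : ℕ → Ω → ℝ≥0∞) (X : ℕ → Ω → S)
    (hT : ∀ n, Measurable (T n)) (hX : ∀ n, Measurable (X n)) : Filtration ℝ≥0 mΩ where
  seq t := MeasurableSpace.generateFrom
    {s | ∃ (n : ℕ) (r : ℝ≥0) (A : Set S), r ≤ t ∧ MeasurableSet A ∧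
      s = {ω | T n ω ≤ (r : ℝ≥0∞) ∧ X n ω ∈ A}}
  mono' := by
    intro t t' htt'
    refine MeasurableSpace.generateFrom_mono ?_
    rintro s ⟨n, r, A, hr, hA, rfl⟩
    exact ⟨n, r, A, hr.trans htt', hA, rfl⟩
  le' := by
    intro t
    refine MeasurableSpace.generateFrom_le ?_
    rintro s ⟨n, r, A, -, hA, rfl⟩
    exact (measurableSet_le (hT n) measurable_const).inter (hX n hA)

namespace QuakeProcess

variable {Ω E : Type*} [mΩ : MeasurableSpace Ω] [MeasurableSpace E] (M : QuakeProcess Ω E)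

/-- The observation filtration `𝓕ᴼ`: times and marks of the quakes, without labels and coins. -/
def obsHistory : Filtration ℝ≥0 mΩ :=
  pointHistory M.time M.mark M.measurable_time M.measurable_mark

/-- The full history: times, marks, labels and coins of the quakes. -/
def fullHistory : Filtration ℝ≥0 mΩ :=
  pointHistory M.time (fun n ω => (M.mark n ω, M.inCluster n ω, M.kill n ω)) M.measurable_time
    (fun n => (M.measurable_mark n).prodMk ((M.measurable_inCluster n).prodMk (M.measurable_kill n)))

/-- The point `y_n = (u_n, τ_n)` (used only when `τ_n < ∞`). -/
def point (n : ℕ) (ω : Ω) : E × ℝ≥0 := (M.mark n ω, (M.time n ω).toNNReal)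

/-- The random counting measure on `E × [0, ∞)` of the quakes with label `b`. -/
def counting (b : Bool) (ω : Ω) : Measure (E × ℝ≥0) :=
  Measure.sum fun n =>
    if M.time n ω ≠ ∞ ∧ M.inCluster n ω = b then Measure.dirac (M.point n ω) else 0

/-- The process `N` of single quakes. -/
def N (ω : Ω) : Measure (E × ℝ≥0) := M.counting false ω

/-- The process `C` of cluster quakes. -/
def C (ω : Ω) : Measure (E × ℝ≥0) := M.counting true ω

/-- The mother quake of the active cluster after the first `n` quakes (`none`: no active cluster).
No cluster is active at time `0`. A cluster quake that occurs while no cluster is active becomes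
the mother of a new active cluster; one that occurs while a cluster is active is an offspring,
and the cluster dies out exactly when its coin says so. Single quakes change nothing. -/
def motherAfter : ℕ → Ω → Option ℕ
  | 0, _ => none
  | n + 1, ω =>
    match M.inCluster n ω, motherAfter n ω with
    | false, m => m
    | true, none => some n
    | true, some i => if M.kill n ω then none else some i

/-- The number of quakes in `[0, t]`. -/
def count (t : ℝ≥0) (ω : Ω) : ℕ := {n | M.time n ω ≤ t}.ncard

/-- The number of quakes in `[0, t)`. -/
def countBefore (t : ℝ≥0) (ω : Ω) : ℕ := {n | M.time n ω < t}.ncard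

/-- `D = 1` or `0` according as a cluster is active or not, given the active mother. -/
def activeOf (m : Option ℕ) : ℝ≥0 := if m.isSome then 1 else 0

/-- The indicator `θ₀(y_i)` that `y_i` is the mother of the active cluster, given the active mother. -/
def thetaOf (i : ℕ) (m : Option ℕ) : ℝ≥0 := if m = some i then 1 else 0

/-- The process `D_t` (which is also `α` at time `t`). -/
def D (t : ℝ≥0) (ω : Ω) : ℝ≥0 := activeOf (M.motherAfter (M.count t ω) ω)

/-- The left limit `D_{t-}`. -/
def DLeft (t : ℝ≥0) (ω : Ω) : ℝ≥0 := activeOf (M.motherAfter (M.countBefore t ω) ω)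

/-- `θ₀(y_i)` at time `t`. -/
def theta (i : ℕ) (t : ℝ≥0) (ω : Ω) : ℝ≥0 := thetaOf i (M.motherAfter (M.count t ω) ω)

/-- `θ₀(y_i)` just before time `t`. -/
def thetaLeft (i : ℕ) (t : ℝ≥0) (ω : Ω) : ℝ≥0 :=
  thetaOf i (M.motherAfter (M.countBefore t ω) ω)

/-- The cluster intensity
`λ(u, t, D_{t-}, η_{t-}) = D_{t-} ∑ᵢ λ(u, t, yᵢ) θ₀(yᵢ) + (1 - D_{t-}) ε(u, t)`,
the sum being over the quakes observed before `t`. -/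
def clusterIntensity (lam : E → ℝ≥0 → E × ℝ≥0 → ℝ≥0) (eps : E → ℝ≥0 → ℝ≥0)
    (u : E) (t : ℝ≥0) (ω : Ω) : ℝ≥0 :=
  M.DLeft t ω * ∑ i ∈ Finset.range (M.countBefore t ω), lam u t (M.point i ω) * M.thetaLeft i t ω
    + (1 - M.DLeft t ω) * eps u t

end QuakeProcess

/-- `X` is a Poisson random measure with mean measure `μ` under `P`. -/
structure IsPoissonRandomMeasure {Ω S : Type*} [MeasurableSpace Ω] [MeasurableSpace S]
    (P : Measure Ω) (X : Ω → Measure S) (μ : Measure S) : Prop where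
  law : ∀ B, MeasurableSet B → μ B < ∞ →
    P.map (fun ω => X ω B) = (poissonMeasure (μ B).toNNReal).map (fun n : ℕ => (n : ℝ≥0∞))
  indep : ∀ (m : ℕ) (B : Fin m → Set S), (∀ i, MeasurableSet (B i)) →
    Pairwise (fun i j => Disjoint (B i) (B j)) → iIndepFun (fun i ω => X ω (B i)) P

/-- The random counting measure `X` on `E × [0, ∞)` has the stochastic intensity
`lam u s ω ν(du) ds` with respect to the filtration `𝓕`:
`E ∫ H dX = E ∫∫ H(s, u) lam(u, s) ν(du) ds` for all nonnegative predictable `H`. -/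
def HasIntensity {Ω E : Type*} [mΩ : MeasurableSpace Ω] [mE : MeasurableSpace E]
    (P : Measure Ω) (𝓕 : Filtration ℝ≥0 mΩ) (X : Ω → Measure (E × ℝ≥0)) (ν : Measure E)
    (lam : E → ℝ≥0 → Ω → ℝ≥0) : Prop :=
  ∀ H : (ℝ≥0 × Ω) × E → ℝ≥0∞, Measurable[𝓕.predictable.prod mE] H →
    ∫⁻ ω, ∫⁻ x, H ((x.2, ω), x.1) ∂(X ω) ∂P
      = ∫⁻ ω, ∫⁻ s, ∫⁻ u, H ((s, ω), u) * (lam u s ω : ℝ≥0∞) ∂ν ∂lebesgueNN ∂P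

/-- The mother-quake model with single-quake intensity `gam`, cluster initiation intensity `eps`,
offspring intensity `lam`, reference measure `ν` and extinction probability `p`. -/
structure IsMotherQuakeModel {Ω E : Type*} [MeasurableSpace Ω] [MeasurableSpace E]
    (M : QuakeProcess Ω E) (P : Measure Ω) (ν : Measure E) (gam eps : E → ℝ≥0 → ℝ≥0)
    (lam : E → ℝ≥0 → E × ℝ≥0 → ℝ≥0) (p : ℝ) : Prop where
  /-- `N` is a Poisson random measure with mean measure `gam(u, s) ν(du) ds`. -/
  poisson : IsPoissonRandomMeasure P M.N
    ((ν.prod lebesgueNN).withDensity fun x => (gam x.1 x.2 : ℝ≥0∞))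
  /-- `N` is compatible with the history: its increments after `t` are independent of the history
  up to time `t`. -/
  compatible : ∀ t : ℝ≥0, Indep
    (MeasurableSpace.comap (fun ω => (M.N ω).restrict (univ ×ˢ Ioi t)) inferInstance)
    (M.fullHistory t) P
  /-- The single quakes are independent of the clusters. -/
  indep : IndepFun M.N (fun ω => (M.C ω, fun t : ℝ≥0 => M.D t ω)) P
  /-- `C` has the predictable intensity `λ(u, s, D_{s-}, η_{s-})`. -/
  intensity : HasIntensity P M.fullHistory M.C ν (M.clusterIntensity lam eps)
  /-- The coins are Bernoulli with parameter `p`, -/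
  kill_prob : ∀ n, P {ω | M.kill n ω = true} = ENNReal.ofReal p
  /-- and each one is independent of all previous history, including the time, mark and label of
  the quake that carries it. -/
  kill_indep : ∀ n, IndepFun (M.kill n)
    (fun ω => ((fun j : Fin n => (M.time j ω, M.mark j ω, M.inCluster j ω, M.kill j ω)),
      (M.time n ω, M.mark n ω, M.inCluster n ω))) P

/-- `π` is the càdlàg version of the filter `π(Z, t) = E[Z_t | 𝓕ᴼ_t]`. -/
structure IsFilterOf {Ω E : Type*} [MeasurableSpace Ω] [MeasurableSpace E]
    (M : QuakeProcess Ω E) (P : Measure Ω) (Z : ℝ≥0 → Ω → ℝ) (π : ℝ≥0 → Ω → ℝ) : Prop where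
  condExp : ∀ t, π t =ᵐ[P] P[Z t | M.obsHistory t]
  cadlag : ∀ᵐ ω ∂P, ∀ t, ContinuousWithinAt (fun s => π s ω) (Ici t) t ∧
    ∃ l, Tendsto (fun s => π s ω) (𝓝[<] t) (𝓝 l)

namespace QuakeProcess

variable {Ω E : Type*} [MeasurableSpace Ω] [MeasurableSpace E] (M : QuakeProcess Ω E)

/-- The process `θ₀(y_i) α`. -/
def thetaAlpha (i : ℕ) (t : ℝ≥0) (ω : Ω) : ℝ := ((M.theta i t ω * M.D t ω : ℝ≥0) : ℝ)

/-- The time of the `k`-th observation counted from `1`, and `0` for `k = 0`; between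
`lastTime k` and `time k` exactly `k` quakes have been observed. -/
def lastTime : ℕ → Ω → ℝ≥0∞
  | 0, _ => 0
  | k + 1, ω => M.time k ω

/-- `exp (-∫_{τ_k}^t (a(y_i, s) - ε(s)) ds)`, with `a(y, s) = ∫ λ(u, s, y) ν(du)` and
`ε(s) = ∫ ε(u, s) ν(du)`. -/
def decay (ν : Measure E) (eps : E → ℝ≥0 → ℝ≥0) (lam : E → ℝ≥0 → E × ℝ≥0 → ℝ≥0)
    (k i : ℕ) (t : ℝ≥0) (ω : Ω) : ℝ :=
  Real.exp (-∫ s in Ioc (M.lastTime k ω).toNNReal t,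
    ((∫ u, (lam u s (M.point i ω) : ℝ) ∂ν) - ∫ u, (eps u s : ℝ) ∂ν) ∂lebesgueNN)

/-- The denominator of `b_k(t)`. -/
def bDenom (ν : Measure E) (eps : E → ℝ≥0 → ℝ≥0) (lam : E → ℝ≥0 → E × ℝ≥0 → ℝ≥0)
    (π : ℕ → ℝ≥0 → Ω → ℝ) (k : ℕ) (t : ℝ≥0) (ω : Ω) : ℝ :=
  (∑ j ∈ Finset.range k, π j (M.lastTime k ω).toNNReal ω * M.decay ν eps lam k j t ω)
    + 1 - ∑ j ∈ Finset.range k, π j (M.lastTime k ω).toNNReal ω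

/-- The left limit `π(θ₀(y_j) α, τ-)` at the time `τ` of quake `k`. -/
def preJump (π : ℕ → ℝ≥0 → Ω → ℝ) (k j : ℕ) (ω : Ω) : ℝ :=
  Function.leftLim (fun s => π j s ω) (M.time k ω).toNNReal

/-- `γ(u, τ)` at the mark `u` and time `τ` of quake `k`. -/
def gamAt (gam : E → ℝ≥0 → ℝ≥0) (k : ℕ) (ω : Ω) : ℝ :=
  gam (M.mark k ω) (M.time k ω).toNNReal

/-- `ε(u, τ)` at the mark `u` and time `τ` of quake `k`. -/
def epsAt (eps : E → ℝ≥0 → ℝ≥0) (k : ℕ) (ω : Ω) : ℝ :=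
  eps (M.mark k ω) (M.time k ω).toNNReal

/-- `λ(u, τ, y_i)` at the mark `u` and time `τ` of quake `k`. -/
def lamAt (lam : E → ℝ≥0 → E × ℝ≥0 → ℝ≥0) (k i : ℕ) (ω : Ω) : ℝ :=
  lam (M.mark k ω) (M.time k ω).toNNReal (M.point i ω)

/-- The normalizer `∑ⱼ (λⱼ - ε) π(θ₀(y_j) α, τ-) + ε + γ` at quake `k`, with the sum over the
earlier quakes. -/
def jumpDenom (gam eps : E → ℝ≥0 → ℝ≥0) (lam : E → ℝ≥0 → E × ℝ≥0 → ℝ≥0)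
    (π : ℕ → ℝ≥0 → Ω → ℝ) (k : ℕ) (ω : Ω) : ℝ :=
  (∑ j ∈ Finset.range k, (M.lamAt lam k j ω - M.epsAt eps k ω) * M.preJump π k j ω)
    + M.epsAt eps k ω + M.gamAt gam k ω

end QuakeProcess

end

/-!
Write `m` for the mother of the active cluster, `none` if there is none. Given the past and `m`, the
next quake is governed by a known total intensity: cluster quakes have one by assumption, and single
quakes have intensity `γ` because the increments of a Poisson random measure after `t` are
independent of the past. Hence the next quake has the density "survival probability of `m` times
rate", and a quake of the cluster moves `m` to `none` with probability `p` by an independent coin.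
Bayes' rule then gives, by induction on the number of quakes, the conditional law of `m` given the
first `k` observations as explicit weights.

On the event that exactly `k` quakes have occurred by time `t`, the observation σ-algebra coincides
with that of the first `k` quakes, so the filter is the vector of weights, discounted by the
survival probabilities up to `t` and normalised. This version is càdlàg, hence indistinguishable
from every other càdlàg version. Dividing the weights by the survival probability of `none` leaves
the factors `exp (-∫ (a - ε))` of (a), and (b) is Bayes' rule at the next quake.
-/

theorem eq_of_eqOn_dense_of_continuousWithinAt_Ici {f g : ℝ≥0 → ℝ} {D : Set ℝ≥0} (hD : Dense D)
    (hf : ∀ t, ContinuousWithinAt f (Ici t) t) (hg : ∀ t, ContinuousWithinAt g (Ici t) t)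
    (hfg : EqOn f g D) : f = g := by
  funext t
  have hcl : t ∈ closure (Ioi t ∩ D) :=
    closure_minimal (hD.open_subset_closure_inter isOpen_Ioi) isClosed_closure
      (closure_Ioi t ▸ self_mem_Ici)
  have := mem_closure_iff_nhdsWithin_neBot.1 hcl
  have hsub : Ioi t ∩ D ⊆ Ici t := inter_subset_left.trans Ioi_subset_Ici_self
  refine tendsto_nhds_unique ((hf t).mono hsub) (((hg t).mono hsub).congr' ?_)
  filter_upwards [self_mem_nhdsWithin] with s hs using (hfg hs.2).symm

section Measure

theorem measurableEmbedding_coe_nnreal_real : MeasurableEmbedding ((↑) : ℝ≥0 → ℝ) :=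
  MeasurableEmbedding.subtype_coe measurableSet_Ici

instance : NullSingletonClass lebesgueNN where
  measure_singleton x := by
    rw [lebesgueNN, measurableEmbedding_coe_nnreal_real.comap_apply]
    simp

theorem lebesgueNN_Iic_lt_top (T : ℝ≥0) : lebesgueNN (Iic T) < ∞ := by
  rw [lebesgueNN, measurableEmbedding_coe_nnreal_real.comap_apply]
  refine (measure_mono (t := Icc (0 : ℝ) T) ?_).trans_lt (by simp)
  rintro _ ⟨x, hx, rfl⟩
  exact ⟨x.2, NNReal.coe_le_coe.2 hx⟩

instance : SigmaFinite lebesgueNN :=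
  ⟨⟨{ set := fun n => Iic (n : ℝ≥0)
      set_mem := fun _ => trivial
      finite := fun n => lebesgueNN_Iic_lt_top n
      spanning := eq_univ_of_forall fun x => mem_iUnion.2 (exists_nat_ge x) }⟩⟩

theorem lintegral_mul_eq_of_forall_setLIntegral_eq {Ω : Type*} {𝓖 m0 : MeasurableSpace Ω}
    {P : Measure Ω} (hm : 𝓖 ≤ m0) {φ ψ : Ω → ℝ≥0∞} (hφ : Measurable φ) (hψ : Measurable ψ)
    (h : ∀ A, MeasurableSet[𝓖] A → ∫⁻ ω in A, φ ω ∂P = ∫⁻ ω in A, ψ ω ∂P)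
    {g : Ω → ℝ≥0∞} (hg : Measurable[𝓖] g) :
    ∫⁻ ω, g ω * φ ω ∂P = ∫⁻ ω, g ω * ψ ω ∂P := by
  have htrim : (P.withDensity φ).trim hm = (P.withDensity ψ).trim hm := by
    refine @Measure.ext _ 𝓖 _ _ fun A hA => ?_
    rw [trim_measurableSet_eq hm hA, trim_measurableSet_eq hm hA,
      withDensity_apply _ (hm _ hA), withDensity_apply _ (hm _ hA), h A hA]
  have lintegral_eq_trim (χ : Ω → ℝ≥0∞) (hχ : Measurable χ) :
      ∫⁻ ω, g ω * χ ω ∂P = ∫⁻ ω, g ω ∂((P.withDensity χ).trim hm) := by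
    rw [lintegral_trim hm hg, lintegral_withDensity_eq_lintegral_mul _ hχ (hg.mono hm le_rfl)]
    simp [mul_comm]
  rw [lintegral_eq_trim φ hφ, lintegral_eq_trim ψ hψ, htrim]

theorem continuousOn_measureReal_Ioc {μ : Measure ℝ≥0} [NullSingletonClass μ] {a t : ℝ≥0}
    (hfin : μ (Ioc a t) ≠ ∞) : ContinuousOn (fun s => μ.real (Ioc a s)) (Icc a t) := by
  set μR : Measure ℝ := μ.map ((↑) : ℝ≥0 → ℝ)
  have hmap (s : ℝ≥0) : μR (Ioc (a : ℝ) s) = μ (Ioc a s) := by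
    rw [Measure.map_apply NNReal.continuous_coe.measurable measurableSet_Ioc]
    congr 1
  have : NullSingletonClass μR := ⟨fun x => by
    rw [Measure.map_apply NNReal.continuous_coe.measurable (measurableSet_singleton x)]
    exact (subsingleton_singleton.preimage NNReal.coe_injective).measure_zero μ⟩
  rcases lt_or_ge t a with hta | _
  · simp [Icc_eq_empty (not_le.2 hta)]
  have hint : IntegrableOn (fun _ => (1 : ℝ)) (Icc (a : ℝ) t) μR := by
    rw [integrableOn_const_iff, ← measure_congr Ioc_ae_eq_Icc, hmap]
    exact Or.inr hfin.lt_top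
  have hcont := (intervalIntegral.continuousOn_primitive hint).comp
    NNReal.continuous_coe.continuousOn (s := Icc a t) fun s hs =>
      ⟨NNReal.coe_le_coe.2 hs.1, NNReal.coe_le_coe.2 hs.2⟩
  exact hcont.congr fun s _ => by simp [Measure.real, hmap]

theorem map_measureReal_Ioc {μ : Measure ℝ≥0} [NullSingletonClass μ] {a b : ℝ≥0} (hab : a ≤ b)
    (hfin : μ (Ioc a b) ≠ ∞) :
    (μ.restrict (Ioc a b)).map (fun s => μ.real (Ioc a s))
      = volume.restrict (Ioc 0 (μ.real (Ioc a b))) := by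
  set F : ℝ≥0 → ℝ := fun s => μ.real (Ioc a s)
  have hcont : ContinuousOn F (Icc a b) := continuousOn_measureReal_Ioc hfin
  have hF_le {x y : ℝ≥0} (hxy : x ≤ y) (hy : y ≤ b) : F x ≤ F y :=
    measureReal_mono (Ioc_subset_Ioc_right hxy)
      (measure_ne_top_of_subset (Ioc_subset_Ioc_right hy) hfin)
  have hFa : F a = 0 := by simp [F]
  have : IsFiniteMeasure (μ.restrict (Ioc a b)) := ⟨by simpa using hfin.lt_top⟩
  refine Measure.ext_of_Iic _ _ fun c => ?_
  rw [Measure.map_apply_of_aemeasurable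
      ((hcont.mono Ioc_subset_Icc_self).aemeasurable measurableSet_Ioc) measurableSet_Iic,
    Measure.restrict_apply' measurableSet_Ioc, Measure.restrict_apply measurableSet_Iic,
    inter_comm (Iic c), Ioc_inter_Iic, Real.volume_Ioc, sub_zero, inter_comm, min_comm]
  rcases lt_or_ge c 0 with hc | hc
  · have hempty : Ioc a b ∩ F ⁻¹' Iic c = ∅ := eq_empty_of_forall_notMem fun s hs =>
      (hc.trans_le measureReal_nonneg).not_ge hs.2
    rw [hempty, measure_empty, ENNReal.ofReal_of_nonpos ((min_le_left _ _).trans hc.le)]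
  · obtain ⟨x, ⟨hx, hxc⟩, hmax⟩ := (isCompact_Icc.of_isClosed_subset
      (hcont.preimage_isClosed_of_isClosed isClosed_Icc isClosed_Iic)
      inter_subset_left).exists_isGreatest ⟨a, left_mem_Icc.2 hab, hFa.trans_le hc⟩
    have hinter : Ioc a b ∩ F ⁻¹' Iic c = Ioc a x := by
      ext s
      exact ⟨fun hs => ⟨hs.1.1, hmax ⟨Ioc_subset_Icc_self hs.1, hs.2⟩⟩,
        fun hs => ⟨⟨hs.1, hs.2.trans hx.2⟩, (hF_le hs.2 hx.2).trans hxc⟩⟩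
    have hFx : F x = min c (F b) := by
      refine (le_min hxc (hF_le hx.2 le_rfl)).antisymm ?_
      obtain ⟨s, hs, hsc⟩ := intermediate_value_Icc hab hcont
        ⟨hFa.trans_le (le_min hc measureReal_nonneg), min_le_right c (F b)⟩
      exact hsc ▸ hF_le (hmax ⟨hs, hsc.trans_le (min_le_left _ _)⟩) hx.2
    rw [hinter, ← hFx, ofReal_measureReal
      (measure_ne_top_of_subset (Ioc_subset_Ioc_right hx.2) hfin)]

theorem lintegral_exp_neg_measureReal_Ioc {μ : Measure ℝ≥0} [NullSingletonClass μ] {a b t : ℝ≥0}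
    (hab : a ≤ b) (hbt : b ≤ t) (hfin : μ (Ioc a t) ≠ ∞) :
    ∫⁻ s in Ioc a b, ENNReal.ofReal (Real.exp (-μ.real (Ioc s t))) ∂μ
      + ENNReal.ofReal (Real.exp (-μ.real (Ioc a t)))
      = ENNReal.ofReal (Real.exp (-μ.real (Ioc b t))) := by
  set F : ℝ≥0 → ℝ := fun s => μ.real (Ioc a s)
  have hfin_b : μ (Ioc a b) ≠ ∞ := measure_ne_top_of_subset (Ioc_subset_Ioc_right hbt) hfin
  have hsplit {s : ℝ≥0} (has : a ≤ s) (hsb : s ≤ b) :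
      ENNReal.ofReal (Real.exp (-μ.real (Ioc s t)))
        = ENNReal.ofReal (Real.exp (-μ.real (Ioc a t))) * ENNReal.ofReal (Real.exp (F s)) := by
    have hst := hsb.trans hbt
    rw [← ENNReal.ofReal_mul (Real.exp_nonneg _), ← Real.exp_add, ← Ioc_union_Ioc_eq_Ioc has hst,
      measureReal_union (Ioc_disjoint_Ioc_of_le le_rfl) measurableSet_Ioc
        (measure_ne_top_of_subset (Ioc_subset_Ioc_right hst) hfin)
        (measure_ne_top_of_subset (Ioc_subset_Ioc_left has) hfin)]
    simp [F]
  have hexp : ∫⁻ s in Ioc a b, ENNReal.ofReal (Real.exp (F s)) ∂μ + 1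
      = ENNReal.ofReal (Real.exp (F b)) := by
    have hFb : 0 ≤ F b := measureReal_nonneg
    have hF : AEMeasurable F (μ.restrict (Ioc a b)) :=
      ((continuousOn_measureReal_Ioc hfin_b).mono Ioc_subset_Icc_self).aemeasurable
        measurableSet_Ioc
    rw [← lintegral_map' (f := fun v => ENNReal.ofReal (Real.exp v)) (by fun_prop) hF,
      map_measureReal_Ioc hab hfin_b, ← ofReal_integral_eq_lintegral_ofReal
        Real.continuous_exp.integrableOn_Ioc
        (Eventually.of_forall fun v => Real.exp_nonneg v),
      ← intervalIntegral.integral_of_le hFb, integral_exp, ← ENNReal.ofReal_one,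
      ← ENNReal.ofReal_add (by simpa using hFb) zero_le_one]
    simp
  rw [setLIntegral_congr_fun measurableSet_Ioc fun s hs => hsplit hs.1.le hs.2,
    lintegral_const_mul' _ _ ENNReal.ofReal_ne_top, hsplit hab le_rfl, ← hexp, mul_add, mul_one]

theorem lintegral_natCast_poissonMeasure (r : ℝ≥0) :
    ∫⁻ n, (n : ℝ≥0∞) ∂(poissonMeasure r) = r := by
  have hterm (n : ℕ) : Real.exp (-r) * r ^ (n + 1) / (n + 1).factorial * ((n : ℝ) + 1)
      = r * (Real.exp (-r) * r ^ n / n.factorial) := by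
    rw [Nat.factorial_succ]
    push_cast
    field_simp
    exact pow_succ' _ n
  have hmean : HasSum (fun n : ℕ => Real.exp (-r) * r ^ n / n.factorial * n) (r : ℝ) := by
    rw [← hasSum_nat_add_iff' 1]
    simpa [hterm] using (hasSum_one_poissonMeasure r).mul_left (r : ℝ)
  rw [poissonMeasure, lintegral_sum_measure]
  simp only [lintegral_smul_measure, lintegral_dirac, smul_eq_mul]
  have hcoe (n : ℕ) : ENNReal.ofReal (Real.exp (-r) * r ^ n / n.factorial) * n
      = ENNReal.ofReal (Real.exp (-r) * r ^ n / n.factorial * n) := by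
    rw [ENNReal.ofReal_mul (by positivity), ENNReal.ofReal_natCast]
  simp_rw [hcoe]
  rw [← ENNReal.ofReal_tsum_of_nonneg (fun n => by positivity) hmean.summable, hmean.tsum_eq,
    ENNReal.ofReal_coe_nnreal]

end Measure

section PointHistory

theorem measurable_indicator_comp_of_subtype {Y Z : Type*} [MeasurableSpace Y] [MeasurableSpace Z]
    {f : Y → Z} {W : Set Y} (hW : MeasurableSet W) (hf : Measurable fun w : W => f w)
    {g : Z → ℝ≥0∞} (hg : Measurable g) : Measurable (W.indicator fun y => g (f y)) := by
  refine measurable_of_restrict_of_restrict_compl hW ?_ ?_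
  · convert hg.comp hf using 1
    ext w; simp
  · convert measurable_const (a := (0 : ℝ≥0∞)) using 1
    ext w; exact indicator_of_notMem w.2 _

variable {Ω S : Type*} [MeasurableSpace S]

/-- The σ-algebra generated by the first `n` points of a marked point process. -/
abbrev pointPast (T : ℕ → Ω → ℝ≥0∞) (X : ℕ → Ω → S) (n : ℕ) : MeasurableSpace Ω :=
  ⨆ i < n, MeasurableSpace.comap (fun ω => (X i ω, T i ω)) inferInstance

theorem measurable_into_pointPast {Y : Type*} [MeasurableSpace Y] {T : ℕ → Ω → ℝ≥0∞}
    {X : ℕ → Ω → S} {n : ℕ} {f : Y → Ω} (hT : ∀ i < n, Measurable fun y => T i (f y))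
    (hX : ∀ i < n, Measurable fun y => X i (f y)) : Measurable[_, pointPast T X n] f := by
  rw [measurable_iff_comap_le, pointPast]
  simp only [MeasurableSpace.comap_iSup, MeasurableSpace.comap_comp, iSup_le_iff]
  exact fun i hi => measurable_iff_comap_le.1 ((hX i hi).prodMk (hT i hi))

theorem pointPast_le_iff {T : ℕ → Ω → ℝ≥0∞} {X : ℕ → Ω → S} {n : ℕ} {m : MeasurableSpace Ω} :
    pointPast T X n ≤ m ↔ ∀ i < n, Measurable[m] (fun ω => (X i ω, T i ω)) := by
  simp only [pointPast, iSup_le_iff, measurable_iff_comap_le]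

theorem measurable_pointPast_mark {T : ℕ → Ω → ℝ≥0∞} {X : ℕ → Ω → S} {n i : ℕ} (hi : i < n) :
    Measurable[pointPast T X n] (X i) :=
  @Measurable.fst _ _ _ (pointPast T X n) _ _ _ (pointPast_le_iff.1 le_rfl i hi)

theorem measurable_pointPast_time {T : ℕ → Ω → ℝ≥0∞} {X : ℕ → Ω → S} {n i : ℕ} (hi : i < n) :
    Measurable[pointPast T X n] (T i) :=
  @Measurable.snd _ _ _ (pointPast T X n) _ _ _ (pointPast_le_iff.1 le_rfl i hi)

theorem pointPast_mono (T : ℕ → Ω → ℝ≥0∞) (X : ℕ → Ω → S) (n : ℕ) :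
    pointPast T X n ≤ pointPast T X (n + 1) :=
  biSup_mono fun _ hi => hi.trans n.lt_succ_self

variable [mΩ : MeasurableSpace Ω] {T : ℕ → Ω → ℝ≥0∞} {X : ℕ → Ω → S}
  (hT : ∀ n, Measurable (T n)) (hX : ∀ n, Measurable (X n))

theorem pointPast_le (hT : ∀ n, Measurable (T n)) (hX : ∀ n, Measurable (X n)) (n : ℕ) :
    pointPast T X n ≤ mΩ :=
  pointPast_le_iff.2 fun i _ => (hX i).prodMk (hT i)

theorem measurableSet_pointHistory_mark {t r : ℝ≥0} (hr : r ≤ t) (n : ℕ) {U : Set S}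
    (hU : MeasurableSet U) :
    MeasurableSet[pointHistory T X hT hX t] {ω | T n ω ≤ r ∧ X n ω ∈ U} :=
  MeasurableSpace.measurableSet_generateFrom ⟨n, r, U, hr, hU, rfl⟩

theorem measurableSet_pointHistory_time_min (t : ℝ≥0) (r : ℝ≥0∞) (n : ℕ) :
    MeasurableSet[pointHistory T X hT hX t] {ω | T n ω ≤ min r t} := by
  obtain ⟨q, hq⟩ : ∃ q : ℝ≥0, (q : ℝ≥0∞) = min r t :=
    ⟨_, ENNReal.coe_toNNReal (min_lt_of_right_lt ENNReal.coe_lt_top).ne⟩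
  have hqt : q ≤ t := ENNReal.coe_le_coe.1 (hq.trans_le (min_le_right _ _))
  simpa [hq] using measurableSet_pointHistory_mark hT hX hqt n MeasurableSet.univ

theorem measurable_subtype_pointPast_pointHistory {L : Ω → ℝ≥0∞} {n : ℕ}
    (hTL : ∀ i < n, ∀ ω, T i ω ≤ L ω) (t : ℝ≥0) :
    Measurable[(pointHistory T X hT hX t).comap Subtype.val, pointPast T X n]
      (fun w : {ω | L ω ≤ t} => (w : Ω)) := by
  let : MeasurableSpace {ω | L ω ≤ t} := (pointHistory T X hT hX t).comap Subtype.val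
  refine measurable_into_pointPast (fun i hi => ?_) (fun i hi => ?_)
  · refine measurable_of_Iic fun r => ⟨_, measurableSet_pointHistory_time_min hT hX t r i, ?_⟩
    ext ⟨ω, hω⟩
    have : T i ω ≤ t := (hTL i hi ω).trans hω
    simp [this]
  · intro U hU
    refine ⟨_, measurableSet_pointHistory_mark hT hX le_rfl i hU, ?_⟩
    ext ⟨ω, hω⟩
    have : T i ω ≤ t := (hTL i hi ω).trans hω
    simp [this]

theorem measurableSet_predictable_of_forall (𝓕 : Filtration ℝ≥0 mΩ) {g : Ω → ℝ≥0∞} {V : Set Ω}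
    (h : ∀ q : ℝ≥0, MeasurableSet[𝓕 q] {ω | g ω ≤ q ∧ ω ∈ V}) :
    MeasurableSet[𝓕.predictable] {x : ℝ≥0 × Ω | g x.2 < x.1 ∧ x.2 ∈ V} := by
  have hunion : {x : ℝ≥0 × Ω | g x.2 < x.1 ∧ x.2 ∈ V}
      = ⋃ q : ℚ, Ioi (Real.toNNReal q) ×ˢ {ω | g ω ≤ Real.toNNReal q ∧ ω ∈ V} := by
    ext ⟨s, ω⟩
    simp only [mem_ofPred_eq, mem_iUnion, mem_prod, mem_Ioi]
    constructor
    · rintro ⟨hgs, hω⟩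
      obtain ⟨q, -, hgq, hqs⟩ := ENNReal.lt_iff_exists_rat_btwn.1 hgs
      exact ⟨q, ENNReal.coe_lt_coe.1 hqs, hgq.le, hω⟩
    · rintro ⟨q, hqs, hgq, hω⟩
      exact ⟨hgq.trans_lt (ENNReal.coe_lt_coe.2 hqs), hω⟩
  rw [hunion]
  exact @MeasurableSet.iUnion _ _ 𝓕.predictable _ _ fun q =>
    measurableSet_predictable_Ioi_prod (h _)

theorem measurable_fst_predictable (𝓕 : Filtration ℝ≥0 mΩ) :
    Measurable[𝓕.predictable] (Prod.fst : ℝ≥0 × Ω → ℝ≥0) := by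
  let := 𝓕.predictable
  refine measurable_of_Ioi fun r => ?_
  convert measurableSet_predictable_Ioi_prod (𝓕 := 𝓕) (i := r) (@MeasurableSet.univ _ (𝓕 r)) using 1
  ext; simp

theorem measurable_subtype_pointPast_predictable {L : Ω → ℝ≥0∞} {n : ℕ}
    (hTL : ∀ i < n, ∀ ω, T i ω ≤ L ω) :
    Measurable[(pointHistory T X hT hX).predictable.comap Subtype.val, pointPast T X n]
      (fun w : {x : ℝ≥0 × Ω | L x.2 < x.1} => (w : ℝ≥0 × Ω).2) := by
  let : MeasurableSpace {x : ℝ≥0 × Ω | L x.2 < x.1} :=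
    (pointHistory T X hT hX).predictable.comap Subtype.val
  refine measurable_into_pointPast (fun i hi => ?_) (fun i hi => ?_)
  · refine measurable_of_Iic fun r => ⟨_, measurableSet_predictable_of_forall _ (g := T i)
      (V := {ω | T i ω ≤ r}) fun q => ?_, ?_⟩
    · convert measurableSet_pointHistory_time_min hT hX q r i using 1
      ext ω; simp [and_comm]
    · ext ⟨⟨s, ω⟩, hω⟩
      have : T i ω < s := (hTL i hi ω).trans_lt hω
      simp [this]
  · intro U hU
    refine ⟨_, measurableSet_predictable_of_forall _ (g := T i) (V := X i ⁻¹' U)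
      fun q => measurableSet_pointHistory_mark hT hX le_rfl i hU, ?_⟩
    ext ⟨⟨s, ω⟩, hω⟩
    have : T i ω < s := (hTL i hi ω).trans_lt hω
    simp [this]

theorem measurable_predictable_between {E : Type*} [mE : MeasurableSpace E] {L : Ω → ℝ≥0∞} {n : ℕ}
    (hTL : ∀ i < n, ∀ ω, T i ω ≤ L ω)
    (hL : ∀ q : ℝ≥0, MeasurableSet[pointHistory T X hT hX q] {ω | L ω ≤ q})
    {G : Ω × (E × ℝ≥0) → ℝ≥0∞} (hG : Measurable[(pointPast T X n).prod inferInstance] G) :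
    Measurable[(pointHistory T X hT hX).predictable.prod mE]
      ({x : (ℝ≥0 × Ω) × E | L x.1.2 < x.1.1 ∧ (x.1.1 : ℝ≥0∞) ≤ T n x.1.2}.indicator
        fun x => G (x.1.2, (x.2, x.1.1))) := by
  let mY : MeasurableSpace (ℝ≥0 × Ω) := (pointHistory T X hT hX).predictable
  have hafter : MeasurableSet {x : ℝ≥0 × Ω | L x.2 < x.1} := by
    simpa using measurableSet_predictable_of_forall (pointHistory T X hT hX) (g := L) (V := univ)
      (by simpa using hL)
  have hbefore : MeasurableSet {x : ℝ≥0 × Ω | (x.1 : ℝ≥0∞) ≤ T n x.2} := by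
    have h := measurableSet_predictable_of_forall (pointHistory T X hT hX) (g := T n) (V := univ)
      (fun q => measurableSet_pointHistory_mark hT hX le_rfl n MeasurableSet.univ)
    convert h.compl using 1
    ext; simp
  let W : Set ((ℝ≥0 × Ω) × E) :=
    {x : (ℝ≥0 × Ω) × E | L x.1.2 < x.1.1 ∧ (x.1.1 : ℝ≥0∞) ≤ T n x.1.2}
  have hW : MeasurableSet W := measurable_fst (hafter.inter hbefore)
  have hsub : Measurable[_, pointPast T X n] (fun w : W => w.1.1.2) :=
    (measurable_subtype_pointPast_predictable hT hX hTL).comp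
      (f := fun w : W => (⟨w.1.1, w.2.1⟩ : {x : ℝ≥0 × Ω | L x.2 < x.1}))
      (Measurable.subtype_mk (measurable_fst.comp measurable_subtype_coe))
  let mZ : MeasurableSpace (Ω × (E × ℝ≥0)) := (pointPast T X n).prod inferInstance
  refine measurable_indicator_comp_of_subtype (f := fun x : (ℝ≥0 × Ω) × E => (x.1.2, (x.2, x.1.1)))
    hW ?_ hG
  refine @Measurable.prodMk _ _ _ _ (pointPast T X n) _ _ _ hsub ?_
  exact (measurable_snd.comp measurable_subtype_coe).prodMk
    ((measurable_fst_predictable _).comp (measurable_fst.comp measurable_subtype_coe))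

theorem exists_pointPast_inter_eq {L : Ω → ℝ≥0∞} {n : ℕ} (hmono : Monotone T) {t : ℝ≥0}
    {A : Set Ω} (hA : MeasurableSet[pointHistory T X hT hX t] A) :
    ∃ B, MeasurableSet[pointPast T X n] B ∧
      ∀ ω, L ω ≤ t → (t : ℝ≥0∞) < T n ω → (ω ∈ A ↔ ω ∈ B) := by
  induction A, hA using MeasurableSpace.generateFrom_induction with
  | hC A hA _ =>
    obtain ⟨i, r, U, hr, hU, rfl⟩ := hA
    by_cases hi : i < n
    · refine ⟨{ω | T i ω ≤ r ∧ X i ω ∈ U}, ?_, fun _ _ _ => Iff.rfl⟩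
      exact @MeasurableSet.inter _ (pointPast T X n) _ _
        (measurable_pointPast_time hi measurableSet_Iic) (measurable_pointPast_mark hi hU)
    · refine ⟨∅, @MeasurableSet.empty _ (pointPast T X n), fun ω _ h => ?_⟩
      have hri : (r : ℝ≥0∞) < T i ω :=
        (ENNReal.coe_le_coe.2 hr).trans_lt (h.trans_le (hmono (not_lt.1 hi) ω))
      simp [hri.not_ge]
  | empty => exact ⟨∅, @MeasurableSet.empty _ (pointPast T X n), fun _ _ _ => Iff.rfl⟩
  | compl A _ ih =>
    obtain ⟨B, hB, h⟩ := ih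
    exact ⟨Bᶜ, hB.compl, fun ω hL hT => not_congr (h ω hL hT)⟩
  | iUnion A _ ih =>
    choose B hB h using ih
    refine ⟨⋃ i, B i, @MeasurableSet.iUnion _ _ (pointPast T X n) _ _ hB, fun ω hL hT => ?_⟩
    simp only [mem_iUnion]
    exact exists_congr fun i => h i ω hL hT

end PointHistory

section PredictableRectangles

variable {Ω E : Type*} [mΩ : MeasurableSpace Ω] [mE : MeasurableSpace E] (𝓕 : Filtration ℝ≥0 mΩ)

theorem predictable_le_prod :
    𝓕.predictable ≤ (inferInstance : MeasurableSpace (ℝ≥0 × Ω)) := by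
  refine measurableSpace_le_predictable_of_measurableSet (fun A hA => ?_) (fun i A hA => ?_)
  · exact (measurableSet_singleton _).prod (𝓕.le _ _ hA)
  · exact measurableSet_Ioi.prod (𝓕.le _ _ hA)

theorem predictable_prod_le :
    𝓕.predictable.prod mE ≤ (inferInstance : MeasurableSpace ((ℝ≥0 × Ω) × E)) :=
  sup_le_sup (MeasurableSpace.comap_mono (predictable_le_prod 𝓕)) le_rfl

/-- The bounded predictable rectangles: a π-system that generates the predictable σ-algebra and
from which `[0, ∞) × Ω` is exhausted by sets of finite measure. -/
def predictableRectangles : Set (Set (ℝ≥0 × Ω)) :=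
  {s | ∃ A, MeasurableSet[𝓕 ⊥] A ∧ s = {⊥} ×ˢ A} ∪
    {s | ∃ i j A, MeasurableSet[𝓕 i] A ∧ s = Ioc i j ×ˢ A}

theorem isPiSystem_predictableRectangles : IsPiSystem (predictableRectangles 𝓕) := by
  have not_bot_mem_Ioc {i j : ℝ≥0} : (⊥ : ℝ≥0) ∉ Ioc i j := fun h => not_lt_bot h.1
  rintro _ (⟨A, hA, rfl⟩ | ⟨i, j, A, hA, rfl⟩) _ (⟨B, hB, rfl⟩ | ⟨i', j', B, hB, rfl⟩)
    ⟨⟨s, ω⟩, hs, hs'⟩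
  · exact Or.inl ⟨A ∩ B, hA.inter hB, by rw [prod_inter_prod, inter_self]⟩
  · exact (not_bot_mem_Ioc (mem_singleton_iff.1 hs.1 ▸ hs'.1)).elim
  · exact (not_bot_mem_Ioc (mem_singleton_iff.1 hs'.1 ▸ hs.1)).elim
  · exact Or.inr ⟨i ⊔ i', j ⊓ j', A ∩ B,
      (𝓕.mono le_sup_left _ hA).inter (𝓕.mono le_sup_right _ hB),
      by rw [prod_inter_prod, Ioc_inter_Ioc]⟩

theorem generateFrom_predictableRectangles :
    MeasurableSpace.generateFrom (predictableRectangles 𝓕) = 𝓕.predictable := by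
  refine (MeasurableSpace.generateFrom_le ?_).antisymm
    (measurableSpace_le_predictable_of_measurableSet (fun A hA => ?_) fun i A hA => ?_)
  · rintro _ (⟨A, hA, rfl⟩ | ⟨i, j, A, hA, rfl⟩)
    exacts [measurableSet_predictable_singleton_bot_prod hA,
      measurableSet_predictable_Ioc_prod i j hA]
  · exact MeasurableSpace.measurableSet_generateFrom (Or.inl ⟨A, hA, rfl⟩)
  · have hunion : Ioi i ×ˢ A = ⋃ n : ℕ, Ioc i (n : ℝ≥0) ×ˢ A := by
      rw [← iUnion_prod_const, iUnion_Ioc_eq_Ioi_self_iff.2 fun x _ => exists_nat_ge x]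
    rw [hunion]
    exact MeasurableSet.iUnion fun n =>
      MeasurableSpace.measurableSet_generateFrom (Or.inr ⟨i, n, A, hA, rfl⟩)

theorem trim_predictable_prod_eq {Q Q' : Measure ((ℝ≥0 × Ω) × E)}
    (hzero : Q (({0} ×ˢ univ) ×ˢ univ) = 0) (hzero' : Q' (({0} ×ˢ univ) ×ˢ univ) = 0)
    (hfin : ∀ T, Q ((Ioc 0 T ×ˢ univ) ×ˢ univ) < ∞)
    (heq : ∀ i j A B, MeasurableSet[𝓕 i] A → MeasurableSet B →
      Q ((Ioc i j ×ˢ A) ×ˢ B) = Q' ((Ioc i j ×ˢ A) ×ˢ B)) :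
    Q.trim (predictable_prod_le 𝓕) = Q'.trim (predictable_prod_le 𝓕) := by
  let exhaustion : ℕ → Set (ℝ≥0 × Ω)
    | 0 => {⊥} ×ˢ univ
    | n + 1 => Ioc ⊥ (n : ℝ≥0) ×ˢ univ
  have hmem : ∀ n, exhaustion n ∈ predictableRectangles 𝓕
    | 0 => Or.inl ⟨univ, .univ, rfl⟩
    | n + 1 => Or.inr ⟨⊥, n, univ, .univ, rfl⟩
  have hcover : ⋃ n, exhaustion n = univ := eq_univ_of_forall fun ⟨s, ω⟩ => by
    obtain ⟨n, hn⟩ := exists_nat_ge s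
    rcases eq_or_ne s ⊥ with rfl | hs
    exacts [mem_iUnion.2 ⟨0, rfl, trivial⟩,
      mem_iUnion.2 ⟨n + 1, ⟨bot_lt_iff_ne_bot.2 hs, hn⟩, trivial⟩]
  have hmeas {J : Set (ℝ≥0 × Ω)} (hJ : J ∈ predictableRectangles 𝓕) {B : Set E}
      (hB : MeasurableSet B) : MeasurableSet[𝓕.predictable.prod mE] (J ×ˢ B) :=
    @MeasurableSet.prod _ _ 𝓕.predictable _ _ _ (generateFrom_predictableRectangles 𝓕 ▸
      MeasurableSpace.measurableSet_generateFrom hJ) hB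
  refine @Measure.ext_of_generateFrom_of_iUnion _ (𝓕.predictable.prod mE) _ _
    (image2 (· ×ˢ ·) (predictableRectangles 𝓕) {B : Set E | MeasurableSet B})
    (fun n => exhaustion n ×ˢ univ) (@generateFrom_eq_prod _ _ 𝓕.predictable _ _ _
      (generateFrom_predictableRectangles 𝓕) MeasurableSpace.generateFrom_measurableSet
      ⟨exhaustion, hmem, hcover⟩ isCountablySpanning_measurableSet).symm
    ((isPiSystem_predictableRectangles 𝓕).prod MeasurableSpace.isPiSystem_measurableSet)
    ?_ (fun n => mem_image2_of_mem (hmem n) .univ) (fun n => ?_) ?_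
  · rw [← iUnion_prod_const, hcover, univ_prod_univ]
  · rw [trim_measurableSet_eq _ (hmeas (hmem n) .univ)]
    exact n.casesOn (hzero.trans_lt ENNReal.zero_lt_top).ne fun n => (hfin n).ne
  · rintro _ ⟨J, hJ, B, hB, rfl⟩
    rw [trim_measurableSet_eq _ (hmeas hJ hB), trim_measurableSet_eq _ (hmeas hJ hB)]
    rcases hJ with ⟨A, _, rfl⟩ | ⟨i, j, A, hA, rfl⟩
    · have hsub : ({⊥} ×ˢ A) ×ˢ B ⊆ (({0} ×ˢ univ) ×ˢ univ : Set ((ℝ≥0 × Ω) × E)) :=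
        prod_mono (prod_mono_right (subset_univ A)) (subset_univ B)
      exact (measure_mono_null hsub hzero).trans (measure_mono_null hsub hzero').symm
    · exact heq i j A B hA hB

end PredictableRectangles

section Intensity

theorem lintegral_withDensity_prod {Ω E : Type*} [MeasurableSpace Ω] [MeasurableSpace E]
    {P : Measure Ω} [SFinite P] {ν : Measure E} [SFinite ν] {rate : E → ℝ≥0 → Ω → ℝ≥0}
    (hrate : Measurable fun x : (ℝ≥0 × Ω) × E => rate x.2 x.1.1 x.1.2)
    {H : (ℝ≥0 × Ω) × E → ℝ≥0∞} (hH : Measurable H) :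
    ∫⁻ x, H x ∂(((lebesgueNN.prod P).prod ν).withDensity
        fun x => (rate x.2 x.1.1 x.1.2 : ℝ≥0∞))
      = ∫⁻ ω, ∫⁻ s, ∫⁻ u, H ((s, ω), u) * (rate u s ω : ℝ≥0∞) ∂ν ∂lebesgueNN ∂P := by
  have hmul := hrate.coe_nnreal_ennreal.mul hH
  rw [lintegral_withDensity_eq_lintegral_mul _ hrate.coe_nnreal_ennreal hH,
    lintegral_prod _ hmul.aemeasurable, lintegral_prod_symm' _ hmul.lintegral_prod_right']
  simp only [Pi.mul_apply, mul_comm]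

theorem lintegral_indicator_prod_mul {Ω E : Type*} [MeasurableSpace Ω] [MeasurableSpace E]
    {P : Measure Ω} {ν : Measure E} (rate : E → ℝ≥0 → Ω → ℝ≥0) {A : Set Ω} {J : Set ℝ≥0}
    {B : Set E} (hA : MeasurableSet A) (hJ : MeasurableSet J) (hB : MeasurableSet B) :
    ∫⁻ ω, ∫⁻ s, ∫⁻ u, ((J ×ˢ A) ×ˢ B).indicator 1 ((s, ω), u) * (rate u s ω : ℝ≥0∞)
        ∂ν ∂lebesgueNN ∂P
      = ∫⁻ ω in A, ∫⁻ s in J, ∫⁻ u in B, (rate u s ω : ℝ≥0∞) ∂ν ∂lebesgueNN ∂P := by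
  classical
  simp_rw [← lintegral_indicator hA, ← lintegral_indicator hJ, ← lintegral_indicator hB]
  refine lintegral_congr fun ω => ?_
  by_cases hω : ω ∈ A
  · rw [indicator_of_mem hω]
    refine lintegral_congr fun s => ?_
    by_cases hs : s ∈ J
    · simp [indicator_apply, hω, hs]
    · simp [hs]
  · simp [hω]

theorem setLIntegral_eq_mul_of_indep {Ω : Type*} {𝓖 𝓖' mΩ : MeasurableSpace Ω} {P : Measure Ω}
    (h𝓖 : 𝓖 ≤ mΩ) (h𝓖' : 𝓖' ≤ mΩ) (hind : Indep 𝓖 𝓖' P) {f : Ω → ℝ≥0∞}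
    (hf : Measurable[𝓖] f) {A : Set Ω} (hA : MeasurableSet[𝓖'] A) :
    ∫⁻ ω in A, f ω ∂P = P A * ∫⁻ ω, f ω ∂P := by
  have hmul := lintegral_mul_indicator_eq_lintegral_mul_lintegral_indicator h𝓖 1 (h𝓖' A hA)
    (indepSets_of_indepSets_of_le_right hind (singleton_subset_iff.2 hA)) hf
  rw [lintegral_indicator_const (h𝓖' A hA), one_mul, mul_comm] at hmul
  rw [← hmul, ← lintegral_indicator (h𝓖' A hA)]
  simp [indicator]

end Intensity

theorem IsPoissonRandomMeasure.lintegral_apply {Ω S : Type*} [MeasurableSpace Ω]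
    [MeasurableSpace S] {P : Measure Ω} {X : Ω → Measure S} {μ : Measure S}
    (h : IsPoissonRandomMeasure P X μ) {B : Set S} (hB : MeasurableSet B) (hfin : μ B < ∞)
    (hX : Measurable fun ω => X ω B) : ∫⁻ ω, X ω B ∂P = μ B := by
  rw [← lintegral_map (f := fun x => x) measurable_id' hX, h.law B hB hfin,
    lintegral_map measurable_id' (by fun_prop),
    lintegral_natCast_poissonMeasure, ENNReal.coe_toNNReal hfin.ne]

/-- The measurability and integrability assumptions on the intensities of the mother-quake model. -/
structure RegularRates {E : Type*} [MeasurableSpace E] (ν : Measure E) (gam eps : E → ℝ≥0 → ℝ≥0)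
    (lam : E → ℝ≥0 → E × ℝ≥0 → ℝ≥0) : Prop where
  gam_meas : Measurable fun x : E × ℝ≥0 => gam x.1 x.2
  eps_meas : Measurable fun x : E × ℝ≥0 => eps x.1 x.2
  lam_meas : Measurable fun x : E × ℝ≥0 × (E × ℝ≥0) => lam x.1 x.2.1 x.2.2
  gam_int : ∀ T : ℝ≥0, ∫⁻ s in Iic T, ∫⁻ u, (gam u s : ℝ≥0∞) ∂ν ∂lebesgueNN < ∞
  eps_int : ∀ T : ℝ≥0, ∫⁻ s in Iic T, ∫⁻ u, (eps u s : ℝ≥0∞) ∂ν ∂lebesgueNN < ∞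
  lam_int : ∀ (y : E × ℝ≥0) (T : ℝ≥0),
    ∫⁻ s in Ioc y.2 T, ∫⁻ u, (lam u s y : ℝ≥0∞) ∂ν ∂lebesgueNN < ∞

namespace QuakeProcess

variable {Ω E : Type*} [mΩ : MeasurableSpace Ω] [mE : MeasurableSpace E] (M : QuakeProcess Ω E)
  {P : Measure Ω} {ν : Measure E} {gam eps : E → ℝ≥0 → ℝ≥0}
  {lam : E → ℝ≥0 → E × ℝ≥0 → ℝ≥0} {p : ℝ≥0}

section Labels

theorem measurable_point (n : ℕ) : Measurable (M.point n) :=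
  (M.measurable_mark n).prodMk (M.measurable_time n).ennreal_toNNReal

theorem monotone_time : Monotone M.time :=
  monotone_nat_of_le_succ fun n ω => M.time_mono n ω

theorem time_lt_time {i n : ℕ} (h : i < n) {ω : Ω} (hfin : M.time i ω ≠ ∞) :
    M.time i ω < M.time n ω :=
  (M.time_lt i ω hfin).trans_le (M.monotone_time h ω)

theorem time_le_lastTime {i n : ℕ} (h : i < n) (ω : Ω) : M.time i ω ≤ M.lastTime n ω := by
  cases n with
  | zero => omega
  | succ n => exact M.monotone_time (Nat.lt_succ_iff.1 h) ω

theorem lastTime_lt_time {n : ℕ} {ω : Ω} (h : M.lastTime n ω ≠ ∞) :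
    M.lastTime n ω < M.time n ω := by
  cases n with
  | zero => exact M.time_pos ω
  | succ n => exact M.time_lt n ω h

theorem lastTime_le_time (n : ℕ) (ω : Ω) : M.lastTime n ω ≤ M.time n ω := by
  cases n with
  | zero => exact zero_le
  | succ n => exact M.time_mono n ω

theorem measurable_lastTime (n : ℕ) : Measurable (M.lastTime n) := by
  cases n with
  | zero => exact measurable_const
  | succ n => exact M.measurable_time n

theorem countBefore_eq {n : ℕ} {s : ℝ≥0} {ω : Ω} (hlast : M.lastTime n ω < s)
    (hnext : (s : ℝ≥0∞) ≤ M.time n ω) : M.countBefore s ω = n := by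
  rw [countBefore, ← ncard_Iio_nat n]
  congr 1
  ext k
  refine ⟨fun h => ?_, fun h => (M.time_le_lastTime h ω).trans_lt hlast⟩
  by_contra hk
  exact absurd (hnext.trans (M.monotone_time (not_lt.1 hk) ω)) (not_le.2 h)

theorem count_eq {n : ℕ} {t : ℝ≥0} {ω : Ω} (hlast : M.lastTime n ω ≤ t)
    (hnext : (t : ℝ≥0∞) < M.time n ω) : M.count t ω = n := by
  rw [count, ← ncard_Iio_nat n]
  congr 1
  ext k
  refine ⟨fun h => ?_, fun h => (M.time_le_lastTime h ω).trans hlast⟩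
  by_contra hk
  exact absurd (hnext.trans_le (M.monotone_time (not_lt.1 hk) ω)) (not_lt.2 h)

theorem lt_of_motherAfter_eq_some {n i : ℕ} {ω : Ω} (h : M.motherAfter n ω = some i) : i < n := by
  induction n generalizing i with
  | zero => simp [motherAfter] at h
  | succ n ih =>
    rw [motherAfter] at h
    grind

/-- The possible values of the active mother after `n` quakes; `none` means that no cluster is
active. -/
def states (n : ℕ) : Finset (Option ℕ) := (Finset.range n).insertNone

theorem motherAfter_mem_states (n : ℕ) (ω : Ω) : M.motherAfter n ω ∈ states n := by
  rcases h : M.motherAfter n ω with _ | i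
  · simp [states]
  · simp [states, M.lt_of_motherAfter_eq_some h]

theorem sum_states {R : Type*} [AddCommMonoid R] (n : ℕ) (f : Option ℕ → R) :
    ∑ m ∈ states n, f m = f none + ∑ i ∈ Finset.range n, f (some i) := by
  simp [states]

/-- The intensity of cluster quakes, given the active mother. -/
def clusterRate (eps : E → ℝ≥0 → ℝ≥0) (lam : E → ℝ≥0 → E × ℝ≥0 → ℝ≥0) :
    Option ℕ → Ω → E → ℝ≥0 → ℝ≥0
  | none, _, u, s => eps u s
  | some i, ω, u, s => lam u s (M.point i ω)

theorem clusterIntensity_eq (eps : E → ℝ≥0 → ℝ≥0) (lam : E → ℝ≥0 → E × ℝ≥0 → ℝ≥0) {n : ℕ}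
    {s : ℝ≥0} {ω : Ω} (hlast : M.lastTime n ω < s)
    (hnext : (s : ℝ≥0∞) ≤ M.time n ω) (u : E) :
    M.clusterIntensity lam eps u s ω = M.clusterRate eps lam (M.motherAfter n ω) ω u s := by
  rw [clusterIntensity, DLeft, M.countBefore_eq hlast hnext]
  rcases h : M.motherAfter n ω with _ | i
  · simp [activeOf, clusterRate]
  · have hi := M.lt_of_motherAfter_eq_some h
    rw [Finset.sum_eq_single i]
    · simp [activeOf, clusterRate, thetaLeft, M.countBefore_eq hlast hnext, h, thetaOf]
    · intro j _ hj
      simp [thetaLeft, M.countBefore_eq hlast hnext, h, thetaOf, hj.symm]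
    · simp [hi]

/-- The event that quake `n` occurs and has label `b`. -/
def labelSet (b : Bool) (n : ℕ) : Set Ω := {ω | M.time n ω ≠ ∞ ∧ M.inCluster n ω = b}

theorem measurableSet_labelSet (b : Bool) (n : ℕ) : MeasurableSet (M.labelSet b n) :=
  ((M.measurable_time n (measurableSet_singleton ∞)).compl).inter
    (M.measurable_inCluster n (measurableSet_singleton b))

theorem lintegral_counting (b : Bool) (ω : Ω) {f : E × ℝ≥0 → ℝ≥0∞} (hf : Measurable f) :
    ∫⁻ x, f x ∂(M.counting b ω)
      = ∑' n, (M.labelSet b n).indicator (fun ω => f (M.point n ω)) ω := by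
  rw [counting, lintegral_sum_measure]
  congr 1
  ext n
  by_cases h : M.time n ω ≠ ∞ ∧ M.inCluster n ω = b
  · rw [if_pos h, lintegral_dirac' _ hf, indicator_of_mem (show ω ∈ M.labelSet b n from h)]
  · rw [if_neg h, indicator_of_notMem (show ω ∉ M.labelSet b n from h)]
    simp

theorem measurable_counting_apply (b : Bool) {B : Set (E × ℝ≥0)} (hB : MeasurableSet B) :
    Measurable fun ω => M.counting b ω B := by
  simp_rw [← lintegral_indicator_one hB, M.lintegral_counting b _ (measurable_one.indicator hB)]
  exact Measurable.tsum fun n => Measurable.indicator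
    ((measurable_one.indicator hB).comp (M.measurable_point n)) (M.measurableSet_labelSet b n)

/-- Quake `n` as a point of the product of the predictable base with the mark space. -/
def basePoint (n : ℕ) (ω : Ω) : (ℝ≥0 × Ω) × E := (((M.time n ω).toNNReal, ω), M.mark n ω)

theorem measurable_basePoint (n : ℕ) : Measurable (M.basePoint n) :=
  ((M.measurable_time n).ennreal_toNNReal.prodMk measurable_id).prodMk (M.measurable_mark n)

theorem lintegral_lintegral_counting (P : Measure Ω) (b : Bool) {H : (ℝ≥0 × Ω) × E → ℝ≥0∞}
    (hH : Measurable H) :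
    ∫⁻ ω, ∫⁻ x, H ((x.2, ω), x.1) ∂(M.counting b ω) ∂P
      = ∑' n, ∫⁻ ω in M.labelSet b n, H (M.basePoint n ω) ∂P := by
  have hsum (ω : Ω) : ∫⁻ x, H ((x.2, ω), x.1) ∂(M.counting b ω)
      = ∑' n, (M.labelSet b n).indicator (fun ω => H (M.basePoint n ω)) ω :=
    M.lintegral_counting b ω (f := fun x => H ((x.2, ω), x.1)) (hH.comp (by fun_prop))
  simp_rw [hsum]
  rw [lintegral_tsum fun n => (Measurable.indicator (by exact hH.comp (M.measurable_basePoint n))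
    (M.measurableSet_labelSet b n)).aemeasurable]
  simp_rw [lintegral_indicator (M.measurableSet_labelSet b _)]

end Labels

section CampbellMeasure

/-- The Campbell measure of the quakes with label `b`: the mean number of such quakes in a set of
(time, outcome, mark) triples. -/
noncomputable def campbell (P : Measure Ω) (b : Bool) : Measure ((ℝ≥0 × Ω) × E) :=
  Measure.sum fun n => (P.restrict (M.labelSet b n)).map (M.basePoint n)

theorem lintegral_campbell (P : Measure Ω) (b : Bool) {H : (ℝ≥0 × Ω) × E → ℝ≥0∞}
    (hH : Measurable H) :
    ∫⁻ x, H x ∂(M.campbell P b) = ∫⁻ ω, ∫⁻ x, H ((x.2, ω), x.1) ∂(M.counting b ω) ∂P := by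
  rw [campbell, lintegral_sum_measure, M.lintegral_lintegral_counting P b hH]
  simp_rw [lintegral_map hH (M.measurable_basePoint _)]

theorem campbell_prod (P : Measure Ω) (b : Bool) {A : Set Ω} {J : Set ℝ≥0} {B : Set E}
    (hA : MeasurableSet A) (hJ : MeasurableSet J) (hB : MeasurableSet B) :
    M.campbell P b ((J ×ˢ A) ×ˢ B) = ∫⁻ ω in A, M.counting b ω (B ×ˢ J) ∂P := by
  have hAJB : MeasurableSet ((J ×ˢ A) ×ˢ B) := (hJ.prod hA).prod hB
  rw [← lintegral_indicator_one hAJB, M.lintegral_campbell P b (measurable_one.indicator hAJB),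
    ← lintegral_indicator hA]
  refine lintegral_congr fun ω => ?_
  by_cases hω : ω ∈ A
  · rw [indicator_of_mem hω, ← lintegral_indicator_one (hB.prod hJ)]
    exact lintegral_congr fun x => by classical simp [indicator_apply, hω, and_comm]
  · simp [indicator, hω]

theorem campbell_zero (P : Measure Ω) (b : Bool) :
    M.campbell P b (({0} ×ˢ univ) ×ˢ univ) = 0 := by
  have hzero : MeasurableSet (({0} ×ˢ univ) ×ˢ univ : Set ((ℝ≥0 × Ω) × E)) :=
    ((measurableSet_singleton 0).prod .univ).prod .univ
  rw [campbell, Measure.sum_apply _ hzero, ENNReal.tsum_eq_zero]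
  intro n
  rw [Measure.map_apply (M.measurable_basePoint n) hzero,
    Measure.restrict_apply (M.measurable_basePoint n hzero)]
  refine measure_mono_null (fun ω hω => ?_) measure_empty
  have htime : (M.time n ω).toNNReal = 0 := hω.1.1.1
  rcases (ENNReal.toNNReal_eq_zero_iff _).1 htime with h0 | htop
  exacts [((M.time_pos ω).trans_le (M.monotone_time (Nat.zero_le n) ω)).ne' h0, hω.2.1 htop]

theorem hasIntensity_counting_of_forall_Ioc {P : Measure Ω} [SFinite P] {ν : Measure E}
    [SFinite ν] {𝓕 : Filtration ℝ≥0 mΩ} {b : Bool} {rate : E → ℝ≥0 → Ω → ℝ≥0}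
    (hrate : Measurable fun x : (ℝ≥0 × Ω) × E => rate x.2 x.1.1 x.1.2)
    (hfin : ∀ T, ∫⁻ ω, ∫⁻ s in Ioc 0 T, ∫⁻ u, (rate u s ω : ℝ≥0∞) ∂ν ∂lebesgueNN ∂P < ∞)
    (heq : ∀ i j A B, MeasurableSet[𝓕 i] A → MeasurableSet B →
      ∫⁻ ω in A, M.counting b ω (B ×ˢ Ioc i j) ∂P
        = ∫⁻ ω in A, ∫⁻ s in Ioc i j, ∫⁻ u in B, (rate u s ω : ℝ≥0∞) ∂ν ∂lebesgueNN ∂P) :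
    HasIntensity P 𝓕 (M.counting b) ν rate := by
  set Q : Measure ((ℝ≥0 × Ω) × E) :=
    ((lebesgueNN.prod P).prod ν).withDensity fun x => (rate x.2 x.1.1 x.1.2 : ℝ≥0∞)
  have hQ {A : Set Ω} {J : Set ℝ≥0} {B : Set E} (hA : MeasurableSet A) (hJ : MeasurableSet J)
      (hB : MeasurableSet B) : Q ((J ×ˢ A) ×ˢ B)
        = ∫⁻ ω in A, ∫⁻ s in J, ∫⁻ u in B, (rate u s ω : ℝ≥0∞) ∂ν ∂lebesgueNN ∂P := by
    have hAJB : MeasurableSet ((J ×ˢ A) ×ˢ B) := (hJ.prod hA).prod hB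
    rw [← lintegral_indicator_one hAJB, lintegral_withDensity_prod hrate
      (measurable_one.indicator hAJB), lintegral_indicator_prod_mul rate hA hJ hB]
  have htrim : Q.trim (predictable_prod_le 𝓕) = (M.campbell P b).trim (predictable_prod_le 𝓕) :=
    trim_predictable_prod_eq 𝓕 (by simp [hQ .univ (measurableSet_singleton 0) .univ])
      (M.campbell_zero P b)
      (fun T => by simpa [hQ .univ measurableSet_Ioc .univ] using hfin T)
      fun i j A B hA hB => by
        rw [hQ (𝓕.le i A hA) measurableSet_Ioc hB,
          M.campbell_prod P b (𝓕.le i A hA) measurableSet_Ioc hB, heq i j A B hA hB]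
  intro H hH
  have hH' := hH.mono (predictable_prod_le 𝓕) le_rfl
  rw [← M.lintegral_campbell P b hH', ← lintegral_withDensity_prod hrate hH',
    ← lintegral_trim (predictable_prod_le 𝓕) hH, ← htrim,
    lintegral_trim (predictable_prod_le 𝓕) hH]

end CampbellMeasure

section SingleQuakes

theorem setLIntegral_single_eq_mul {μ : Measure (E × ℝ≥0)}
    (hpoi : IsPoissonRandomMeasure P M.N μ) {t : ℝ≥0}
    (hcomp : Indep (MeasurableSpace.comap (fun ω => (M.N ω).restrict (univ ×ˢ Ioi t)) inferInstance)
      (M.fullHistory t) P)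
    {A : Set Ω} (hA : MeasurableSet[M.fullHistory t] A) {B : Set E} (hB : MeasurableSet B) {T : ℝ≥0}
    (hfin : μ (B ×ˢ Ioc t T) < ∞) :
    ∫⁻ ω in A, M.N ω (B ×ˢ Ioc t T) ∂P = P A * μ (B ×ˢ Ioc t T) := by
  have hBT : MeasurableSet (B ×ˢ Iic T) := hB.prod measurableSet_Iic
  have hrestrict (ω : Ω) : M.N ω (B ×ˢ Ioc t T)
      = (M.N ω).restrict (univ ×ˢ Ioi t) (B ×ˢ Iic T) := by
    rw [Measure.restrict_apply hBT, prod_inter_prod, inter_univ, inter_comm, Ioi_inter_Iic]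
  have hfuture : MeasurableSpace.comap (fun ω => (M.N ω).restrict (univ ×ˢ Ioi t)) inferInstance
      ≤ mΩ := by
    refine measurable_iff_comap_le.1 (Measure.measurable_of_measurable_coe _ fun S hS => ?_)
    simp_rw [Measure.restrict_apply hS]
    exact M.measurable_counting_apply false (hS.inter (MeasurableSet.univ.prod measurableSet_Ioi))
  rw [← hpoi.lintegral_apply (hB.prod measurableSet_Ioc) hfin
    (M.measurable_counting_apply false (hB.prod measurableSet_Ioc))]
  refine setLIntegral_eq_mul_of_indep hfuture (M.fullHistory.le t) hcomp ?_ hA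
  simp_rw [hrestrict]
  exact (Measure.measurable_coe hBT).comp (comap_measurable _)

theorem hasIntensity_single [IsProbabilityMeasure P] {ν : Measure E} [SigmaFinite ν]
    {gam : E → ℝ≥0 → ℝ≥0} (hgam : Measurable fun x : E × ℝ≥0 => gam x.1 x.2)
    (hgam_int : ∀ T : ℝ≥0, ∫⁻ s in Iic T, ∫⁻ u, (gam u s : ℝ≥0∞) ∂ν ∂lebesgueNN < ∞)
    (hpoi : IsPoissonRandomMeasure P M.N
      ((ν.prod lebesgueNN).withDensity fun x => (gam x.1 x.2 : ℝ≥0∞)))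
    (hcomp : ∀ t : ℝ≥0, Indep
      (MeasurableSpace.comap (fun ω => (M.N ω).restrict (univ ×ˢ Ioi t)) inferInstance)
      (M.fullHistory t) P) :
    HasIntensity P M.fullHistory M.N ν (fun u s _ => gam u s) := by
  have hmean {B : Set E} (hB : MeasurableSet B) (i j : ℝ≥0) :
      (ν.prod lebesgueNN).withDensity (fun x => (gam x.1 x.2 : ℝ≥0∞)) (B ×ˢ Ioc i j)
        = ∫⁻ s in Ioc i j, ∫⁻ u in B, (gam u s : ℝ≥0∞) ∂ν ∂lebesgueNN := by
    rw [withDensity_apply _ (hB.prod measurableSet_Ioc), ← Measure.prod_restrict,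
      lintegral_prod_symm _ hgam.coe_nnreal_ennreal.aemeasurable]
  have hfin (B : Set E) (i j : ℝ≥0) :
      ∫⁻ s in Ioc i j, ∫⁻ u in B, (gam u s : ℝ≥0∞) ∂ν ∂lebesgueNN < ∞ :=
    (lintegral_mono' (Measure.restrict_mono_set _ Ioc_subset_Iic_self)
      fun s => setLIntegral_le_lintegral B _).trans_lt (hgam_int j)
  refine M.hasIntensity_counting_of_forall_Ioc
    (hgam.comp (measurable_snd.prodMk (measurable_fst.comp measurable_fst)))
    (fun T => by simpa using hfin univ 0 T) fun i j A B hA hB => ?_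
  rw [lintegral_const, Measure.restrict_apply_univ, mul_comm, ← hmean hB]
  exact M.setLIntegral_single_eq_mul hpoi (hcomp i) hA hB ((hmean hB i j).trans_lt (hfin B i j))

end SingleQuakes

section Hazard

/-- The mark, label and coin of quake `n`. -/
def fullMark (n : ℕ) (ω : Ω) : E × Bool × Bool := (M.mark n ω, M.inCluster n ω, M.kill n ω)

theorem measurable_fullMark (n : ℕ) : Measurable (M.fullMark n) :=
  (M.measurable_mark n).prodMk ((M.measurable_inCluster n).prodMk (M.measurable_kill n))

/-- The σ-algebra of the times and marks of the first `n` quakes. -/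
abbrev obsPast (n : ℕ) : MeasurableSpace Ω := pointPast M.time M.mark n

/-- The σ-algebra of the times, marks, labels and coins of the first `n` quakes. -/
abbrev fullPast (n : ℕ) : MeasurableSpace Ω := pointPast M.time M.fullMark n

theorem obsPast_le_fullPast (n : ℕ) : M.obsPast n ≤ M.fullPast n := by
  refine pointPast_le_iff.2 fun i hi => ?_
  have hfull : Measurable[M.fullPast n] (M.fullMark i) := measurable_pointPast_mark hi
  have htime : Measurable[M.fullPast n] (M.time i) := measurable_pointPast_time hi
  exact (measurable_fst.comp hfull).prodMk htime

theorem fullPast_le (n : ℕ) : M.fullPast n ≤ mΩ :=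
  pointPast_le M.measurable_time M.measurable_fullMark n

theorem obsPast_le (n : ℕ) : M.obsPast n ≤ mΩ :=
  (M.obsPast_le_fullPast n).trans (M.fullPast_le n)

section Composition

variable {Y : Type*} {mY : MeasurableSpace Y} {f : Y → Ω} {n : ℕ}

theorem measurable_comp_point (hf : Measurable[mY, M.obsPast n] f) {i : ℕ} (hi : i < n) :
    Measurable fun y => M.point i (f y) :=
  ((measurable_pointPast_mark (X := M.mark) hi).comp hf).prodMk
    ((measurable_pointPast_time (X := M.mark) hi).comp hf).ennreal_toNNReal

theorem measurable_comp_lastTime (hf : Measurable[mY, M.obsPast n] f) :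
    Measurable fun y => M.lastTime n (f y) := by
  cases n with
  | zero => exact measurable_const
  | succ n => exact (measurable_pointPast_time (X := M.mark) n.lt_succ_self).comp hf

theorem measurable_comp_clusterRate (h : RegularRates ν gam eps lam)
    (hf : Measurable[mY, M.obsPast n] f) {u : Y → E} {s : Y → ℝ≥0} (hu : Measurable u)
    (hs : Measurable s) {m : Option ℕ} (hm : m ∈ states n) :
    Measurable fun y => M.clusterRate eps lam m (f y) (u y) (s y) := by
  cases m with
  | none => exact h.eps_meas.comp (hu.prodMk hs)
  | some i =>
    have hi : i < n := by simpa [states] using hm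
    exact h.lam_meas.comp (hu.prodMk (hs.prodMk (M.measurable_comp_point hf hi)))

/-- The total intensity of quakes, given the active mother. -/
noncomputable def totalRate (ν : Measure E) (gam eps : E → ℝ≥0 → ℝ≥0)
    (lam : E → ℝ≥0 → E × ℝ≥0 → ℝ≥0) (m : Option ℕ) (ω : Ω) (s : ℝ≥0) : ℝ≥0∞ :=
  ∫⁻ u, (gam u s + M.clusterRate eps lam m ω u s : ℝ≥0) ∂ν

/-- The cumulative intensity of quakes, given the active mother. -/
noncomputable def hazard (ν : Measure E) (gam eps : E → ℝ≥0 → ℝ≥0)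
    (lam : E → ℝ≥0 → E × ℝ≥0 → ℝ≥0) (m : Option ℕ) (ω : Ω) : Measure ℝ≥0 :=
  lebesgueNN.withDensity (M.totalRate ν gam eps lam m ω)

/-- The probability that no quake occurs in `(s, t]`, given the past up to time `s` with the active
mother `m`. -/
noncomputable def survFrom (ν : Measure E) (gam eps : E → ℝ≥0 → ℝ≥0)
    (lam : E → ℝ≥0 → E × ℝ≥0 → ℝ≥0) (m : Option ℕ) (ω : Ω) (s t : ℝ≥0) : ℝ≥0 :=
  (Real.exp (-(M.hazard ν gam eps lam m ω).real (Ioc s t))).toNNReal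

/-- The probability that no quake occurs between the last of the first `n` quakes and time `t`,
given the first `n` quakes and the active mother. -/
noncomputable def surv (ν : Measure E) (gam eps : E → ℝ≥0 → ℝ≥0)
    (lam : E → ℝ≥0 → E × ℝ≥0 → ℝ≥0) (n : ℕ) (m : Option ℕ) (ω : Ω) (t : ℝ≥0) : ℝ≥0 :=
  M.survFrom ν gam eps lam m ω (M.lastTime n ω).toNNReal t

instance (m : Option ℕ) (ω : Ω) : NullSingletonClass (M.hazard ν gam eps lam m ω) :=
  ⟨fun x => withDensity_absolutelyContinuous _ _ (measure_singleton x)⟩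

variable [SigmaFinite ν]

theorem measurable_comp_totalRate (h : RegularRates ν gam eps lam)
    (hf : Measurable[mY, M.obsPast n] f) {s : Y → ℝ≥0}
    (hs : Measurable s) {m : Option ℕ} (hm : m ∈ states n) :
    Measurable fun y => M.totalRate ν gam eps lam m (f y) (s y) := by
  refine Measurable.lintegral_prod_right' (f := fun x : Y × E =>
    ((gam x.2 (s x.1) + M.clusterRate eps lam m (f x.1) x.2 (s x.1) : ℝ≥0) : ℝ≥0∞)) ?_
  refine Measurable.coe_nnreal_ennreal (Measurable.add ?_ ?_)
  · exact h.gam_meas.comp (measurable_snd.prodMk (hs.comp measurable_fst))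
  · exact M.measurable_comp_clusterRate h (hf.comp measurable_fst) measurable_snd
      (hs.comp measurable_fst) hm

theorem measurable_comp_hazard (h : RegularRates ν gam eps lam)
    (hf : Measurable[mY, M.obsPast n] f) {s t : Y → ℝ≥0}
    (hs : Measurable s) (ht : Measurable t) {m : Option ℕ} (hm : m ∈ states n) :
    Measurable fun y => M.hazard ν gam eps lam m (f y) (Ioc (s y) (t y)) := by
  have hindicator (y : Y) : M.hazard ν gam eps lam m (f y) (Ioc (s y) (t y)) = ∫⁻ r,
      ({x : Y × ℝ≥0 | s x.1 < x.2 ∧ x.2 ≤ t x.1}.indicator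
        (fun x => M.totalRate ν gam eps lam m (f x.1) x.2)) (y, r) ∂lebesgueNN := by
    rw [hazard, withDensity_apply _ measurableSet_Ioc, ← lintegral_indicator measurableSet_Ioc]
    rfl
  simp_rw [hindicator]
  refine Measurable.lintegral_prod_right' ((M.measurable_comp_totalRate h (hf.comp measurable_fst)
    measurable_snd hm).indicator ?_)
  exact (measurableSet_lt (f := fun x : Y × ℝ≥0 => s x.1) (hs.comp measurable_fst)
    measurable_snd).inter (measurableSet_le (g := fun x : Y × ℝ≥0 => t x.1) measurable_snd
    (ht.comp measurable_fst))

theorem measurable_comp_survFrom (h : RegularRates ν gam eps lam)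
    (hf : Measurable[mY, M.obsPast n] f) {s t : Y → ℝ≥0} (hs : Measurable s) (ht : Measurable t)
    {m : Option ℕ} (hm : m ∈ states n) :
    Measurable fun y => M.survFrom ν gam eps lam m (f y) (s y) (t y) :=
  (Real.measurable_exp.comp
    (M.measurable_comp_hazard h hf hs ht hm).ennreal_toReal.neg).real_toNNReal

theorem measurable_comp_surv (h : RegularRates ν gam eps lam)
    (hf : Measurable[mY, M.obsPast n] f) {t : Y → ℝ≥0} (ht : Measurable t) {m : Option ℕ}
    (hm : m ∈ states n) : Measurable fun y => M.surv ν gam eps lam n m (f y) (t y) :=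
  M.measurable_comp_survFrom h hf (M.measurable_comp_lastTime hf).ennreal_toNNReal ht hm

end Composition

theorem measurableSet_motherAfter (n : ℕ) (m : Option ℕ) :
    MeasurableSet[M.fullPast n] {ω | M.motherAfter n ω = m} := by
  let _ : MeasurableSpace (Option ℕ) := ⊤
  suffices h : Measurable[M.fullPast n] (M.motherAfter n) from
    h (show MeasurableSet {m} from trivial)
  induction n with
  | zero => exact @measurable_const _ _ _ (M.fullPast 0) none
  | succ n ih =>
    have hmark : Measurable[M.fullPast (n + 1)] (M.fullMark n) :=
      measurable_pointPast_mark n.lt_succ_self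
    have hmother : Measurable[M.fullPast (n + 1)] (M.motherAfter n) :=
      ih.mono (pointPast_mono _ _ n) le_rfl
    have hstep : M.motherAfter (n + 1) = (fun x : Option ℕ × Bool × Bool =>
        match x.2.1, x.1 with
        | false, m => m
        | true, none => some n
        | true, some i => if x.2.2 then none else some i) ∘
          fun ω => (M.motherAfter n ω, (M.fullMark n ω).2) := rfl
    rw [hstep]
    exact (measurable_of_countable _).comp (hmother.prodMk (measurable_snd.comp hmark))

theorem measurableSet_pointHistory_lastTime_le {S : Type*} [MeasurableSpace S] {X : ℕ → Ω → S}
    (hX : ∀ n, Measurable (X n)) (n : ℕ) (t : ℝ≥0) :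
    MeasurableSet[pointHistory M.time X M.measurable_time hX t] {ω | M.lastTime n ω ≤ t} := by
  cases n with
  | zero => simp [lastTime]
  | succ n => simpa [lastTime] using
      measurableSet_pointHistory_mark M.measurable_time hX (le_refl t) n MeasurableSet.univ

/-- The time interval between the last of the first `n` quakes and the next one. -/
def gap (n : ℕ) (ω : Ω) : Set ℝ≥0 := {s | M.lastTime n ω < s ∧ (s : ℝ≥0∞) ≤ M.time n ω}

theorem measurableSet_gap (n : ℕ) (ω : Ω) : MeasurableSet (M.gap n ω) :=
  (measurableSet_lt measurable_const measurable_coe_nnreal_ennreal).inter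
    (measurableSet_le measurable_coe_nnreal_ennreal measurable_const)

theorem toNNReal_time_mem_gap_iff {k n : ℕ} {ω : Ω} (hk : M.time k ω ≠ ∞) :
    (M.time k ω).toNNReal ∈ M.gap n ω ↔ k = n := by
  simp only [gap, mem_ofPred_eq, ENNReal.coe_toNNReal hk]
  constructor
  · rintro ⟨hlast, hnext⟩
    refine le_antisymm (not_lt.1 fun h => ?_) (not_lt.1 fun h => ?_)
    · exact (M.time_lt_time h (ne_top_of_le_ne_top hk (M.monotone_time h.le ω))).not_ge hnext
    · exact (M.time_le_lastTime h ω).not_gt hlast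
  · rintro rfl
    exact ⟨M.lastTime_lt_time (ne_top_of_le_ne_top hk (M.lastTime_le_time k ω)), le_rfl⟩

theorem setLIntegral_labelSet_of_hasIntensity {P : Measure Ω} {ν : Measure E} {b : Bool}
    {κ : E → ℝ≥0 → Ω → ℝ≥0} (hκ : HasIntensity P M.fullHistory (M.counting b) ν κ) (n : ℕ)
    {G : Ω × (E × ℝ≥0) → ℝ≥0∞} (hG : Measurable[(M.fullPast n).prod inferInstance] G) :
    ∫⁻ ω in M.labelSet b n, G (ω, M.point n ω) ∂P
      = ∫⁻ ω, ∫⁻ s in M.gap n ω, ∫⁻ u, G (ω, (u, s)) * κ u s ω ∂ν ∂lebesgueNN ∂P := by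
  set inGap : Set ((ℝ≥0 × Ω) × E) := {x | x.1.1 ∈ M.gap n x.1.2}
  set H : (ℝ≥0 × Ω) × E → ℝ≥0∞ := inGap.indicator fun x => G (x.1.2, (x.2, x.1.1)) with hH
  have hHmeas : Measurable[M.fullHistory.predictable.prod mE] H :=
    measurable_predictable_between M.measurable_time M.measurable_fullMark
      (fun i hi ω => M.time_le_lastTime hi ω)
      (M.measurableSet_pointHistory_lastTime_le M.measurable_fullMark n) hG
  have hmain := hκ H hHmeas
  rw [M.lintegral_lintegral_counting P b (hHmeas.mono (predictable_prod_le _) le_rfl),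
    tsum_eq_single n] at hmain
  · convert hmain using 1
    · refine setLIntegral_congr_fun (M.measurableSet_labelSet b n) fun ω hω => ?_
      have hmem : M.basePoint n ω ∈ inGap := (M.toNNReal_time_mem_gap_iff hω.1).2 rfl
      exact (indicator_of_mem hmem fun x => G (x.1.2, (x.2, x.1.1))).symm
    · refine lintegral_congr fun ω => ?_
      rw [← lintegral_indicator (M.measurableSet_gap n ω)]
      refine lintegral_congr fun s => ?_
      by_cases hs : s ∈ M.gap n ω <;> simp [hH, inGap, indicator, hs]
  · intro k hk
    rw [← lintegral_zero (μ := P.restrict (M.labelSet b k))]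
    refine setLIntegral_congr_fun (M.measurableSet_labelSet b k) fun ω hω => ?_
    have hnotMem : M.basePoint k ω ∉ inGap :=
      fun hmem => hk ((M.toNNReal_time_mem_gap_iff hω.1).1 hmem)
    exact indicator_of_notMem hnotMem _

end Hazard

section Survival

theorem measurableSet_time_ne_top (n : ℕ) : MeasurableSet {ω | M.time n ω ≠ ∞} :=
  (M.measurable_time n (measurableSet_singleton ∞)).compl

theorem setLIntegral_labelSet_add (n : ℕ) (f : Ω → ℝ≥0∞) :
    ∫⁻ ω in M.labelSet false n, f ω ∂P + ∫⁻ ω in M.labelSet true n, f ω ∂P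
      = ∫⁻ ω in {ω | M.time n ω ≠ ∞}, f ω ∂P := by
  have hdisj : Disjoint (M.labelSet false n) (M.labelSet true n) :=
    disjoint_left.2 fun ω hfalse htrue => Bool.false_ne_true (hfalse.2.symm.trans htrue.2)
  have hunion : {ω | M.time n ω ≠ ∞} = M.labelSet false n ∪ M.labelSet true n := by
    ext ω
    rcases h : M.inCluster n ω <;> simp [labelSet, h]
  rw [hunion, lintegral_union (M.measurableSet_labelSet true n) hdisj]

theorem totalRate_eq_add (h : RegularRates ν gam eps lam) (m : Option ℕ) (ω : Ω) (s : ℝ≥0) :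
    M.totalRate ν gam eps lam m ω s
      = ∫⁻ u, (gam u s : ℝ≥0∞) ∂ν + ∫⁻ u, (M.clusterRate eps lam m ω u s : ℝ≥0∞) ∂ν := by
  have hgam : Measurable fun u => (gam u s : ℝ≥0∞) :=
    (h.gam_meas.comp (measurable_id.prodMk measurable_const)).coe_nnreal_ennreal
  rw [totalRate, ← lintegral_add_left hgam]
  simp

theorem lintegral_clusterRate_lt_top (h : RegularRates ν gam eps lam) {n : ℕ} {m : Option ℕ}
    {ω : Ω} {t : ℝ≥0} (hm : m ∈ states n) (hL : M.lastTime n ω ≤ t) :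
    ∫⁻ s in Ioc (M.lastTime n ω).toNNReal t, ∫⁻ u, (M.clusterRate eps lam m ω u s : ℝ≥0∞) ∂ν
      ∂lebesgueNN < ∞ := by
  cases m with
  | none => exact (lintegral_mono_set Ioc_subset_Iic_self).trans_lt (h.eps_int t)
  | some i =>
    have hi : i < n := by simpa [states] using hm
    refine (lintegral_mono_set (Ioc_subset_Ioc_left ?_)).trans_lt (h.lam_int (M.point i ω) t)
    exact ENNReal.toNNReal_mono (ne_top_of_le_ne_top ENNReal.coe_ne_top hL)
      (M.time_le_lastTime hi ω)

theorem survFrom_self (m : Option ℕ) (ω : Ω) (t : ℝ≥0) :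
    M.survFrom ν gam eps lam m ω t t = 1 := by
  simp [survFrom]

theorem survFrom_le_one (m : Option ℕ) (ω : Ω) (s t : ℝ≥0) :
    M.survFrom ν gam eps lam m ω s t ≤ 1 := by
  simp [survFrom]

variable [SigmaFinite ν]

theorem hazard_ne_top (h : RegularRates ν gam eps lam) {n : ℕ} {m : Option ℕ} {ω : Ω}
    {t : ℝ≥0} (hm : m ∈ states n) (hL : M.lastTime n ω ≤ t) :
    M.hazard ν gam eps lam m ω (Ioc (M.lastTime n ω).toNNReal t) ≠ ∞ := by
  rw [hazard, withDensity_apply _ measurableSet_Ioc]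
  simp_rw [M.totalRate_eq_add h]
  rw [lintegral_add_left (Measurable.lintegral_prod_right' (f := fun x : ℝ≥0 × E =>
    (gam x.2 x.1 : ℝ≥0∞)) (h.gam_meas.comp measurable_swap).coe_nnreal_ennreal)]
  exact (ENNReal.add_lt_top.2 ⟨(lintegral_mono_set Ioc_subset_Iic_self).trans_lt (h.gam_int t),
    M.lintegral_clusterRate_lt_top h hm hL⟩).ne

theorem measurable_surv (h : RegularRates ν gam eps lam) {n : ℕ} {m : Option ℕ}
    (hm : m ∈ states n) (t : ℝ≥0) :
    Measurable[M.fullPast n] fun ω => M.surv ν gam eps lam n m ω t :=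
  M.measurable_comp_surv h (measurable_id'' (M.obsPast_le_fullPast n)) measurable_const hm

theorem measurable_setLIntegral_gap (n : ℕ) {f : Ω × ℝ≥0 → ℝ≥0∞} (hf : Measurable f) :
    Measurable fun ω => ∫⁻ s in M.gap n ω, f (ω, s) ∂lebesgueNN := by
  have hgap : MeasurableSet {x : Ω × ℝ≥0 | x.2 ∈ M.gap n x.1} :=
    (measurableSet_lt (f := fun x : Ω × ℝ≥0 => M.lastTime n x.1)
      ((M.measurable_lastTime n).comp measurable_fst)
      (measurable_coe_nnreal_ennreal.comp measurable_snd)).inter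
    (measurableSet_le (g := fun x : Ω × ℝ≥0 => M.time n x.1)
      (measurable_coe_nnreal_ennreal.comp measurable_snd)
      ((M.measurable_time n).comp measurable_fst))
  simp_rw [← lintegral_indicator (M.measurableSet_gap n _)]
  exact Measurable.lintegral_prod_right' (hf.indicator hgap)

theorem setLIntegral_time_ne_top (h : RegularRates ν gam eps lam)
    (hN : HasIntensity P M.fullHistory M.N ν (fun u s _ => gam u s))
    (hC : HasIntensity P M.fullHistory M.C ν (M.clusterIntensity lam eps))
    (n : ℕ) {g : Ω × ℝ≥0 → ℝ≥0∞} (hg : Measurable[(M.fullPast n).prod inferInstance] g) :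
    ∫⁻ ω in {ω | M.time n ω ≠ ∞}, g (ω, (M.time n ω).toNNReal) ∂P
      = ∫⁻ ω, ∫⁻ s in M.gap n ω, g (ω, s) ∂(M.hazard ν gam eps lam (M.motherAfter n ω) ω) ∂P := by
  have hgm : Measurable g :=
    hg.mono (sup_le_sup (MeasurableSpace.comap_mono (M.fullPast_le n)) le_rfl) le_rfl
  have hG : Measurable[(M.fullPast n).prod inferInstance]
      fun x : Ω × (E × ℝ≥0) => g (x.1, x.2.2) := by
    let _ := M.fullPast n
    exact hg.comp (measurable_fst.prodMk (measurable_snd.comp measurable_snd))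
  have hsingle : Measurable fun x : Ω × ℝ≥0 => ∫⁻ u, g x * gam u x.2 ∂ν :=
    Measurable.lintegral_prod_right' (f := fun x : (Ω × ℝ≥0) × E => g x.1 * gam x.2 x.1.2)
      ((hgm.comp measurable_fst).mul (h.gam_meas.comp (measurable_snd.prodMk
        (measurable_snd.comp measurable_fst))).coe_nnreal_ennreal)
  rw [← M.setLIntegral_labelSet_add n]
  refine (congrArg₂ (· + ·) (M.setLIntegral_labelSet_of_hasIntensity hN n hG)
    (M.setLIntegral_labelSet_of_hasIntensity hC n hG)).trans ?_
  rw [← lintegral_add_left (M.measurable_setLIntegral_gap n hsingle)]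
  refine lintegral_congr fun ω => ?_
  have hm := M.motherAfter_mem_states n ω
  have hrate : Measurable (M.totalRate ν gam eps lam (M.motherAfter n ω) ω) :=
    M.measurable_comp_totalRate h (measurable_const (a := ω)) measurable_id hm
  have hsingleω : Measurable fun s => ∫⁻ u, g (ω, s) * gam u s ∂ν :=
    hsingle.comp measurable_prodMk_left
  have hgω : Measurable fun s => g (ω, s) := hgm.comp measurable_prodMk_left
  rw [← lintegral_add_left hsingleω, hazard,
    setLIntegral_withDensity_eq_setLIntegral_mul _ hrate hgω (M.measurableSet_gap n ω)]
  refine setLIntegral_congr_fun (M.measurableSet_gap n ω) fun s hs => ?_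
  have hcluster : Measurable fun u => M.clusterRate eps lam (M.motherAfter n ω) ω u s :=
    M.measurable_comp_clusterRate h (measurable_const (a := ω)) measurable_id measurable_const hm
  have hgam : Measurable fun u => gam u s := h.gam_meas.comp (measurable_id.prodMk measurable_const)
  simp_rw [M.clusterIntensity_eq eps lam hs.1 hs.2]
  rw [lintegral_const_mul _ hgam.coe_nnreal_ennreal,
    lintegral_const_mul _ hcluster.coe_nnreal_ennreal, ← mul_add, ← M.totalRate_eq_add h,
    Pi.mul_apply, mul_comm]

theorem gap_inter_Iic {n : ℕ} {t : ℝ≥0} {ω : Ω} (hL : M.lastTime n ω ≤ t) :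
    M.gap n ω ∩ Iic t
      = Ioc (M.lastTime n ω).toNNReal (min (t : ℝ≥0∞) (M.time n ω)).toNNReal := by
  ext s
  have hmin : min (t : ℝ≥0∞) (M.time n ω) ≠ ∞ := by simp
  rw [mem_Ioc, ← ENNReal.coe_lt_coe, ← ENNReal.coe_le_coe, ENNReal.coe_toNNReal hmin, le_min_iff,
    ENNReal.coe_toNNReal (ne_top_of_le_ne_top ENNReal.coe_ne_top hL), ENNReal.coe_le_coe,
    and_comm (a := s ≤ t), ← and_assoc]
  rfl

theorem lintegral_survFrom_add_surv (h : RegularRates ν gam eps lam) {n : ℕ} {m : Option ℕ}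
    {ω : Ω} {t : ℝ≥0} (hm : m ∈ states n) (hL : M.lastTime n ω ≤ t) :
    ∫⁻ s in M.gap n ω ∩ Iic t, (M.survFrom ν gam eps lam m ω s t : ℝ≥0∞)
        ∂(M.hazard ν gam eps lam m ω) + M.surv ν gam eps lam n m ω t
      = M.survFrom ν gam eps lam m ω (min (t : ℝ≥0∞) (M.time n ω)).toNNReal t := by
  have hmin : min (t : ℝ≥0∞) (M.time n ω) ≠ ∞ := by simp
  rw [M.gap_inter_Iic hL]
  exact lintegral_exp_neg_measureReal_Ioc
    (ENNReal.toNNReal_mono hmin (le_min hL (M.lastTime_le_time n ω)))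
    (ENNReal.toNNReal_mono ENNReal.coe_ne_top (min_le_left _ _)) (M.hazard_ne_top h hm hL)

theorem setLIntegral_survFrom_time (h : RegularRates ν gam eps lam)
    (hN : HasIntensity P M.fullHistory M.N ν (fun u s _ => gam u s))
    (hC : HasIntensity P M.fullHistory M.C ν (M.clusterIntensity lam eps))
    {n : ℕ} {m : Option ℕ} {t : ℝ≥0} (hm : m ∈ states n) {B : Set Ω}
    (hB : MeasurableSet[M.fullPast n] B) (hBm : ∀ ω ∈ B, M.motherAfter n ω = m) :
    ∫⁻ ω in {ω | M.time n ω ≤ t} ∩ B, M.survFrom ν gam eps lam m ω (M.time n ω).toNNReal t ∂P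
      = ∫⁻ ω in B, ∫⁻ s in M.gap n ω ∩ Iic t, M.survFrom ν gam eps lam m ω s t
          ∂(M.hazard ν gam eps lam m ω) ∂P := by
  set g : Ω × ℝ≥0 → ℝ≥0∞ :=
    {x | x.1 ∈ B ∧ x.2 ≤ t}.indicator fun x => M.survFrom ν gam eps lam m x.1 x.2 t with hg
  have hgmeas : Measurable[(M.fullPast n).prod inferInstance] g := by
    let _ : MeasurableSpace (Ω × ℝ≥0) := (M.fullPast n).prod inferInstance
    have hfst : Measurable[_, M.fullPast n] (Prod.fst : Ω × ℝ≥0 → Ω) :=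
      @measurable_fst _ _ (M.fullPast n) _
    have hsnd : Measurable (Prod.snd : Ω × ℝ≥0 → ℝ≥0) := @measurable_snd _ _ (M.fullPast n) _
    refine Measurable.indicator ?_ ((hfst hB).inter (hsnd measurableSet_Iic))
    exact (M.measurable_comp_survFrom h ((measurable_id'' (M.obsPast_le_fullPast n)).comp hfst)
      hsnd measurable_const hm).coe_nnreal_ennreal
  have htime : MeasurableSet ({ω | M.time n ω ≤ t} ∩ B) :=
    (measurableSet_le (M.measurable_time n) measurable_const).inter (M.fullPast_le n _ hB)
  have hsub : {ω | M.time n ω ≤ t} ∩ B ⊆ {ω | M.time n ω ≠ ∞} :=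
    fun ω hω => ne_top_of_le_ne_top ENNReal.coe_ne_top hω.1
  have hmain := M.setLIntegral_time_ne_top h hN hC n hgmeas
  rw [← inter_eq_left.2 hsub, ← setLIntegral_indicator htime,
    ← lintegral_indicator (M.fullPast_le n _ hB)]
  convert hmain using 1
  · refine setLIntegral_congr_fun (M.measurableSet_time_ne_top n) fun ω hω => ?_
    have hle : M.time n ω ≤ t ↔ (M.time n ω).toNNReal ≤ t := by
      rw [← ENNReal.coe_le_coe, ENNReal.coe_toNNReal hω]
    exact indicator_eq_indicator ((and_congr_left' hle).trans and_comm) rfl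
  · refine lintegral_congr fun ω => ?_
    by_cases hω : ω ∈ B
    · rw [indicator_of_mem hω, hBm ω hω, inter_comm, ← setLIntegral_indicator measurableSet_Iic]
      simp [hg, indicator, hω]
    · simp [hg, indicator, hω]

theorem measure_no_quake [IsProbabilityMeasure P] (h : RegularRates ν gam eps lam)
    (hN : HasIntensity P M.fullHistory M.N ν (fun u s _ => gam u s))
    (hC : HasIntensity P M.fullHistory M.C ν (M.clusterIntensity lam eps))
    {n : ℕ} {m : Option ℕ} {t : ℝ≥0} (hm : m ∈ states n) {B : Set Ω}
    (hB : MeasurableSet[M.fullPast n] B)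
    (hBm : ∀ ω ∈ B, M.lastTime n ω ≤ t ∧ M.motherAfter n ω = m) :
    P (B ∩ {ω | (t : ℝ≥0∞) < M.time n ω}) = ∫⁻ ω in B, M.surv ν gam eps lam n m ω t ∂P := by
  have hquake : MeasurableSet {ω | M.time n ω ≤ t} :=
    measurableSet_le (M.measurable_time n) measurable_const
  have hno : MeasurableSet {ω | (t : ℝ≥0∞) < M.time n ω} :=
    measurableSet_lt measurable_const (M.measurable_time n)
  -- With the survival probability up to `t` as test function, the expectations of `hit` on both
  -- sides of the intensity identity cancel: no integral equation has to be solved.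
  set hit : Ω → ℝ≥0∞ := fun ω => M.survFrom ν gam eps lam m ω (M.time n ω).toNNReal t
  have hsplit : ∀ ω ∈ B, ∫⁻ s in M.gap n ω ∩ Iic t, (M.survFrom ν gam eps lam m ω s t : ℝ≥0∞)
        ∂(M.hazard ν gam eps lam m ω) + M.surv ν gam eps lam n m ω t
      = {ω | M.time n ω ≤ t}.indicator hit ω
        + {ω | (t : ℝ≥0∞) < M.time n ω}.indicator 1 ω := by
    intro ω hω
    rw [M.lintegral_survFrom_add_surv h hm (hBm ω hω).1]
    rcases le_or_gt (M.time n ω) t with ht | ht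
    · simp [hit, indicator, ht, ht.not_gt]
    · simp [indicator, ht.not_ge, ht, min_eq_left ht.le, survFrom_self]
  have hfinite : ∫⁻ ω in B, {ω | M.time n ω ≤ t}.indicator hit ω ∂P ≠ ∞ := by
    refine ne_top_of_le_ne_top (measure_ne_top P B) ((lintegral_mono fun ω => ?_).trans
      (setLIntegral_one B).le)
    exact (indicator_le_self _ _ ω).trans
      (ENNReal.coe_le_one_iff.2 (M.survFrom_le_one m ω _ t))
  have hint := setLIntegral_congr_fun (μ := P) (M.fullPast_le n _ hB) hsplit
  rw [lintegral_add_right _ ((M.measurable_surv h hm t).mono (M.fullPast_le n)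
    le_rfl).coe_nnreal_ennreal, lintegral_add_right _ (measurable_one.indicator hno),
    ← M.setLIntegral_survFrom_time h hN hC hm hB fun ω hω => (hBm ω hω).2,
    ← setLIntegral_indicator hquake, lintegral_indicator_one hno,
    Measure.restrict_apply hno, inter_comm] at hint
  exact ((ENNReal.add_right_inj hfinite).1 hint).symm

theorem setLIntegral_no_quake [IsProbabilityMeasure P] (h : RegularRates ν gam eps lam)
    (hN : HasIntensity P M.fullHistory M.N ν (fun u s _ => gam u s))
    (hC : HasIntensity P M.fullHistory M.C ν (M.clusterIntensity lam eps))
    {n : ℕ} {m : Option ℕ} (hm : m ∈ states n) (t : ℝ≥0) {g : Ω → ℝ≥0∞}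
    (hg : Measurable[M.fullPast n] g) :
    ∫⁻ ω in {ω | M.motherAfter n ω = m ∧ M.lastTime n ω ≤ t ∧ (t : ℝ≥0∞) < M.time n ω}, g ω ∂P
      = ∫⁻ ω in {ω | M.motherAfter n ω = m ∧ M.lastTime n ω ≤ t},
          g ω * M.surv ν gam eps lam n m ω t ∂P := by
  set S : Set Ω := {ω | M.motherAfter n ω = m ∧ M.lastTime n ω ≤ t} with hS
  set noQuake : Set Ω := {ω | (t : ℝ≥0∞) < M.time n ω} with hno
  have hSpast : MeasurableSet[M.fullPast n] S :=
    (M.measurableSet_motherAfter n m).inter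
      (M.measurable_comp_lastTime (measurable_id'' (M.obsPast_le_fullPast n)) measurableSet_Iic)
  have hSmeas := M.fullPast_le n _ hSpast
  have hnomeas : MeasurableSet noQuake := measurableSet_lt measurable_const (M.measurable_time n)
  have hsurv : Measurable fun ω => (M.surv ν gam eps lam n m ω t : ℝ≥0∞) :=
    ((M.measurable_surv h hm t).mono (M.fullPast_le n) le_rfl).coe_nnreal_ennreal
  have hset : {ω | M.motherAfter n ω = m ∧ M.lastTime n ω ≤ t ∧ (t : ℝ≥0∞) < M.time n ω}
      = S ∩ noQuake := by ext; simp [hS, hno, and_assoc]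
  have htest := lintegral_mul_eq_of_forall_setLIntegral_eq (P := P) (M.fullPast_le n)
    (φ := (S ∩ noQuake).indicator 1)
    (ψ := S.indicator fun ω => (M.surv ν gam eps lam n m ω t : ℝ≥0∞))
    (measurable_one.indicator (hSmeas.inter hnomeas)) (hsurv.indicator hSmeas)
    (fun A hA => by
      rw [setLIntegral_indicator (hSmeas.inter hnomeas), setLIntegral_indicator hSmeas,
        ← M.measure_no_quake h hN hC hm (hSpast.inter hA) fun ω hω => ⟨hω.1.2, hω.1.1⟩]
      simp [inter_right_comm, hno]) hg
  rw [hset, ← lintegral_indicator (hSmeas.inter hnomeas), ← lintegral_indicator hSmeas]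
  convert htest using 2
  · ext ω; by_cases hω : ω ∈ S ∩ noQuake <;> simp only [indicator, hω, if_true, if_false] <;> simp
  · ext ω; by_cases hω : ω ∈ S <;> simp [indicator, hω]

end Survival

section NextQuake

/-- The reference measure for the next quake: the product of the law of the past with `ν(du) ds`,
restricted to the times after the last of the first `n` quakes. -/
noncomputable def nextMeasure (P : Measure Ω) (ν : Measure E) (n : ℕ) : Measure (Ω × (E × ℝ≥0)) :=
  (P.prod (ν.prod lebesgueNN)).restrict {x | M.lastTime n x.1 < x.2.2}

theorem measurableSet_lastTime_lt (n : ℕ) :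
    MeasurableSet {x : Ω × (E × ℝ≥0) | M.lastTime n x.1 < x.2.2} :=
  measurableSet_lt (f := fun x : Ω × (E × ℝ≥0) => M.lastTime n x.1)
    ((M.measurable_lastTime n).comp measurable_fst)
    (measurable_coe_nnreal_ennreal.comp (measurable_snd.comp measurable_snd))

theorem prod_fullPast_le (n : ℕ) : (M.fullPast n).prod (inferInstance : MeasurableSpace (E × ℝ≥0))
    ≤ (inferInstance : MeasurableSpace (Ω × (E × ℝ≥0))) :=
  sup_le_sup (MeasurableSpace.comap_mono (M.fullPast_le n)) le_rfl

theorem prod_obsPast_le_prod_fullPast (n : ℕ) :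
    (M.obsPast n).prod (inferInstance : MeasurableSpace (E × ℝ≥0))
      ≤ (M.fullPast n).prod (inferInstance : MeasurableSpace (E × ℝ≥0)) :=
  sup_le_sup (MeasurableSpace.comap_mono (M.obsPast_le_fullPast n)) le_rfl

theorem measurable_fst_prod_obsPast (n : ℕ) :
    Measurable[(M.obsPast n).prod (inferInstance : MeasurableSpace (E × ℝ≥0)), M.obsPast n]
      (Prod.fst : Ω × (E × ℝ≥0) → Ω) := @measurable_fst _ _ (M.obsPast n) _

theorem measurable_snd_prod_obsPast (n : ℕ) :
    Measurable[(M.obsPast n).prod (inferInstance : MeasurableSpace (E × ℝ≥0))]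
      (Prod.snd : Ω × (E × ℝ≥0) → E × ℝ≥0) := @measurable_snd _ _ (M.obsPast n) _

variable [SigmaFinite ν]

theorem lintegral_nextMeasure [SFinite P] (n : ℕ) {F : Ω × (E × ℝ≥0) → ℝ≥0∞}
    (hF : Measurable F) :
    ∫⁻ x, F x ∂(M.nextMeasure P ν n)
      = ∫⁻ ω, ∫⁻ s in {s : ℝ≥0 | M.lastTime n ω < s}, ∫⁻ u, F (ω, (u, s)) ∂ν ∂lebesgueNN ∂P := by
  have hFlast := hF.indicator (M.measurableSet_lastTime_lt n)
  rw [nextMeasure, ← lintegral_indicator (M.measurableSet_lastTime_lt n),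
    lintegral_prod _ hFlast.aemeasurable]
  refine lintegral_congr fun ω => ?_
  have hFω : Measurable fun y => {x | M.lastTime n x.1 < x.2.2}.indicator F (ω, y) :=
    hFlast.comp measurable_prodMk_left
  rw [lintegral_prod_symm _ hFω.aemeasurable,
    ← lintegral_indicator (measurableSet_lt measurable_const measurable_coe_nnreal_ennreal)]
  refine lintegral_congr fun s => ?_
  by_cases hs : M.lastTime n ω < s <;> simp [indicator, hs]

theorem lintegral_nextMeasure_symm [SFinite P] (n : ℕ) {F : Ω × (E × ℝ≥0) → ℝ≥0∞}
    (hF : Measurable F) :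
    ∫⁻ x, F x ∂(M.nextMeasure P ν n)
      = ∫⁻ y, ∫⁻ ω in {ω | M.lastTime n ω < y.2}, F (ω, y) ∂P ∂(ν.prod lebesgueNN) := by
  rw [nextMeasure, ← lintegral_indicator (M.measurableSet_lastTime_lt n),
    lintegral_prod_symm _ (hF.indicator (M.measurableSet_lastTime_lt n)).aemeasurable]
  refine lintegral_congr fun y => ?_
  rw [← lintegral_indicator (measurableSet_lt (M.measurable_lastTime n) measurable_const)]
  rfl

theorem setLIntegral_nextMeasure_no_quake [IsProbabilityMeasure P] (h : RegularRates ν gam eps lam)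
    (hN : HasIntensity P M.fullHistory M.N ν (fun u s _ => gam u s))
    (hC : HasIntensity P M.fullHistory M.C ν (M.clusterIntensity lam eps))
    {n : ℕ} {m : Option ℕ} (hm : m ∈ states n)
    {F : Ω × (E × ℝ≥0) → ℝ≥0∞} (hF : Measurable[(M.fullPast n).prod inferInstance] F) :
    ∫⁻ x in {x | M.motherAfter n x.1 = m ∧ (x.2.2 : ℝ≥0∞) < M.time n x.1}, F x
        ∂(M.nextMeasure P ν n)
      = ∫⁻ x in {x | M.motherAfter n x.1 = m}, F x * M.surv ν gam eps lam n m x.1 x.2.2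
          ∂(M.nextMeasure P ν n) := by
  have hFm : Measurable F := hF.mono (M.prod_fullPast_le n) le_rfl
  have hmother : MeasurableSet {ω | M.motherAfter n ω = m} :=
    M.fullPast_le n _ (M.measurableSet_motherAfter n m)
  have hmother' : MeasurableSet {x : Ω × (E × ℝ≥0) | M.motherAfter n x.1 = m} :=
    measurable_fst hmother
  have hnoQuake : MeasurableSet
      {x : Ω × (E × ℝ≥0) | M.motherAfter n x.1 = m ∧ (x.2.2 : ℝ≥0∞) < M.time n x.1} :=
    hmother'.inter (measurableSet_lt
      (measurable_coe_nnreal_ennreal.comp (measurable_snd.comp measurable_snd))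
      ((M.measurable_time n).comp measurable_fst))
  have hFsurv : Measurable fun x => F x * M.surv ν gam eps lam n m x.1 x.2.2 :=
    hFm.mul (M.measurable_comp_surv h ((measurable_id'' (M.obsPast_le n)).comp measurable_fst)
      (measurable_snd.comp measurable_snd) hm).coe_nnreal_ennreal
  rw [← lintegral_indicator hnoQuake, ← lintegral_indicator hmother',
    M.lintegral_nextMeasure_symm n (hFm.indicator hnoQuake),
    M.lintegral_nextMeasure_symm n (hFsurv.indicator hmother')]
  refine lintegral_congr fun y => ?_
  have hlast : MeasurableSet[M.fullPast n] {ω | M.lastTime n ω < y.2} :=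
    M.measurable_comp_lastTime (measurable_id'' (M.obsPast_le_fullPast n)) measurableSet_Iio
  have hlast' := M.fullPast_le n _ hlast
  have hFy : Measurable[M.fullPast n] fun ω => F (ω, y) :=
    hF.comp (@measurable_prodMk_right _ _ (M.fullPast n) _ y)
  have hslice := M.setLIntegral_no_quake h hN hC hm y.2 (hFy.indicator hlast)
  have hsub : MeasurableSet {ω | M.motherAfter n ω = m ∧ M.lastTime n ω ≤ y.2} :=
    hmother.inter (measurableSet_le (M.measurable_lastTime n) measurable_const)
  have hsub' : MeasurableSet {ω | M.motherAfter n ω = m ∧ M.lastTime n ω ≤ y.2 ∧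
      (y.2 : ℝ≥0∞) < M.time n ω} :=
    hmother.inter ((measurableSet_le (M.measurable_lastTime n) measurable_const).inter
      (measurableSet_lt measurable_const (M.measurable_time n)))
  rw [← lintegral_indicator hsub, ← lintegral_indicator hsub'] at hslice
  rw [← lintegral_indicator hlast', ← lintegral_indicator hlast']
  convert hslice using 3 with ω ω
  · by_cases hω : M.lastTime n ω < y.2
    · simp [indicator, hω, hω.le]
    · simp [indicator, hω]
  · by_cases hω : M.lastTime n ω < y.2
    · simp [indicator, hω, hω.le]
    · simp [indicator, hω]

theorem gap_ae_eq (n : ℕ) (ω : Ω) :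
    M.gap n ω =ᵐ[lebesgueNN]
      ({s | (s : ℝ≥0∞) < M.time n ω} ∩ {s | M.lastTime n ω < s} : Set ℝ≥0) := by
  have hne : ∀ᵐ s ∂lebesgueNN, s ≠ (M.time n ω).toNNReal := by
    simp [ae_iff, measure_singleton]
  filter_upwards [hne] with s hs
  have hlt : (s : ℝ≥0∞) ≤ M.time n ω ↔ (s : ℝ≥0∞) < M.time n ω :=
    ⟨fun hle => lt_of_le_of_ne hle fun heq => hs (by rw [← heq, ENNReal.toNNReal_coe]), le_of_lt⟩
  exact propext ((and_congr_right' hlt).trans and_comm)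

theorem setLIntegral_labelSet_inter_motherAfter [SFinite P] {n : ℕ} {m : Option ℕ} {b : Bool}
    {κ : E → ℝ≥0 → Ω → ℝ≥0} (hκ : HasIntensity P M.fullHistory (M.counting b) ν κ)
    {R : Ω × (E × ℝ≥0) → ℝ≥0} (hR : Measurable R)
    (hκR : ∀ ω s u, M.motherAfter n ω = m → s ∈ M.gap n ω → κ u s ω = R (ω, (u, s)))
    {G : Ω × (E × ℝ≥0) → ℝ≥0∞} (hG : Measurable[(M.fullPast n).prod inferInstance] G) :
    ∫⁻ ω in M.labelSet b n ∩ {ω | M.motherAfter n ω = m}, G (ω, M.point n ω) ∂P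
      = ∫⁻ x in {x | M.motherAfter n x.1 = m ∧ (x.2.2 : ℝ≥0∞) < M.time n x.1}, G x * R x
          ∂(M.nextMeasure P ν n) := by
  have hmother := M.measurableSet_motherAfter n m
  have hmother' : MeasurableSet[(M.fullPast n).prod inferInstance]
      {x : Ω × (E × ℝ≥0) | M.motherAfter n x.1 = m} :=
    (@measurable_fst Ω (E × ℝ≥0) (M.fullPast n) _) hmother
  have hset : MeasurableSet
      {x : Ω × (E × ℝ≥0) | M.motherAfter n x.1 = m ∧ (x.2.2 : ℝ≥0∞) < M.time n x.1} :=
    (measurable_fst (M.fullPast_le n _ hmother)).inter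
      (measurableSet_lt (measurable_coe_nnreal_ennreal.comp (measurable_snd.comp measurable_snd))
        ((M.measurable_time n).comp measurable_fst))
  have hGR : Measurable fun x => G x * R x :=
    (hG.mono (M.prod_fullPast_le n) le_rfl).mul hR.coe_nnreal_ennreal
  rw [inter_comm, ← setLIntegral_indicator (M.fullPast_le n _ hmother),
    ← lintegral_indicator hset, M.lintegral_nextMeasure n (hGR.indicator hset)]
  refine (M.setLIntegral_labelSet_of_hasIntensity hκ n (hG.indicator hmother')).trans ?_
  refine lintegral_congr fun ω => ?_
  by_cases hω : M.motherAfter n ω = m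
  · rw [setLIntegral_congr (M.gap_ae_eq n ω),
      ← setLIntegral_indicator (measurableSet_lt measurable_coe_nnreal_ennreal measurable_const)]
    refine setLIntegral_congr_fun
      (measurableSet_lt measurable_const measurable_coe_nnreal_ennreal) fun s hs => ?_
    by_cases hlt : (s : ℝ≥0∞) < M.time n ω
    · have hgap : s ∈ M.gap n ω := ⟨hs, hlt.le⟩
      simp [indicator, hω, hlt, hκR ω s _ hω hgap]
    · simp [indicator, hlt]
  · simp [indicator, hω]

theorem setLIntegral_labelSet_mother [IsProbabilityMeasure P] (h : RegularRates ν gam eps lam)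
    (hN : HasIntensity P M.fullHistory M.N ν (fun u s _ => gam u s))
    (hC : HasIntensity P M.fullHistory M.C ν (M.clusterIntensity lam eps))
    {n : ℕ} {m : Option ℕ} (hm : m ∈ states n) {b : Bool} {κ : E → ℝ≥0 → Ω → ℝ≥0}
    (hκ : HasIntensity P M.fullHistory (M.counting b) ν κ) {R : Ω × (E × ℝ≥0) → ℝ≥0}
    (hR : Measurable[(M.fullPast n).prod inferInstance] R)
    (hκR : ∀ ω s u, M.motherAfter n ω = m → s ∈ M.gap n ω → κ u s ω = R (ω, (u, s)))
    {G : Ω × (E × ℝ≥0) → ℝ≥0∞} (hG : Measurable[(M.fullPast n).prod inferInstance] G) :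
    ∫⁻ ω in M.labelSet b n ∩ {ω | M.motherAfter n ω = m}, G (ω, M.point n ω) ∂P
      = ∫⁻ x in {x | M.motherAfter n x.1 = m},
          G x * (M.surv ν gam eps lam n m x.1 x.2.2 * R x : ℝ≥0) ∂(M.nextMeasure P ν n) := by
  rw [M.setLIntegral_labelSet_inter_motherAfter hκ (hR.mono (M.prod_fullPast_le n) le_rfl) hκR hG]
  refine (M.setLIntegral_nextMeasure_no_quake h hN hC hm (hG.mul hR.coe_nnreal_ennreal)).trans
    (lintegral_congr fun x => ?_)
  rw [Pi.mul_apply]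
  push_cast
  ring

end NextQuake

section Coins

/-- The active mother after a cluster quake with number `n` and coin `k`. -/
def moveTo (n : ℕ) (k : Bool) : Option ℕ → Option ℕ
  | none => some n
  | some i => if k then none else some i

/-- The probability that a cluster quake with number `n` turns the active mother `m` into `m'`. -/
def moveProb (p : ℝ≥0) (n : ℕ) (m m' : Option ℕ) : ℝ≥0 :=
  p * (if moveTo n true m = m' then 1 else 0) + (1 - p) * (if moveTo n false m = m' then 1 else 0)

theorem motherAfter_succ_of_true {n : ℕ} {ω : Ω} (h : M.inCluster n ω = true) :
    M.motherAfter (n + 1) ω = moveTo n (M.kill n ω) (M.motherAfter n ω) := by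
  rw [motherAfter, h]
  cases M.motherAfter n ω <;> rfl

theorem motherAfter_succ_of_false {n : ℕ} {ω : Ω} (h : M.inCluster n ω = false) :
    M.motherAfter (n + 1) ω = M.motherAfter n ω := by
  rw [motherAfter, h]

theorem moveTo_mem_states {n : ℕ} {m : Option ℕ} (hm : m ∈ states n) (k : Bool) :
    moveTo n k m ∈ states (n + 1) := by
  rcases m with _ | i
  · simp [moveTo, states]
  · have hi : i < n := by simpa [states] using hm
    rcases k with _ | _ <;> simp [moveTo, states]
    omega

theorem states_mono {n : ℕ} {m : Option ℕ} (hm : m ∈ states n) : m ∈ states (n + 1) := by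
  rcases m with _ | i
  · simp [states]
  · have hi : i < n := by simpa [states] using hm
    simp [states]
    omega

theorem sum_moveProb (hp : p ≤ 1) {n : ℕ} {m : Option ℕ} (hm : m ∈ states n) :
    ∑ m' ∈ states (n + 1), moveProb p n m m' = 1 := by
  simp only [moveProb, Finset.sum_add_distrib, ← Finset.mul_sum, Finset.sum_ite_eq,
    moveTo_mem_states hm, if_true, mul_one]
  exact add_tsub_cancel_of_le hp

/-- The rate of quakes at `x = (ω, (u, s))` that turn the active mother `m` into `m'`. -/
def jumpRate (gam eps : E → ℝ≥0 → ℝ≥0) (lam : E → ℝ≥0 → E × ℝ≥0 → ℝ≥0) (p : ℝ≥0) (n : ℕ)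
    (m' m : Option ℕ) (x : Ω × (E × ℝ≥0)) : ℝ≥0 :=
  (if m = m' then 1 else 0) * gam x.2.1 x.2.2
    + moveProb p n m m' * M.clusterRate eps lam m x.1 x.2.1 x.2.2

/-- The rate of quakes at `x = (ω, (u, s))` when `m` is the active mother. -/
def markRate (gam eps : E → ℝ≥0 → ℝ≥0) (lam : E → ℝ≥0 → E × ℝ≥0 → ℝ≥0)
    (m : Option ℕ) (x : Ω × (E × ℝ≥0)) : ℝ≥0 :=
  gam x.2.1 x.2.2 + M.clusterRate eps lam m x.1 x.2.1 x.2.2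

theorem sum_jumpRate (hp : p ≤ 1) {n : ℕ} {m : Option ℕ} (hm : m ∈ states n)
    (x : Ω × (E × ℝ≥0)) :
    ∑ m' ∈ states (n + 1), M.jumpRate gam eps lam p n m' m x = M.markRate gam eps lam m x := by
  simp only [jumpRate, markRate, Finset.sum_add_distrib, ← Finset.sum_mul, sum_moveProb hp hm,
    Finset.sum_ite_eq, states_mono hm, if_true, one_mul]

/-- Everything that precedes the coin of quake `n`: the first `n` quakes, and the time, mark and
label of quake `n` itself. -/
def coinPast (n : ℕ) (ω : Ω) : (Fin n → ℝ≥0∞ × E × Bool × Bool) × ℝ≥0∞ × E × Bool :=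
  ((fun j : Fin n => (M.time j ω, M.mark j ω, M.inCluster j ω, M.kill j ω)),
    (M.time n ω, M.mark n ω, M.inCluster n ω))

/-- The σ-algebra of everything that precedes the coin of quake `n`. -/
abbrev coinPastSigma (n : ℕ) : MeasurableSpace Ω :=
  MeasurableSpace.comap (M.coinPast n) inferInstance

theorem coinPastSigma_le (n : ℕ) : M.coinPastSigma n ≤ mΩ := by
  refine measurable_iff_comap_le.1 (Measurable.prodMk (measurable_pi_lambda _ fun j => ?_) ?_)
  · exact (M.measurable_time j).prodMk ((M.measurable_mark j).prodMk
      ((M.measurable_inCluster j).prodMk (M.measurable_kill j)))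
  · exact (M.measurable_time n).prodMk ((M.measurable_mark n).prodMk (M.measurable_inCluster n))

theorem fullPast_le_coinPastSigma (n : ℕ) : M.fullPast n ≤ M.coinPastSigma n := by
  refine pointPast_le_iff.2 fun i hi => ?_
  have hpast : Measurable[M.coinPastSigma n] (M.coinPast n) := comap_measurable _
  have hquake : Measurable[M.coinPastSigma n] fun ω =>
      (M.time i ω, M.mark i ω, M.inCluster i ω, M.kill i ω) :=
    (measurable_pi_apply (⟨i, hi⟩ : Fin n)).comp (measurable_fst.comp hpast)
  have htime : Measurable[M.coinPastSigma n] (M.time i) := measurable_fst.comp hquake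
  have hmark : Measurable[M.coinPastSigma n] (M.fullMark i) := measurable_snd.comp hquake
  exact hmark.prodMk htime

theorem measurable_coinPastSigma_next (n : ℕ) :
    Measurable[M.coinPastSigma n] fun ω => (M.time n ω, M.mark n ω, M.inCluster n ω) :=
  measurable_snd.comp (comap_measurable (M.coinPast n))

theorem measurable_coinPastSigma_point (n : ℕ) : Measurable[M.coinPastSigma n] (M.point n) := by
  have hnext := M.measurable_coinPastSigma_next n
  exact Measurable.prodMk (measurable_fst.comp (measurable_snd.comp hnext))
    (measurable_fst.comp hnext).ennreal_toNNReal

theorem measurableSet_coinPastSigma_labelSet (n : ℕ) (b : Bool) :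
    MeasurableSet[M.coinPastSigma n] (M.labelSet b n) := by
  have hset : MeasurableSet {x : ℝ≥0∞ × E × Bool | x.1 ≠ ∞ ∧ x.2.2 = b} :=
    (measurable_fst (measurableSet_singleton ∞)).compl.inter
      ((measurable_snd.comp measurable_snd) (measurableSet_singleton b))
  exact M.measurable_coinPastSigma_next n hset

theorem lintegral_moveTo_kill [IsProbabilityMeasure P] {n : ℕ}
    (hk : P {ω | M.kill n ω = true} = p) (m m' : Option ℕ) :
    ∫⁻ ω, (if moveTo n (M.kill n ω) m = m' then 1 else 0) ∂P = moveProb p n m m' := by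
  have hkill := M.measurable_kill n
  have hmap : ∀ k, P.map (M.kill n) {k} = P {ω | M.kill n ω = k} := fun k =>
    Measure.map_apply hkill (measurableSet_singleton k)
  have hfalse : P {ω | M.kill n ω = false} = (1 - p : ℝ≥0) := by
    have hset : {ω | M.kill n ω = false} = (M.kill n ⁻¹' {true})ᶜ := by ext ω; simp
    rw [ENNReal.coe_sub, ENNReal.coe_one, ← hk, hset]
    exact prob_compl_eq_one_sub (hkill (measurableSet_singleton true))
  rw [← lintegral_map (f := fun k => if moveTo n k m = m' then (1 : ℝ≥0∞) else 0)
    (measurable_of_countable _) hkill, lintegral_fintype, Fintype.sum_bool, hmap, hmap, hk, hfalse,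
    moveProb]
  push_cast
  simp only [mul_comm]
  congr 2 <;> split_ifs <;> simp

theorem lintegral_mul_moveTo [IsProbabilityMeasure P] {n : ℕ}
    (hk : P {ω | M.kill n ω = true} = p) (hind : IndepFun (M.kill n) (M.coinPast n) P)
    (m m' : Option ℕ) {G : Ω × (E × ℝ≥0) → ℝ≥0∞}
    (hG : Measurable[(M.fullPast n).prod inferInstance] G) :
    ∫⁻ ω in M.labelSet true n, G (ω, M.point n ω) *
        (if moveTo n (M.kill n ω) m = m' then 1 else 0) ∂P
      = (∫⁻ ω in M.labelSet true n, G (ω, M.point n ω) ∂P) * moveProb p n m m' := by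
  have hGpoint : Measurable[M.coinPastSigma n]
      ((M.labelSet true n).indicator fun ω => G (ω, M.point n ω)) :=
    (hG.comp (@Measurable.prodMk _ _ _ _ (M.fullPast n) _ _ _
      (measurable_id'' (M.fullPast_le_coinPastSigma n))
      (M.measurable_coinPastSigma_point n))).indicator (M.measurableSet_coinPastSigma_labelSet n _)
  have hmove : Measurable[MeasurableSpace.comap (M.kill n) inferInstance]
      fun ω => if moveTo n (M.kill n ω) m = m' then (1 : ℝ≥0∞) else 0 :=
    (measurable_of_countable fun k : Bool => if moveTo n k m = m' then (1 : ℝ≥0∞) else 0).comp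
      (comap_measurable (M.kill n))
  have hprod := lintegral_mul_eq_lintegral_mul_lintegral_of_independent_measurableSpace
    (M.coinPastSigma_le n) (measurable_iff_comap_le.1 (M.measurable_kill n)) hind.symm hGpoint hmove
  rw [M.lintegral_moveTo_kill hk, lintegral_indicator (M.measurableSet_labelSet true n)] at hprod
  rw [← hprod, ← lintegral_indicator (M.measurableSet_labelSet true n)]
  simp_rw [indicator_mul_left]

end Coins

section MotherTransitions

/-- The facts about the mother-quake model that determine the filter: the intensities of both kinds
of quakes with respect to the full history, and the law of the coins. -/
structure IntensityModel (P : Measure Ω) (ν : Measure E) (gam eps : E → ℝ≥0 → ℝ≥0)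
    (lam : E → ℝ≥0 → E × ℝ≥0 → ℝ≥0) (p : ℝ≥0) : Prop where
  rates : RegularRates ν gam eps lam
  single : HasIntensity P M.fullHistory M.N ν (fun u s _ => gam u s)
  cluster : HasIntensity P M.fullHistory M.C ν (M.clusterIntensity lam eps)
  coin_prob : ∀ n, P {ω | M.kill n ω = true} = p
  coin_indep : ∀ n, IndepFun (M.kill n) (M.coinPast n) P
  prob_le_one : p ≤ 1

theorem measurableSet_motherAfter' (n : ℕ) (m : Option ℕ) :
    MeasurableSet {ω | M.motherAfter n ω = m} :=
  M.fullPast_le n _ (M.measurableSet_motherAfter n m)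

theorem measurableSet_next_mother (n : ℕ) (m : Option ℕ) :
    MeasurableSet {ω | M.time n ω ≠ ∞ ∧ M.motherAfter (n + 1) ω = m} :=
  (M.measurableSet_time_ne_top n).inter (M.measurableSet_motherAfter' (n + 1) m)

theorem measurable_comp_pointAt {n : ℕ} {G : Ω × (E × ℝ≥0) → ℝ≥0∞}
    (hG : Measurable[(M.fullPast n).prod inferInstance] G) :
    Measurable fun ω => G (ω, M.point n ω) :=
  (hG.mono (M.prod_fullPast_le n) le_rfl).comp (measurable_id.prodMk (M.measurable_point n))

theorem measurable_prod_gam (h : RegularRates ν gam eps lam) (n : ℕ) :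
    Measurable[(M.obsPast n).prod inferInstance]
      fun x : Ω × (E × ℝ≥0) => gam x.2.1 x.2.2 :=
  h.gam_meas.comp (M.measurable_snd_prod_obsPast n)

theorem measurable_prod_clusterRate (h : RegularRates ν gam eps lam) {n : ℕ} {m : Option ℕ}
    (hm : m ∈ states n) : Measurable[(M.obsPast n).prod inferInstance]
      fun x : Ω × (E × ℝ≥0) => M.clusterRate eps lam m x.1 x.2.1 x.2.2 :=
  M.measurable_comp_clusterRate h (M.measurable_fst_prod_obsPast n)
    (measurable_fst.comp (M.measurable_snd_prod_obsPast n))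
    (measurable_snd.comp (M.measurable_snd_prod_obsPast n)) hm

/-- The average of the rates `R m`, weighted with `w` and the survival probabilities. -/
noncomputable def mix (ν : Measure E) (gam eps : E → ℝ≥0 → ℝ≥0)
    (lam : E → ℝ≥0 → E × ℝ≥0 → ℝ≥0) (n : ℕ) (w : Option ℕ → Ω → ℝ≥0)
    (R : Option ℕ → Ω × (E × ℝ≥0) → ℝ≥0) (x : Ω × (E × ℝ≥0)) : ℝ≥0 :=
  ∑ m ∈ states n, w m x.1 * (M.surv ν gam eps lam n m x.1 x.2.2 * R m x)

/-- The posterior probability, given the first `n` quakes, that `m` is the active mother. The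
denominator vanishes only on a null event, see `ae_mix_markRate_ne_zero`. -/
noncomputable def weight (ν : Measure E) (gam eps : E → ℝ≥0 → ℝ≥0)
    (lam : E → ℝ≥0 → E × ℝ≥0 → ℝ≥0) (p : ℝ≥0) : ℕ → Option ℕ → Ω → ℝ≥0
  | 0, m, _ => if m = none then 1 else 0
  | n + 1, m', ω =>
    M.mix ν gam eps lam n (weight ν gam eps lam p n) (M.jumpRate gam eps lam p n m')
        (ω, M.point n ω)
      / M.mix ν gam eps lam n (weight ν gam eps lam p n) (M.markRate gam eps lam) (ω, M.point n ω)

theorem sum_mix_jumpRate (hp : p ≤ 1) (n : ℕ) (w : Option ℕ → Ω → ℝ≥0) (x : Ω × (E × ℝ≥0)) :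
    ∑ m' ∈ states (n + 1), M.mix ν gam eps lam n w (M.jumpRate gam eps lam p n m') x
      = M.mix ν gam eps lam n w (M.markRate gam eps lam) x := by
  simp only [mix]
  rw [Finset.sum_comm]
  refine Finset.sum_congr rfl fun m hm => ?_
  rw [← Finset.mul_sum, ← Finset.mul_sum, M.sum_jumpRate hp hm]

theorem measurable_jumpRate (h : RegularRates ν gam eps lam) {n : ℕ} (m' : Option ℕ) {m : Option ℕ}
    (hm : m ∈ states n) : Measurable[(M.obsPast n).prod inferInstance]
      (M.jumpRate gam eps lam p n m' m) :=
  (measurable_const.mul (M.measurable_prod_gam h n)).add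
    (measurable_const.mul (M.measurable_prod_clusterRate h hm))

theorem measurable_markRate (h : RegularRates ν gam eps lam) {n : ℕ} {m : Option ℕ}
    (hm : m ∈ states n) : Measurable[(M.obsPast n).prod inferInstance]
      (M.markRate gam eps lam m) :=
  (M.measurable_prod_gam h n).add (M.measurable_prod_clusterRate h hm)

variable [SigmaFinite ν]

theorem measurable_prod_surv (h : RegularRates ν gam eps lam) {n : ℕ} {m : Option ℕ}
    (hm : m ∈ states n) : Measurable[(M.obsPast n).prod inferInstance]
      fun x : Ω × (E × ℝ≥0) => M.surv ν gam eps lam n m x.1 x.2.2 :=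
  M.measurable_comp_surv h (M.measurable_fst_prod_obsPast n)
    (measurable_snd.comp (M.measurable_snd_prod_obsPast n)) hm

theorem setLIntegral_single_mother [IsProbabilityMeasure P]
    (h : M.IntensityModel P ν gam eps lam p) {n : ℕ} {m : Option ℕ} (hm : m ∈ states n)
    {G : Ω × (E × ℝ≥0) → ℝ≥0∞} (hG : Measurable[(M.fullPast n).prod inferInstance] G) :
    ∫⁻ ω in M.labelSet false n ∩ {ω | M.motherAfter n ω = m}, G (ω, M.point n ω) ∂P
      = ∫⁻ x in {x | M.motherAfter n x.1 = m},
          G x * (M.surv ν gam eps lam n m x.1 x.2.2 * gam x.2.1 x.2.2 : ℝ≥0)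
            ∂(M.nextMeasure P ν n) :=
  M.setLIntegral_labelSet_mother h.rates h.single h.cluster hm h.single
    ((M.measurable_prod_gam h.rates n).mono (M.prod_obsPast_le_prod_fullPast n) le_rfl)
    (fun _ _ _ _ _ => rfl) hG

theorem setLIntegral_cluster_mother [IsProbabilityMeasure P]
    (h : M.IntensityModel P ν gam eps lam p) {n : ℕ} {m : Option ℕ} (hm : m ∈ states n)
    {G : Ω × (E × ℝ≥0) → ℝ≥0∞} (hG : Measurable[(M.fullPast n).prod inferInstance] G) :
    ∫⁻ ω in M.labelSet true n ∩ {ω | M.motherAfter n ω = m}, G (ω, M.point n ω) ∂P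
      = ∫⁻ x in {x | M.motherAfter n x.1 = m},
          G x * (M.surv ν gam eps lam n m x.1 x.2.2
            * M.clusterRate eps lam m x.1 x.2.1 x.2.2 : ℝ≥0) ∂(M.nextMeasure P ν n) :=
  M.setLIntegral_labelSet_mother h.rates h.single h.cluster hm h.cluster
    ((M.measurable_prod_clusterRate h.rates hm).mono (M.prod_obsPast_le_prod_fullPast n) le_rfl)
    (fun _ _ _ hmother hgap => by rw [M.clusterIntensity_eq eps lam hgap.1 hgap.2, hmother]) hG

theorem setLIntegral_cluster_moveTo [IsProbabilityMeasure P]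
    (h : M.IntensityModel P ν gam eps lam p) {n : ℕ} {m : Option ℕ} (hm : m ∈ states n)
    (m' : Option ℕ) {G : Ω × (E × ℝ≥0) → ℝ≥0∞}
    (hG : Measurable[(M.fullPast n).prod inferInstance] G) :
    ∫⁻ ω in M.labelSet true n ∩ {ω | M.motherAfter n ω = m},
        G (ω, M.point n ω) * (if moveTo n (M.kill n ω) m = m' then 1 else 0) ∂P
      = ∫⁻ x in {x | M.motherAfter n x.1 = m},
          G x * (M.surv ν gam eps lam n m x.1 x.2.2
            * (moveProb p n m m' * M.clusterRate eps lam m x.1 x.2.1 x.2.2) : ℝ≥0)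
            ∂(M.nextMeasure P ν n) := by
  have hmother : MeasurableSet[(M.fullPast n).prod inferInstance]
      {x : Ω × (E × ℝ≥0) | M.motherAfter n x.1 = m} :=
    (@measurable_fst Ω (E × ℝ≥0) (M.fullPast n) _) (M.measurableSet_motherAfter n m)
  have hcoin := M.lintegral_mul_moveTo (h.coin_prob n) (h.coin_indep n) m m'
    (hG.indicator hmother)
  have hindicator : ∀ ω, {x : Ω × (E × ℝ≥0) | M.motherAfter n x.1 = m}.indicator G
      (ω, M.point n ω) = {ω | M.motherAfter n ω = m}.indicator (fun ω => G (ω, M.point n ω)) ω :=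
    fun _ => rfl
  have hindicator_mul : ∀ ω, {ω | M.motherAfter n ω = m}.indicator (fun ω => G (ω, M.point n ω)) ω
        * (if moveTo n (M.kill n ω) m = m' then 1 else 0)
      = {ω | M.motherAfter n ω = m}.indicator (fun ω => G (ω, M.point n ω)
          * (if moveTo n (M.kill n ω) m = m' then 1 else 0)) ω :=
    fun _ => (indicator_mul_left _ _ fun ω => if moveTo n (M.kill n ω) m = m' then 1 else 0).symm
  simp_rw [hindicator, hindicator_mul] at hcoin
  rw [setLIntegral_indicator (M.measurableSet_motherAfter' n m),
    setLIntegral_indicator (M.measurableSet_motherAfter' n m), inter_comm,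
    M.setLIntegral_cluster_mother h hm hG, mul_comm,
    ← lintegral_const_mul' _ _ ENNReal.coe_ne_top] at hcoin
  refine hcoin.trans (lintegral_congr fun x => ?_)
  push_cast
  ring

theorem setLIntegral_motherAfter_succ (n : ℕ) (m' : Option ℕ) {F : Ω → ℝ≥0∞} (hF : Measurable F) :
    ∫⁻ ω in {ω | M.time n ω ≠ ∞ ∧ M.motherAfter (n + 1) ω = m'}, F ω ∂P
      = ∑ m ∈ states n,
        ((if m = m' then 1 else 0) * ∫⁻ ω in M.labelSet false n ∩ {ω | M.motherAfter n ω = m},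
            F ω ∂P
          + ∫⁻ ω in M.labelSet true n ∩ {ω | M.motherAfter n ω = m},
            F ω * (if moveTo n (M.kill n ω) m = m' then 1 else 0) ∂P) := by
  have hmove : ∀ m, Measurable fun ω => if moveTo n (M.kill n ω) m = m' then (1 : ℝ≥0∞) else 0 :=
    fun m => (measurable_of_countable fun k : Bool =>
      if moveTo n k m = m' then (1 : ℝ≥0∞) else 0).comp (M.measurable_kill n)
  have hset : ∀ b m, MeasurableSet (M.labelSet b n ∩ {ω | M.motherAfter n ω = m}) := fun b m =>
    (M.measurableSet_labelSet b n).inter (M.measurableSet_motherAfter' n m)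
  have hsplit : ∀ ω, {ω | M.time n ω ≠ ∞ ∧ M.motherAfter (n + 1) ω = m'}.indicator F ω
      = ∑ m ∈ states n,
        ((if m = m' then 1 else 0)
            * (M.labelSet false n ∩ {ω | M.motherAfter n ω = m}).indicator F ω
          + (M.labelSet true n ∩ {ω | M.motherAfter n ω = m}).indicator
            (fun ω => F ω * (if moveTo n (M.kill n ω) m = m' then 1 else 0)) ω) := by
    intro ω
    rw [Finset.sum_eq_single_of_mem _ (M.motherAfter_mem_states n ω) fun m _ hm => by
      simp [hm.symm]]
    by_cases htime : M.time n ω = ∞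
    · simp [htime, labelSet]
    · rcases hlabel : M.inCluster n ω with _ | _
      · simp [labelSet, htime, hlabel, indicator_apply, M.motherAfter_succ_of_false hlabel]
      · simp [labelSet, htime, hlabel, indicator_apply, M.motherAfter_succ_of_true hlabel]
  have hsingle : ∀ m, Measurable fun ω => (if m = m' then (1 : ℝ≥0∞) else 0)
      * (M.labelSet false n ∩ {ω | M.motherAfter n ω = m}).indicator F ω := fun m =>
    measurable_const.mul (hF.indicator (hset false m))
  have hcluster : ∀ m, Measurable fun ω =>
      (M.labelSet true n ∩ {ω | M.motherAfter n ω = m}).indicator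
        (fun ω => F ω * (if moveTo n (M.kill n ω) m = m' then 1 else 0)) ω := fun m =>
    (hF.mul (hmove m)).indicator (hset true m)
  have hadd := fun m => (hsingle m).add (hcluster m)
  simp only [Pi.add_def] at hadd
  simp_rw [← lintegral_indicator (M.measurableSet_next_mother n m'), hsplit]
  rw [lintegral_finsetSum _ fun m _ => hadd m]
  refine Finset.sum_congr rfl fun m _ => ?_
  rw [lintegral_add_left (hsingle m), lintegral_const_mul _ (hF.indicator (hset false m)),
    lintegral_indicator (hset false m), lintegral_indicator (hset true m)]

theorem setLIntegral_next_mother [IsProbabilityMeasure P]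
    (h : M.IntensityModel P ν gam eps lam p) (n : ℕ) (m' : Option ℕ) {G : Ω × (E × ℝ≥0) → ℝ≥0∞}
    (hG : Measurable[(M.fullPast n).prod inferInstance] G) :
    ∫⁻ ω in {ω | M.time n ω ≠ ∞ ∧ M.motherAfter (n + 1) ω = m'}, G (ω, M.point n ω) ∂P
      = ∑ m ∈ states n, ∫⁻ x in {x | M.motherAfter n x.1 = m},
          G x * (M.surv ν gam eps lam n m x.1 x.2.2 * M.jumpRate gam eps lam p n m' m x : ℝ≥0)
            ∂(M.nextMeasure P ν n) := by
  have hle := M.prod_obsPast_le_prod_fullPast (E := E) n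
  rw [M.setLIntegral_motherAfter_succ n m' (M.measurable_comp_pointAt hG)]
  refine Finset.sum_congr rfl fun m hm => ?_
  have hsingle : Measurable[(M.fullPast n).prod inferInstance] fun x : Ω × (E × ℝ≥0) =>
      G x * (M.surv ν gam eps lam n m x.1 x.2.2 * gam x.2.1 x.2.2 : ℝ≥0) :=
    hG.mul (((M.measurable_prod_surv h.rates hm).mul
      (M.measurable_prod_gam h.rates n)).mono hle le_rfl).coe_nnreal_ennreal
  have hsingle' := hsingle.mono (M.prod_fullPast_le n) le_rfl
  rw [M.setLIntegral_single_mother h hm hG, M.setLIntegral_cluster_moveTo h hm m' hG,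
    ← lintegral_const_mul _ hsingle', ← lintegral_add_left (hsingle'.const_mul _)]
  refine lintegral_congr fun x => ?_
  rw [jumpRate]
  split_ifs <;> (push_cast; ring)

theorem measurable_mix (h : RegularRates ν gam eps lam) {n : ℕ} {w : Option ℕ → Ω → ℝ≥0}
    (hw : ∀ m, Measurable[M.obsPast n] (w m)) {R : Option ℕ → Ω × (E × ℝ≥0) → ℝ≥0}
    (hR : ∀ m ∈ states n, Measurable[(M.obsPast n).prod inferInstance] (R m)) :
    Measurable[(M.obsPast n).prod inferInstance] (M.mix ν gam eps lam n w R) :=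
  Finset.measurable_fun_sum _ fun m hm => ((hw m).comp (M.measurable_fst_prod_obsPast n)).mul
    ((M.measurable_prod_surv h hm).mul (hR m hm))

theorem measurable_pointAt_obsPast (n : ℕ) : Measurable[M.obsPast (n + 1),
    (M.obsPast n).prod inferInstance] fun ω => (ω, M.point n ω) := by
  have hpoint : Measurable[M.obsPast (n + 1)] (M.point n) :=
    M.measurable_comp_point (f := id) (@measurable_id _ (M.obsPast (n + 1))) n.lt_succ_self
  exact @Measurable.prodMk _ _ _ _ (M.obsPast n) _ _ _
    (measurable_id'' (pointPast_mono M.time M.mark n)) hpoint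

theorem measurable_weight (h : RegularRates ν gam eps lam) (n : ℕ) (m : Option ℕ) :
    Measurable[M.obsPast n] (M.weight ν gam eps lam p n m) := by
  induction n generalizing m with
  | zero => exact @measurable_const _ _ _ (M.obsPast 0) _
  | succ n ih =>
    exact ((M.measurable_mix h ih fun _ hm' => M.measurable_jumpRate h m hm').comp
      (M.measurable_pointAt_obsPast n)).div
      ((M.measurable_mix h ih fun _ hm' => M.measurable_markRate h hm').comp
      (M.measurable_pointAt_obsPast n))

end MotherTransitions

section Posterior

variable {M}

/-- The family `w` gives the conditional law of the active mother given the first `n` quakes. -/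
def IsPosterior (M : QuakeProcess Ω E) (P : Measure Ω) (n : ℕ) (w : Option ℕ → Ω → ℝ≥0) : Prop :=
  ∀ m ∈ states n, ∀ g : Ω → ℝ≥0∞, Measurable[M.obsPast n] g →
    ∫⁻ ω in {ω | M.lastTime n ω ≠ ∞ ∧ M.motherAfter n ω = m}, g ω ∂P
      = ∫⁻ ω in {ω | M.lastTime n ω ≠ ∞}, g ω * w m ω ∂P

theorem IsPosterior.setLIntegral_inter_motherAfter {n : ℕ} {w : Option ℕ → Ω → ℝ≥0}
    (hw : M.IsPosterior P n w) {m : Option ℕ} (hm : m ∈ states n) {A : Set Ω}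
    (hA : MeasurableSet[M.obsPast n] A) (hsub : A ⊆ {ω | M.lastTime n ω ≠ ∞})
    {g : Ω → ℝ≥0∞} (hg : Measurable[M.obsPast n] g) :
    ∫⁻ ω in A ∩ {ω | M.motherAfter n ω = m}, g ω ∂P = ∫⁻ ω in A, g ω * w m ω ∂P := by
  have hA' := M.obsPast_le n A hA
  have hset : A ∩ {ω | M.lastTime n ω ≠ ∞ ∧ M.motherAfter n ω = m}
      = A ∩ {ω | M.motherAfter n ω = m} :=
    ext fun ω => and_congr_right fun hω => and_iff_right (hsub hω)
  have hweight := hw m hm (A.indicator g) (hg.indicator hA)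
  simp_rw [← indicator_mul_left A g fun ω => (w m ω : ℝ≥0∞)] at hweight
  rwa [setLIntegral_indicator hA', setLIntegral_indicator hA', hset, inter_eq_left.2 hsub]
    at hweight

theorem prod_obsPast_le (M : QuakeProcess Ω E) (n : ℕ) :
    (M.obsPast n).prod (inferInstance : MeasurableSpace (E × ℝ≥0))
      ≤ (inferInstance : MeasurableSpace (Ω × (E × ℝ≥0))) :=
  (M.prod_obsPast_le_prod_fullPast n).trans (M.prod_fullPast_le n)

theorem exists_measurable_comp_point (M : QuakeProcess Ω E) {n : ℕ} {g : Ω → ℝ≥0∞}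
    (hg : Measurable[M.obsPast (n + 1)] g) :
    ∃ G : Ω × (E × ℝ≥0) → ℝ≥0∞, Measurable[(M.obsPast n).prod inferInstance] G ∧
      ∀ ω, M.time n ω ≠ ∞ → g ω = G (ω, M.point n ω) := by
  obtain ⟨f, hf, hgf⟩ : ∃ f : Ω × (E × ℝ≥0∞) → ℝ≥0∞,
      Measurable[(M.obsPast n).prod inferInstance] f ∧
        g = f ∘ fun ω => (ω, (M.mark n ω, M.time n ω)) := by
    refine @Measurable.exists_eq_measurable_comp Ω (Ω × (E × ℝ≥0∞)) ℝ≥0∞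
      ((M.obsPast n).prod inferInstance) _ _ _ _ _ ?_
    convert hg using 1
    rw [MeasurableSpace.prod, MeasurableSpace.comap_sup, MeasurableSpace.comap_comp,
      MeasurableSpace.comap_comp]
    change MeasurableSpace.comap id _ ⊔ _ = _
    rw [MeasurableSpace.comap_id]
    exact (Nat.iSup_lt_succ _ n).symm
  have hsnd := M.measurable_snd_prod_obsPast n
  refine ⟨fun x => f (x.1, (x.2.1, (x.2.2 : ℝ≥0∞))), hf.comp (@Measurable.prodMk _ _ _ _
    (M.obsPast n) _ _ _ (M.measurable_fst_prod_obsPast n) ((measurable_fst.comp hsnd).prodMk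
      (measurable_coe_nnreal_ennreal.comp (measurable_snd.comp hsnd)))), fun ω hω => ?_⟩
  simp [hgf, point, ENNReal.coe_toNNReal hω]

theorem mix_jumpRate_le_mix_markRate (M : QuakeProcess Ω E) (hp : p ≤ 1) {n : ℕ} {m' : Option ℕ}
    (hm' : m' ∈ states (n + 1)) (w : Option ℕ → Ω → ℝ≥0) (x : Ω × (E × ℝ≥0)) :
    M.mix ν gam eps lam n w (M.jumpRate gam eps lam p n m') x
      ≤ M.mix ν gam eps lam n w (M.markRate gam eps lam) x := by
  rw [← M.sum_mix_jumpRate hp]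
  exact Finset.single_le_sum
    (f := fun m' => M.mix ν gam eps lam n w (M.jumpRate gam eps lam p n m') x)
    (fun _ _ => zero_le) hm'

theorem isPosterior_zero : M.IsPosterior P 0 (M.weight ν gam eps lam p 0) := by
  intro m hm g _
  obtain rfl : m = none := by
    rcases m with _ | i
    · rfl
    · simp [states] at hm
  simp [lastTime, motherAfter, weight]

variable [SigmaFinite ν] [IsProbabilityMeasure P]

theorem IsPosterior.setLIntegral_nextMeasure {n : ℕ} {w : Option ℕ → Ω → ℝ≥0}
    (hw : M.IsPosterior P n w) (hwm : ∀ m, Measurable[M.obsPast n] (w m)) {m : Option ℕ}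
    (hm : m ∈ states n) {F : Ω × (E × ℝ≥0) → ℝ≥0∞}
    (hF : Measurable[(M.obsPast n).prod inferInstance] F) :
    ∫⁻ x in {x | M.motherAfter n x.1 = m}, F x ∂(M.nextMeasure P ν n)
      = ∫⁻ x, F x * w m x.1 ∂(M.nextMeasure P ν n) := by
  have hF' : Measurable F := hF.mono (M.prod_obsPast_le n) le_rfl
  have hmother := M.measurableSet_motherAfter' n m
  have hmother' : MeasurableSet {x : Ω × (E × ℝ≥0) | M.motherAfter n x.1 = m} :=
    measurable_fst hmother
  have hFw : Measurable fun x : Ω × (E × ℝ≥0) => F x * (w m x.1 : ℝ≥0∞) :=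
    hF'.mul (((hwm m).mono (M.obsPast_le n) le_rfl).comp measurable_fst).coe_nnreal_ennreal
  rw [← lintegral_indicator hmother', M.lintegral_nextMeasure_symm n (hF'.indicator hmother'),
    M.lintegral_nextMeasure_symm n hFw]
  refine lintegral_congr fun y => ?_
  have hlast : MeasurableSet[M.obsPast n] {ω | M.lastTime n ω < y.2} :=
    M.measurable_comp_lastTime (f := id) (@measurable_id _ (M.obsPast n)) measurableSet_Iio
  have hFy : Measurable[M.obsPast n] fun ω => F (ω, y) :=
    hF.comp (@measurable_prodMk_right _ _ (M.obsPast n) _ y)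
  have hslice := hw.setLIntegral_inter_motherAfter hm hlast
    (fun ω hω => (lt_trans hω ENNReal.coe_lt_top).ne) hFy
  rwa [inter_comm, ← setLIntegral_indicator hmother] at hslice

theorem IsPosterior.setLIntegral_next_mother (h : M.IntensityModel P ν gam eps lam p) {n : ℕ}
    {w : Option ℕ → Ω → ℝ≥0} (hw : M.IsPosterior P n w)
    (hwm : ∀ m, Measurable[M.obsPast n] (w m)) (m' : Option ℕ)
    {G : Ω × (E × ℝ≥0) → ℝ≥0∞} (hG : Measurable[(M.obsPast n).prod inferInstance] G) :
    ∫⁻ ω in {ω | M.time n ω ≠ ∞ ∧ M.motherAfter (n + 1) ω = m'}, G (ω, M.point n ω) ∂P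
      = ∫⁻ x, G x * M.mix ν gam eps lam n w (M.jumpRate gam eps lam p n m') x
          ∂(M.nextMeasure P ν n) := by
  have hrate : ∀ m ∈ states n, Measurable[(M.obsPast n).prod inferInstance]
      fun x : Ω × (E × ℝ≥0) => G x * (M.surv ν gam eps lam n m x.1 x.2.2
        * M.jumpRate gam eps lam p n m' m x : ℝ≥0) := fun m hm =>
    hG.mul ((M.measurable_prod_surv h.rates hm).mul
      (M.measurable_jumpRate h.rates m' hm)).coe_nnreal_ennreal
  have hsummand : ∀ m ∈ states n, Measurable fun x : Ω × (E × ℝ≥0) => G x *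
      (M.surv ν gam eps lam n m x.1 x.2.2 * M.jumpRate gam eps lam p n m' m x : ℝ≥0) * w m x.1 :=
    fun m hm => ((hrate m hm).mono (M.prod_obsPast_le n) le_rfl).mul
      (((hwm m).mono (M.obsPast_le n) le_rfl).comp measurable_fst).coe_nnreal_ennreal
  rw [M.setLIntegral_next_mother h n m' (hG.mono (M.prod_obsPast_le_prod_fullPast n) le_rfl),
    Finset.sum_congr rfl fun m hm => hw.setLIntegral_nextMeasure hwm hm (hrate m hm),
    ← lintegral_finsetSum' _ fun m hm => (hsummand m hm).aemeasurable]
  refine lintegral_congr fun x => ?_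
  rw [mix, ENNReal.ofNNReal_finsetSum, Finset.mul_sum]
  refine Finset.sum_congr rfl fun m _ => ?_
  push_cast
  ring

theorem IsPosterior.setLIntegral_next (h : M.IntensityModel P ν gam eps lam p) {n : ℕ}
    {w : Option ℕ → Ω → ℝ≥0} (hw : M.IsPosterior P n w)
    (hwm : ∀ m, Measurable[M.obsPast n] (w m))
    {G : Ω × (E × ℝ≥0) → ℝ≥0∞} (hG : Measurable[(M.obsPast n).prod inferInstance] G) :
    ∫⁻ ω in {ω | M.time n ω ≠ ∞}, G (ω, M.point n ω) ∂P
      = ∫⁻ x, G x * M.mix ν gam eps lam n w (M.markRate gam eps lam) x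
          ∂(M.nextMeasure P ν n) := by
  have hmix : ∀ m', Measurable fun x => G x *
      M.mix ν gam eps lam n w (M.jumpRate gam eps lam p n m') x := fun m' =>
    (hG.mul (M.measurable_mix h.rates hwm fun m hm =>
      M.measurable_jumpRate h.rates m' hm).coe_nnreal_ennreal).mono (M.prod_obsPast_le n) le_rfl
  have hunion : {ω | M.time n ω ≠ ∞}
      = ⋃ m' ∈ states (n + 1), {ω | M.time n ω ≠ ∞ ∧ M.motherAfter (n + 1) ω = m'} := by
    ext ω
    simp [M.motherAfter_mem_states (n + 1) ω]
  rw [hunion, lintegral_biUnion_finset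
      (fun i _ j _ hij => disjoint_left.2 fun ω hi hj => hij (hi.2.symm.trans hj.2))
      (fun m' _ => M.measurableSet_next_mother n m'),
    Finset.sum_congr rfl fun m' _ => hw.setLIntegral_next_mother h hwm m' hG,
    ← lintegral_finsetSum _ fun m' _ => hmix m']
  refine lintegral_congr fun x => ?_
  rw [← Finset.mul_sum, ← M.sum_mix_jumpRate h.prob_le_one, ENNReal.ofNNReal_finsetSum]

theorem IsPosterior.succ (h : M.IntensityModel P ν gam eps lam p) {n : ℕ}
    (hw : M.IsPosterior P n (M.weight ν gam eps lam p n)) :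
    M.IsPosterior P (n + 1) (M.weight ν gam eps lam p (n + 1)) := by
  intro m' hm' g hg
  obtain ⟨G, hG, hgG⟩ := M.exists_measurable_comp_point hg
  have hwm := M.measurable_weight (p := p) h.rates n
  set num := M.mix ν gam eps lam n (M.weight ν gam eps lam p n) (M.jumpRate gam eps lam p n m')
  set den := M.mix ν gam eps lam n (M.weight ν gam eps lam p n) (M.markRate gam eps lam)
  have hnum : Measurable[(M.obsPast n).prod inferInstance] num :=
    M.measurable_mix h.rates hwm fun m hm => M.measurable_jumpRate h.rates m' hm
  have hden : Measurable[(M.obsPast n).prod inferInstance] den :=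
    M.measurable_mix h.rates hwm fun m hm => M.measurable_markRate h.rates hm
  have hratio : ∀ x, num x / den x * den x = num x := fun x =>
    div_mul_cancel_of_imp fun hzero => nonpos_iff_eq_zero.1
      (hzero ▸ M.mix_jumpRate_le_mix_markRate h.prob_le_one hm' _ x)
  calc ∫⁻ ω in {ω | M.time n ω ≠ ∞ ∧ M.motherAfter (n + 1) ω = m'}, g ω ∂P
      = ∫⁻ ω in {ω | M.time n ω ≠ ∞ ∧ M.motherAfter (n + 1) ω = m'}, G (ω, M.point n ω) ∂P :=
        setLIntegral_congr_fun (M.measurableSet_next_mother n m') fun ω hω => hgG ω hω.1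
    _ = ∫⁻ x, G x * num x ∂(M.nextMeasure P ν n) := hw.setLIntegral_next_mother h hwm m' hG
    _ = ∫⁻ x, G x * (num x / den x : ℝ≥0) * den x ∂(M.nextMeasure P ν n) :=
        lintegral_congr fun x => by rw [mul_assoc, ← ENNReal.coe_mul, hratio]
    _ = ∫⁻ ω in {ω | M.time n ω ≠ ∞}, G (ω, M.point n ω)
          * (num (ω, M.point n ω) / den (ω, M.point n ω) : ℝ≥0) ∂P :=
        (hw.setLIntegral_next h hwm (hG.mul (hnum.div hden).coe_nnreal_ennreal)).symm
    _ = ∫⁻ ω in {ω | M.time n ω ≠ ∞}, g ω * M.weight ν gam eps lam p (n + 1) m' ω ∂P :=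
        setLIntegral_congr_fun (M.measurableSet_time_ne_top n) fun ω hω => by
          simp only [hgG ω hω]
          rfl

theorem isPosterior_weight (h : M.IntensityModel P ν gam eps lam p) (n : ℕ) :
    M.IsPosterior P n (M.weight ν gam eps lam p n) := by
  induction n with
  | zero => exact isPosterior_zero
  | succ n ih => exact ih.succ h

theorem ae_mix_markRate_ne_zero (h : M.IntensityModel P ν gam eps lam p) (n : ℕ) :
    ∀ᵐ ω ∂P, M.time n ω ≠ ∞ → M.mix ν gam eps lam n (M.weight ν gam eps lam p n)
      (M.markRate gam eps lam) (ω, M.point n ω) ≠ 0 := by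
  have hwm := M.measurable_weight (p := p) h.rates n
  set den := M.mix ν gam eps lam n (M.weight ν gam eps lam p n) (M.markRate gam eps lam) with hden
  have hdm : Measurable[(M.obsPast n).prod inferInstance] den :=
    M.measurable_mix h.rates hwm fun m hm => M.measurable_markRate h.rates hm
  have hG : Measurable[(M.obsPast n).prod inferInstance]
      ((den ⁻¹' {0}).indicator fun _ => (1 : ℝ≥0∞)) :=
    measurable_const.indicator (hdm (measurableSet_singleton 0))
  have hnull := (isPosterior_weight h n).setLIntegral_next h hwm hG
  have hzero : ∀ x, (den ⁻¹' {0}).indicator (fun _ => (1 : ℝ≥0∞)) x * den x = 0 := fun x => by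
    by_cases hx : den x = 0 <;> simp [hx]
  simp_rw [← hden, hzero, lintegral_zero] at hnull
  rw [lintegral_eq_zero_iff (M.measurable_comp_pointAt
    (hG.mono (M.prod_obsPast_le_prod_fullPast n) le_rfl))] at hnull
  filter_upwards [(ae_restrict_iff' (M.measurableSet_time_ne_top n)).1 hnull] with ω hω htime hden0
  simpa [hden0] using hω htime

theorem ae_sum_weight (h : M.IntensityModel P ν gam eps lam p) (n : ℕ) :
    ∀ᵐ ω ∂P, M.lastTime n ω ≠ ∞ → ∑ m ∈ states n, M.weight ν gam eps lam p n m ω = 1 := by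
  cases n with
  | zero => exact Eventually.of_forall fun ω _ => by simp [states, weight]
  | succ n =>
    filter_upwards [ae_mix_markRate_ne_zero h n] with ω hω htime
    simp only [weight]
    rw [← Finset.sum_div, M.sum_mix_jumpRate h.prob_le_one]
    exact div_self (hω htime)

end Posterior

section ConditionalExpectation

/-- The event that exactly `k` quakes have occurred by time `t`. -/
def cell (t : ℝ≥0) (k : ℕ) : Set Ω := {ω | M.lastTime k ω ≤ t ∧ (t : ℝ≥0∞) < M.time k ω}

theorem mem_cell_count (t : ℝ≥0) (ω : Ω) : ω ∈ M.cell t (M.count t ω) := by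
  have hex : ∃ n, (t : ℝ≥0∞) < M.time n ω :=
    ((M.tendsto_time ω).eventually (lt_mem_nhds ENNReal.coe_lt_top)).exists
  have hmem : ω ∈ M.cell t (Nat.find hex) := by
    refine ⟨?_, Nat.find_spec hex⟩
    rcases hk : Nat.find hex with _ | k
    · exact zero_le
    · exact not_lt.1 (Nat.find_min hex (by omega : k < Nat.find hex))
  rwa [M.count_eq hmem.1 hmem.2]

theorem mem_cell_iff {t : ℝ≥0} {k : ℕ} {ω : Ω} : ω ∈ M.cell t k ↔ M.count t ω = k :=
  ⟨fun h => M.count_eq h.1 h.2, fun h => h ▸ M.mem_cell_count t ω⟩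

theorem measurableSet_cell (t : ℝ≥0) (k : ℕ) : MeasurableSet (M.cell t k) :=
  (M.measurable_lastTime k measurableSet_Iic).inter (M.measurable_time k measurableSet_Ioi)

theorem setLIntegral_eq_tsum_cell {A : Set Ω} (hA : MeasurableSet A) (t : ℝ≥0) (f : Ω → ℝ≥0∞) :
    ∫⁻ ω in A, f ω ∂P = ∑' k, ∫⁻ ω in A ∩ M.cell t k, f ω ∂P := by
  have hunion : A = ⋃ k, A ∩ M.cell t k := by
    ext ω
    simp [M.mem_cell_iff]
  have hdisj : Pairwise (Function.onFun Disjoint fun k => A ∩ M.cell t k) := fun j k hjk =>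
    disjoint_left.2 fun ω hj hk =>
      hjk ((M.mem_cell_iff.1 hj.2).symm.trans (M.mem_cell_iff.1 hk.2))
  conv_lhs => rw [hunion]
  exact lintegral_iUnion (fun k => hA.inter (M.measurableSet_cell t k)) hdisj f

theorem thetaAlpha_eq (i : ℕ) (t : ℝ≥0) (ω : Ω) :
    M.thetaAlpha i t ω = if M.motherAfter (M.count t ω) ω = some i then 1 else 0 := by
  rw [thetaAlpha, theta, D]
  rcases M.motherAfter (M.count t ω) ω with _ | j
  · simp [thetaOf, activeOf]
  · by_cases hj : j = i <;> simp [thetaOf, activeOf, hj]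

theorem measurable_thetaAlpha (i : ℕ) (t : ℝ≥0) : Measurable (M.thetaAlpha i t) := by
  have hunion : {ω | M.motherAfter (M.count t ω) ω = some i}
      = ⋃ k, {ω | M.motherAfter k ω = some i} ∩ M.cell t k := by
    ext ω
    simp [M.mem_cell_iff]
  have hmother : MeasurableSet {ω | M.motherAfter (M.count t ω) ω = some i} :=
    hunion ▸ MeasurableSet.iUnion fun k =>
      (M.measurableSet_motherAfter' k _).inter (M.measurableSet_cell t k)
  rw [funext (M.thetaAlpha_eq i t)]
  exact Measurable.ite hmother measurable_const measurable_const

theorem measurableSet_obsHistory_inter_cell {k : ℕ} {t : ℝ≥0} {A : Set Ω}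
    (hA : MeasurableSet[M.obsPast k] A) : MeasurableSet[M.obsHistory t] (A ∩ M.cell t k) := by
  obtain ⟨B, hB, hBA⟩ := measurable_subtype_pointPast_pointHistory M.measurable_time
    M.measurable_mark (L := M.lastTime k) (n := k) (fun i hi ω => M.time_le_lastTime hi ω) t hA
  have hlast := M.measurableSet_pointHistory_lastTime_le M.measurable_mark k t
  have hnext := M.measurableSet_pointHistory_lastTime_le M.measurable_mark (k + 1) t
  have hset : A ∩ M.cell t k = ({ω | M.lastTime k ω ≤ t} ∩ B) \ {ω | M.lastTime (k + 1) ω ≤ t} := by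
    rw [(Subtype.preimage_val_eq_preimage_val_iff _ _ _).1 hBA]
    ext ω
    simp [cell, lastTime, and_comm, and_left_comm]
  rw [hset]
  exact @MeasurableSet.diff _ (M.obsHistory t) _ _
    (@MeasurableSet.inter _ (M.obsHistory t) _ _ hlast hB) hnext

theorem exists_obsPast_inter_cell_eq {t : ℝ≥0} {A : Set Ω} (hA : MeasurableSet[M.obsHistory t] A)
    (k : ℕ) : ∃ B, MeasurableSet[M.obsPast k] B ∧ A ∩ M.cell t k = B ∩ M.cell t k := by
  obtain ⟨B, hB, hAB⟩ := exists_pointPast_inter_eq M.measurable_time M.measurable_mark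
    (L := M.lastTime k) (n := k) M.monotone_time hA
  exact ⟨B, hB, ext fun ω => and_congr_left fun hω => hAB ω hω.1 hω.2⟩

/-- The weight of `m` after `k` quakes, discounted by the probability that nothing has happened
between quake `k` and time `t`: the unnormalized posterior probability of `m` at time `t`. -/
noncomputable def survWeight (ν : Measure E) (gam eps : E → ℝ≥0 → ℝ≥0)
    (lam : E → ℝ≥0 → E × ℝ≥0 → ℝ≥0) (p : ℝ≥0) (k : ℕ) (m : Option ℕ) (t : ℝ≥0) (ω : Ω) : ℝ≥0 :=
  M.weight ν gam eps lam p k m ω * M.surv ν gam eps lam k m ω t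

/-- The posterior probability at time `t` that `m` is the active mother, when exactly `k` quakes
have occurred by time `t`. -/
noncomputable def posterior (ν : Measure E) (gam eps : E → ℝ≥0 → ℝ≥0)
    (lam : E → ℝ≥0 → E × ℝ≥0 → ℝ≥0) (p : ℝ≥0) (k : ℕ) (m : Option ℕ) (t : ℝ≥0) (ω : Ω) : ℝ≥0 :=
  if m ∈ states k then M.survWeight ν gam eps lam p k m t ω
    / ∑ j ∈ states k, M.survWeight ν gam eps lam p k j t ω else 0

/-- The explicit version of the filter `π(θ₀(y_i)α, t)`. -/
noncomputable def explicitFilter (ν : Measure E) (gam eps : E → ℝ≥0 → ℝ≥0)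
    (lam : E → ℝ≥0 → E × ℝ≥0 → ℝ≥0) (p : ℝ≥0) (i : ℕ) (t : ℝ≥0) (ω : Ω) : ℝ :=
  M.posterior ν gam eps lam p (M.count t ω) (some i) t ω

theorem posterior_le_one (k : ℕ) (m : Option ℕ) (t : ℝ≥0) (ω : Ω) :
    M.posterior ν gam eps lam p k m t ω ≤ 1 := by
  rw [posterior]
  split_ifs with hm
  · exact div_le_one_of_le₀ (Finset.single_le_sum
      (f := fun j => M.survWeight ν gam eps lam p k j t ω) (fun _ _ => zero_le) hm) zero_le
  · exact zero_le_one

theorem posterior_mul_sum_survWeight {k : ℕ} {m : Option ℕ} (hm : m ∈ states k) (t : ℝ≥0) (ω : Ω) :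
    M.posterior ν gam eps lam p k m t ω * ∑ j ∈ states k, M.survWeight ν gam eps lam p k j t ω
      = M.survWeight ν gam eps lam p k m t ω := by
  rw [posterior, if_pos hm]
  exact div_mul_cancel_of_imp fun h0 =>
    (Finset.sum_eq_zero_iff_of_nonneg fun _ _ => zero_le).1 h0 m hm

variable [SigmaFinite ν]

theorem measurable_survWeight (h : RegularRates ν gam eps lam) {k : ℕ} {m : Option ℕ}
    (hm : m ∈ states k) (t : ℝ≥0) :
    Measurable[M.obsPast k] (M.survWeight ν gam eps lam p k m t) :=
  (M.measurable_weight h k m).mul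
    (M.measurable_comp_surv (f := id) h (@measurable_id _ (M.obsPast k))
      (@measurable_const _ _ _ (M.obsPast k) t) hm)

theorem measurable_posterior (h : RegularRates ν gam eps lam) (k : ℕ) (m : Option ℕ) (t : ℝ≥0) :
    Measurable[M.obsPast k] (M.posterior ν gam eps lam p k m t) := by
  unfold posterior
  split_ifs with hm
  · exact (M.measurable_survWeight h hm t).div
      (Finset.measurable_fun_sum _ fun _ hj => M.measurable_survWeight h hj t)
  · exact @measurable_const _ _ _ (M.obsPast k) _

theorem measurable_explicitFilter (h : RegularRates ν gam eps lam) (i : ℕ) (t : ℝ≥0) :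
    Measurable[M.obsHistory t] (M.explicitFilter ν gam eps lam p i t) := by
  intro U hU
  have hunion : M.explicitFilter ν gam eps lam p i t ⁻¹' U = ⋃ k,
      (fun ω => (M.posterior ν gam eps lam p k (some i) t ω : ℝ)) ⁻¹' U ∩ M.cell t k := by
    ext ω
    simp [M.mem_cell_iff, explicitFilter]
  rw [hunion]
  exact @MeasurableSet.iUnion _ _ (M.obsHistory t) _ _ fun k =>
    M.measurableSet_obsHistory_inter_cell
      ((measurable_coe_nnreal_real.comp (M.measurable_posterior h k (some i) t)) hU)

variable [IsProbabilityMeasure P]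

theorem setLIntegral_cell_mother (h : M.IntensityModel P ν gam eps lam p) {k : ℕ} {m : Option ℕ}
    (hm : m ∈ states k) (t : ℝ≥0) {g : Ω → ℝ≥0∞} (hg : Measurable[M.obsPast k] g) :
    ∫⁻ ω in M.cell t k ∩ {ω | M.motherAfter k ω = m}, g ω ∂P
      = ∫⁻ ω in {ω | M.lastTime k ω ≤ t}, g ω * M.survWeight ν gam eps lam p k m t ω ∂P := by
  have hlast : MeasurableSet[M.obsPast k] {ω | M.lastTime k ω ≤ t} :=
    M.measurable_comp_lastTime (f := id) (@measurable_id _ (M.obsPast k)) measurableSet_Iic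
  have hsurv : Measurable[M.obsPast k] fun ω => M.surv ν gam eps lam k m ω t :=
    M.measurable_comp_surv (f := id) h.rates (@measurable_id _ (M.obsPast k))
      (@measurable_const _ _ _ (M.obsPast k) t) hm
  have hcell : M.cell t k ∩ {ω | M.motherAfter k ω = m}
      = {ω | M.motherAfter k ω = m ∧ M.lastTime k ω ≤ t ∧ (t : ℝ≥0∞) < M.time k ω} :=
    inter_comm _ _
  have hgsurv : Measurable[M.obsPast k] fun ω => g ω * (M.surv ν gam eps lam k m ω t : ℝ≥0∞) :=
    hg.mul hsurv.coe_nnreal_ennreal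
  have hset : {ω | M.motherAfter k ω = m ∧ M.lastTime k ω ≤ t}
      = {ω | M.lastTime k ω ≤ t} ∩ {ω | M.motherAfter k ω = m} := inter_comm _ _
  rw [hcell, M.setLIntegral_no_quake h.rates h.single h.cluster hm t
    (hg.mono (M.obsPast_le_fullPast k) le_rfl), hset,
    (isPosterior_weight h k).setLIntegral_inter_motherAfter hm hlast
      (fun ω hω => ne_top_of_le_ne_top ENNReal.coe_ne_top hω) hgsurv]
  refine lintegral_congr fun ω => ?_
  rw [survWeight, ENNReal.coe_mul, mul_assoc, mul_comm (M.weight ν gam eps lam p k m ω : ℝ≥0∞)]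

theorem setLIntegral_cell (h : M.IntensityModel P ν gam eps lam p) (k : ℕ) (t : ℝ≥0)
    {g : Ω → ℝ≥0∞} (hg : Measurable[M.obsPast k] g) :
    ∫⁻ ω in M.cell t k, g ω ∂P = ∫⁻ ω in {ω | M.lastTime k ω ≤ t},
      g ω * (∑ m ∈ states k, M.survWeight ν gam eps lam p k m t ω : ℝ≥0) ∂P := by
  have hunion : M.cell t k
      = ⋃ m ∈ states k, M.cell t k ∩ {ω | M.motherAfter k ω = m} := by
    ext ω
    simp [M.motherAfter_mem_states k ω]
  have hsummand : ∀ m ∈ states k, Measurable fun ω =>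
      g ω * (M.survWeight ν gam eps lam p k m t ω : ℝ≥0∞) := fun m hm =>
    (hg.mul (M.measurable_survWeight h.rates hm t).coe_nnreal_ennreal).mono (M.obsPast_le k) le_rfl
  conv_lhs => rw [hunion]
  rw [lintegral_biUnion_finset
      (fun i _ j _ hij => disjoint_left.2 fun ω hi hj => hij (hi.2.symm.trans hj.2))
      (fun m _ => (M.measurableSet_cell t k).inter (M.measurableSet_motherAfter' k m)),
    Finset.sum_congr rfl fun m hm => M.setLIntegral_cell_mother h hm t hg,
    ← lintegral_finsetSum' _ fun m hm => (hsummand m hm).aemeasurable]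
  refine lintegral_congr fun ω => ?_
  rw [ENNReal.ofNNReal_finsetSum, Finset.mul_sum]

theorem setLIntegral_posterior (h : M.IntensityModel P ν gam eps lam p) (k : ℕ) (m : Option ℕ)
    (t : ℝ≥0) {g : Ω → ℝ≥0∞} (hg : Measurable[M.obsPast k] g) :
    ∫⁻ ω in M.cell t k, g ω * M.posterior ν gam eps lam p k m t ω ∂P
      = ∫⁻ ω in M.cell t k ∩ {ω | M.motherAfter k ω = m}, g ω ∂P := by
  by_cases hm : m ∈ states k
  · have hgp : Measurable[M.obsPast k] fun ω =>
        g ω * (M.posterior ν gam eps lam p k m t ω : ℝ≥0∞) :=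
      hg.mul (M.measurable_posterior h.rates k m t).coe_nnreal_ennreal
    rw [M.setLIntegral_cell_mother h hm t hg, M.setLIntegral_cell h k t hgp]
    refine lintegral_congr fun ω => ?_
    rw [mul_assoc, ← ENNReal.coe_mul, M.posterior_mul_sum_survWeight hm]
  · have hempty : M.cell t k ∩ {ω | M.motherAfter k ω = m} = ∅ :=
      eq_empty_of_forall_notMem fun ω hω => hm (hω.2 ▸ M.motherAfter_mem_states k ω)
    simp [hempty, posterior, hm]

theorem setLIntegral_inter_cell_explicitFilter (h : M.IntensityModel P ν gam eps lam p) (i : ℕ)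
    {t : ℝ≥0} {A : Set Ω} (hA : MeasurableSet[M.obsHistory t] A) (k : ℕ) :
    ∫⁻ ω in A ∩ M.cell t k, ENNReal.ofReal (M.explicitFilter ν gam eps lam p i t ω) ∂P
      = ∫⁻ ω in A ∩ M.cell t k, ENNReal.ofReal (M.thetaAlpha i t ω) ∂P := by
  obtain ⟨B, hB, hAB⟩ := M.exists_obsPast_inter_cell_eq hA k
  have hB' := M.obsPast_le k B hB
  have hcell := M.measurableSet_cell t k
  set active : Set Ω := {ω | M.motherAfter k ω = some i}
  have hactive : MeasurableSet active := M.measurableSet_motherAfter' k (some i)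
  have hindicator : Measurable[M.obsPast k] (B.indicator (1 : Ω → ℝ≥0∞)) :=
    (@measurable_const _ _ _ (M.obsPast k) 1).indicator hB
  have hposterior := M.setLIntegral_posterior h k (some i) t hindicator
  calc ∫⁻ ω in A ∩ M.cell t k, ENNReal.ofReal (M.explicitFilter ν gam eps lam p i t ω) ∂P
      = ∫⁻ ω in B ∩ M.cell t k, M.posterior ν gam eps lam p k (some i) t ω ∂P := by
        rw [hAB]
        refine setLIntegral_congr_fun (hB'.inter hcell) fun ω hω => ?_
        simp [explicitFilter, M.mem_cell_iff.1 hω.2]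
    _ = ∫⁻ ω in M.cell t k, B.indicator 1 ω * M.posterior ν gam eps lam p k (some i) t ω ∂P := by
        rw [← setLIntegral_indicator hB']
        refine lintegral_congr fun ω => ?_
        by_cases hω : ω ∈ B <;> simp [hω]
    _ = ∫⁻ ω in B ∩ M.cell t k, active.indicator 1 ω ∂P := by
        rw [hposterior, setLIntegral_indicator hB', setLIntegral_indicator hactive,
          ← inter_assoc, inter_comm]
    _ = ∫⁻ ω in A ∩ M.cell t k, ENNReal.ofReal (M.thetaAlpha i t ω) ∂P := by
        rw [hAB]
        refine setLIntegral_congr_fun (hB'.inter hcell) fun ω hω => ?_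
        simp only [M.thetaAlpha_eq, M.mem_cell_iff.1 hω.2, indicator_apply, active, mem_ofPred_eq]
        split_ifs <;> simp

theorem explicitFilter_ae_eq_condExp (h : M.IntensityModel P ν gam eps lam p) (i : ℕ) (t : ℝ≥0) :
    M.explicitFilter ν gam eps lam p i t =ᵐ[P] P[M.thetaAlpha i t | M.obsHistory t] := by
  have hle := M.obsHistory.le t
  have hfilter_obs := M.measurable_explicitFilter (p := p) h.rates i t
  have hfilter := hfilter_obs.mono hle le_rfl
  have hfilter_nonneg : ∀ ω, 0 ≤ M.explicitFilter ν gam eps lam p i t ω := fun ω =>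
    NNReal.coe_nonneg _
  have hfilter_int : Integrable (M.explicitFilter ν gam eps lam p i t) P :=
    Integrable.of_bound hfilter.aestronglyMeasurable 1 (Eventually.of_forall fun ω => by
      rw [Real.norm_of_nonneg (hfilter_nonneg ω)]
      exact NNReal.coe_le_one.2 (M.posterior_le_one _ _ _ _))
  have htheta := M.measurable_thetaAlpha i t
  have htheta_nonneg : ∀ ω, 0 ≤ M.thetaAlpha i t ω := fun ω => NNReal.coe_nonneg _
  have htheta_int : Integrable (M.thetaAlpha i t) P :=
    Integrable.of_bound htheta.aestronglyMeasurable 1 (Eventually.of_forall fun ω => by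
      rw [M.thetaAlpha_eq]
      split_ifs <;> simp)
  refine ae_eq_condExp_of_forall_setIntegral_eq hle htheta_int
    (fun _ _ _ => hfilter_int.integrableOn) (fun A hA _ => ?_)
    hfilter_obs.stronglyMeasurable.aestronglyMeasurable
  rw [integral_eq_lintegral_of_nonneg_ae (Eventually.of_forall hfilter_nonneg)
      hfilter.aestronglyMeasurable,
    integral_eq_lintegral_of_nonneg_ae (Eventually.of_forall htheta_nonneg)
      htheta.aestronglyMeasurable,
    M.setLIntegral_eq_tsum_cell (hle A hA) t, M.setLIntegral_eq_tsum_cell (hle A hA) t]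
  simp_rw [M.setLIntegral_inter_cell_explicitFilter h i hA]

end ConditionalExpectation

section CadlagVersion

theorem coe_surv (n : ℕ) (m : Option ℕ) (ω : Ω) (t : ℝ≥0) :
    (M.surv ν gam eps lam n m ω t : ℝ)
      = Real.exp (-(M.hazard ν gam eps lam m ω).real (Ioc (M.lastTime n ω).toNNReal t)) :=
  Real.coe_toNNReal _ (Real.exp_pos _).le

theorem surv_pos (n : ℕ) (m : Option ℕ) (ω : Ω) (t : ℝ≥0) : 0 < M.surv ν gam eps lam n m ω t :=
  Real.toNNReal_pos.2 (Real.exp_pos _)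

theorem surv_lastTime (n : ℕ) (m : Option ℕ) (ω : Ω) :
    M.surv ν gam eps lam n m ω (M.lastTime n ω).toNNReal = 1 := by
  simp [surv, survFrom]

theorem sum_survWeight_pos {k : ℕ} {ω : Ω} (t : ℝ≥0)
    (hw : ∑ m ∈ states k, M.weight ν gam eps lam p k m ω = 1) :
    0 < ∑ m ∈ states k, M.survWeight ν gam eps lam p k m t ω := by
  obtain ⟨m, hm, hne⟩ := Finset.exists_ne_zero_of_sum_ne_zero (hw ▸ one_ne_zero)
  exact Finset.sum_pos' (fun _ _ => zero_le)
    ⟨m, hm, mul_pos (pos_iff_ne_zero.2 hne) (M.surv_pos k m ω t)⟩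

theorem posterior_lastTime {k : ℕ} {ω : Ω} {m : Option ℕ} (hm : m ∈ states k)
    (hw : ∑ m ∈ states k, M.weight ν gam eps lam p k m ω = 1) :
    M.posterior ν gam eps lam p k m (M.lastTime k ω).toNNReal ω
      = M.weight ν gam eps lam p k m ω := by
  simp [posterior, survWeight, hm, surv_lastTime, hw]

theorem sum_posterior {k : ℕ} {ω : Ω} (t : ℝ≥0)
    (hw : ∑ m ∈ states k, M.weight ν gam eps lam p k m ω = 1) :
    ∑ m ∈ states k, M.posterior ν gam eps lam p k m t ω = 1 := by
  rw [Finset.sum_congr rfl fun m (hm : m ∈ states k) => show M.posterior ν gam eps lam p k m t ω = _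
    from if_pos hm, ← Finset.sum_div]
  exact div_self (M.sum_survWeight_pos t hw).ne'

theorem mix_weight_eq (k : ℕ) (ω : Ω) (x : E × ℝ≥0)
    (R : Option ℕ → Ω × (E × ℝ≥0) → ℝ≥0) :
    M.mix ν gam eps lam k (M.weight ν gam eps lam p k) R (ω, x)
      = (∑ m ∈ states k, M.survWeight ν gam eps lam p k m x.2 ω)
        * ∑ m ∈ states k, M.posterior ν gam eps lam p k m x.2 ω * R m (ω, x) := by
  rw [mix, Finset.mul_sum]
  refine Finset.sum_congr rfl fun m hm => ?_
  rw [← mul_assoc, ← mul_assoc, mul_comm (∑ j ∈ states k, _) (M.posterior ν gam eps lam p k m _ ω),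
    M.posterior_mul_sum_survWeight hm, survWeight]

theorem weight_succ_eq {k : ℕ} {ω : Ω} (m' : Option ℕ)
    (hw : ∑ m ∈ states k, M.weight ν gam eps lam p k m ω = 1) :
    M.weight ν gam eps lam p (k + 1) m' ω
      = (∑ m ∈ states k, M.posterior ν gam eps lam p k m (M.point k ω).2 ω
          * M.jumpRate gam eps lam p k m' m (ω, M.point k ω))
        / ∑ m ∈ states k, M.posterior ν gam eps lam p k m (M.point k ω).2 ω
          * M.markRate gam eps lam m (ω, M.point k ω) := by
  rw [weight, mix_weight_eq, mix_weight_eq,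
    mul_div_mul_left _ _ (M.sum_survWeight_pos _ hw).ne']

theorem sum_mul_jumpRate_of_lt {k i : ℕ} (hi : i < k) (v : Option ℕ → ℝ≥0) (x : Ω × (E × ℝ≥0)) :
    ∑ m ∈ states k, v m * M.jumpRate gam eps lam p k (some i) m x
      = v (some i) * (gam x.2.1 x.2.2 + (1 - p) * lam x.2.1 x.2.2 (M.point i x.1)) := by
  rw [Finset.sum_eq_single (some i)]
  · simp [jumpRate, moveProb, moveTo, clusterRate]
  · intro m _ hm
    rcases m with _ | j
    · simp [jumpRate, moveProb, moveTo, hi.ne']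
    · simp [jumpRate, moveProb, moveTo, show j ≠ i from fun h => hm (h ▸ rfl)]
  · intro hnot
    simp [states, hi] at hnot

theorem sum_mul_jumpRate_self (hp : p ≤ 1) (k : ℕ) (v : Option ℕ → ℝ≥0) (x : Ω × (E × ℝ≥0)) :
    ∑ m ∈ states k, v m * M.jumpRate gam eps lam p k (some k) m x
      = v none * eps x.2.1 x.2.2 := by
  rw [Finset.sum_eq_single none]
  · simp [jumpRate, moveProb, moveTo, clusterRate, add_tsub_cancel_of_le hp]
  · intro m hm hne
    rcases m with _ | j
    · exact absurd rfl hne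
    · have hj : j < k := by simpa [states] using hm
      simp [jumpRate, moveProb, moveTo, hj.ne]
  · intro hnot
    simp [states] at hnot

theorem explicitFilter_eq_posterior {k i : ℕ} {t : ℝ≥0} {ω : Ω} (hL : M.lastTime k ω ≤ t)
    (ht : (t : ℝ≥0∞) < M.time k ω) : M.explicitFilter ν gam eps lam p i t ω
      = M.posterior ν gam eps lam p k (some i) t ω := by
  rw [explicitFilter, M.count_eq hL ht]

theorem _root_.IsFilterOf.ae_forall_eq {M : QuakeProcess Ω E} {P : Measure Ω}
    {Z π π' : ℝ≥0 → Ω → ℝ} (h : IsFilterOf M P Z π) (h' : IsFilterOf M P Z π') :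
    ∀ᵐ ω ∂P, ∀ t, π t ω = π' t ω := by
  obtain ⟨D, hDc, hD⟩ := TopologicalSpace.exists_countable_dense ℝ≥0
  have hae : ∀ᵐ ω ∂P, ∀ t ∈ D, π t ω = π' t ω :=
    (ae_ball_iff hDc).2 fun t _ => (h.condExp t).trans (h'.condExp t).symm
  filter_upwards [hae, h.cadlag, h'.cadlag] with ω heq hcadlag hcadlag'
  exact congrFun (eq_of_eqOn_dense_of_continuousWithinAt_Ici hD
    (fun t => (hcadlag t).1) (fun t => (hcadlag' t).1) heq)

theorem measurable_clusterRate (h : RegularRates ν gam eps lam) (m : Option ℕ) (ω : Ω) :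
    Measurable fun x : E × ℝ≥0 => M.clusterRate eps lam m ω x.1 x.2 := by
  cases m with
  | none => exact h.eps_meas
  | some i =>
    exact h.lam_meas.comp (measurable_fst.prodMk (measurable_snd.prodMk measurable_const))

theorem integral_clusterRate (h : RegularRates ν gam eps lam) (m : Option ℕ) (ω : Ω) (s : ℝ≥0) :
    ∫ u, (M.clusterRate eps lam m ω u s : ℝ) ∂ν
      = (∫⁻ u, (M.clusterRate eps lam m ω u s : ℝ≥0∞) ∂ν).toReal :=
  integral_toReal (f := fun u => (M.clusterRate eps lam m ω u s : ℝ≥0∞))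
    ((M.measurable_clusterRate h m ω).comp measurable_prodMk_right).coe_nnreal_ennreal.aemeasurable
    (Eventually.of_forall fun _ => ENNReal.coe_lt_top)

variable [SigmaFinite ν]

theorem continuousOn_surv (h : RegularRates ν gam eps lam) {n : ℕ} {m : Option ℕ} {ω : Ω} {t : ℝ≥0}
    (hm : m ∈ states n) (hL : M.lastTime n ω ≤ t) :
    ContinuousOn (fun s => M.surv ν gam eps lam n m ω s) (Icc (M.lastTime n ω).toNNReal t) :=
  continuous_real_toNNReal.comp_continuousOn (Real.continuous_exp.comp_continuousOn
    (continuousOn_measureReal_Ioc (M.hazard_ne_top h hm hL)).neg)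

theorem continuousOn_survWeight (h : RegularRates ν gam eps lam) {k : ℕ} {m : Option ℕ} {ω : Ω}
    {t : ℝ≥0} (hm : m ∈ states k) (hL : M.lastTime k ω ≤ t) :
    ContinuousOn (fun s => M.survWeight ν gam eps lam p k m s ω)
      (Icc (M.lastTime k ω).toNNReal t) :=
  continuousOn_const.mul (M.continuousOn_surv h hm hL)

theorem continuousOn_posterior (h : RegularRates ν gam eps lam) {k : ℕ} (m : Option ℕ) {ω : Ω}
    {t : ℝ≥0} (hL : M.lastTime k ω ≤ t)
    (hw : ∑ m ∈ states k, M.weight ν gam eps lam p k m ω = 1) :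
    ContinuousOn (fun s => (M.posterior ν gam eps lam p k m s ω : ℝ))
      (Icc (M.lastTime k ω).toNNReal t) := by
  refine NNReal.continuous_coe.comp_continuousOn ?_
  by_cases hm : m ∈ states k
  · simp only [posterior, hm, if_true]
    exact (M.continuousOn_survWeight h hm hL).div
      (continuousOn_finsetSum _ fun j hj => M.continuousOn_survWeight h hj hL)
      fun s _ => (M.sum_survWeight_pos s hw).ne'
  · simp only [posterior, hm, if_false]
    exact continuousOn_const

theorem continuousWithinAt_explicitFilter (h : RegularRates ν gam eps lam) {ω : Ω}
    (hw : ∀ k, M.lastTime k ω ≠ ∞ → ∑ m ∈ states k, M.weight ν gam eps lam p k m ω = 1)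
    (i : ℕ) (t : ℝ≥0) :
    ContinuousWithinAt (fun s => M.explicitFilter ν gam eps lam p i s ω) (Ici t) t := by
  obtain ⟨hL, ht⟩ := M.mem_cell_count t ω
  set k := M.count t ω
  obtain ⟨T, htT, hT⟩ := ENNReal.lt_iff_exists_nnreal_btwn.1 ht
  have htT' : t < T := by exact_mod_cast htT
  have hLne : M.lastTime k ω ≠ ∞ := ne_top_of_le_ne_top ENNReal.coe_ne_top hL
  have hLt : (M.lastTime k ω).toNNReal ≤ t := ENNReal.toNNReal_mono ENNReal.coe_ne_top hL
  have hposterior : ContinuousWithinAt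
      (fun s => (M.posterior ν gam eps lam p k (some i) s ω : ℝ)) (Ici t) t :=
    ((M.continuousOn_posterior h (some i) (hL.trans htT.le) (hw k hLne) t ⟨hLt, htT'.le⟩).mono
      (Icc_subset_Icc_left hLt)).mono_of_mem_nhdsWithin (Icc_mem_nhdsGE htT')
  refine hposterior.congr_of_eventuallyEq ?_ (M.explicitFilter_eq_posterior hL ht)
  filter_upwards [Icc_mem_nhdsGE htT'] with s hs
  exact M.explicitFilter_eq_posterior (hL.trans (by exact_mod_cast hs.1))
    (lt_of_le_of_lt (by exact_mod_cast hs.2) hT)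

theorem tendsto_explicitFilter (h : RegularRates ν gam eps lam) {ω : Ω} {k : ℕ} {t : ℝ≥0}
    (hw : ∑ m ∈ states k, M.weight ν gam eps lam p k m ω = 1) (hL : M.lastTime k ω < t)
    (ht : (t : ℝ≥0∞) ≤ M.time k ω) (i : ℕ) :
    Tendsto (fun s => M.explicitFilter ν gam eps lam p i s ω) (𝓝[<] t)
      (𝓝 (M.posterior ν gam eps lam p k (some i) t ω)) := by
  have hLne : M.lastTime k ω ≠ ∞ := (hL.trans ENNReal.coe_lt_top).ne
  have hLt : (M.lastTime k ω).toNNReal < t := by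
    rwa [← ENNReal.coe_lt_coe, ENNReal.coe_toNNReal hLne]
  have hposterior := M.continuousOn_posterior h (some i) hL.le hw t ⟨hLt.le, le_rfl⟩
  have hmem := Ioo_mem_nhdsLT hLt
  refine (hposterior.tendsto.mono_left (nhdsWithin_le_of_mem
    (mem_of_superset hmem Ioo_subset_Icc_self))).congr' ?_
  filter_upwards [hmem] with s hs
  refine (M.explicitFilter_eq_posterior ?_ (lt_of_lt_of_le (by exact_mod_cast hs.2) ht)).symm
  rw [← ENNReal.coe_toNNReal hLne]
  exact_mod_cast hs.1.le

theorem exists_tendsto_explicitFilter (h : RegularRates ν gam eps lam) {ω : Ω}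
    (hw : ∀ k, M.lastTime k ω ≠ ∞ → ∑ m ∈ states k, M.weight ν gam eps lam p k m ω = 1)
    (i : ℕ) (t : ℝ≥0) :
    ∃ l, Tendsto (fun s => M.explicitFilter ν gam eps lam p i s ω) (𝓝[<] t) (𝓝 l) := by
  rcases eq_or_ne t 0 with rfl | ht
  · exact ⟨0, by simp⟩
  have hex : ∃ n, (t : ℝ≥0∞) ≤ M.time n ω :=
    ((M.tendsto_time ω).eventually (le_mem_nhds ENNReal.coe_lt_top)).exists
  have hL : M.lastTime (Nat.find hex) ω < t := by
    rcases hk : Nat.find hex with _ | k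
    · simpa [lastTime] using pos_iff_ne_zero.2 ht
    · exact not_le.1 (Nat.find_min hex (by omega : k < Nat.find hex))
  exact ⟨_, M.tendsto_explicitFilter h (hw _ (hL.trans ENNReal.coe_lt_top).ne) hL
    (Nat.find_spec hex) i⟩

theorem isFilterOf_explicitFilter [IsProbabilityMeasure P]
    (h : M.IntensityModel P ν gam eps lam p) (i : ℕ) :
    IsFilterOf M P (M.thetaAlpha i) (M.explicitFilter ν gam eps lam p i) where
  condExp := M.explicitFilter_ae_eq_condExp h i
  cadlag := by
    filter_upwards [ae_all_iff.2 (ae_sum_weight h)] with ω hω t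
    exact ⟨M.continuousWithinAt_explicitFilter h.rates hω i t,
      M.exists_tendsto_explicitFilter h.rates hω i t⟩

theorem measurable_lintegral_clusterRate (h : RegularRates ν gam eps lam) (m : Option ℕ) (ω : Ω) :
    Measurable fun s => ∫⁻ u, (M.clusterRate eps lam m ω u s : ℝ≥0∞) ∂ν :=
  Measurable.lintegral_prod_right' (f := fun x : ℝ≥0 × E =>
    (M.clusterRate eps lam m ω x.2 x.1 : ℝ≥0∞))
    ((M.measurable_clusterRate h m ω).comp measurable_swap).coe_nnreal_ennreal

theorem integrableOn_integral_clusterRate (h : RegularRates ν gam eps lam) {n : ℕ} {m : Option ℕ}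
    {ω : Ω} {t : ℝ≥0} (hm : m ∈ states n) (hL : M.lastTime n ω ≤ t) :
    IntegrableOn (fun s => ∫ u, (M.clusterRate eps lam m ω u s : ℝ) ∂ν)
      (Ioc (M.lastTime n ω).toNNReal t) lebesgueNN := by
  simp_rw [M.integral_clusterRate h]
  exact integrable_toReal_of_lintegral_ne_top
    (M.measurable_lintegral_clusterRate h m ω).aemeasurable
    (M.lintegral_clusterRate_lt_top h hm hL).ne

theorem measureReal_hazard (h : RegularRates ν gam eps lam) {n : ℕ} {m : Option ℕ} {ω : Ω}
    {t : ℝ≥0} (hm : m ∈ states n) (hL : M.lastTime n ω ≤ t) :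
    (M.hazard ν gam eps lam m ω).real (Ioc (M.lastTime n ω).toNNReal t)
      = (∫⁻ s in Ioc (M.lastTime n ω).toNNReal t, ∫⁻ u, (gam u s : ℝ≥0∞) ∂ν ∂lebesgueNN).toReal
        + ∫ s in Ioc (M.lastTime n ω).toNNReal t, ∫ u, (M.clusterRate eps lam m ω u s : ℝ) ∂ν
          ∂lebesgueNN := by
  have hrate := M.measurable_lintegral_clusterRate h m ω
  have hrate_fin := M.lintegral_clusterRate_lt_top h hm hL
  have hgam : Measurable fun s => ∫⁻ u, (gam u s : ℝ≥0∞) ∂ν :=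
    Measurable.lintegral_prod_right' (f := fun x : ℝ≥0 × E => (gam x.2 x.1 : ℝ≥0∞))
      (h.gam_meas.comp measurable_swap).coe_nnreal_ennreal
  have hgam_fin : ∫⁻ s in Ioc (M.lastTime n ω).toNNReal t, ∫⁻ u, (gam u s : ℝ≥0∞) ∂ν
      ∂lebesgueNN < ∞ := (lintegral_mono_set Ioc_subset_Iic_self).trans_lt (h.gam_int t)
  simp_rw [M.integral_clusterRate h]
  rw [integral_toReal hrate.aemeasurable (ae_lt_top hrate hrate_fin.ne), Measure.real, hazard,
    withDensity_apply _ measurableSet_Ioc]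
  simp_rw [M.totalRate_eq_add h]
  rw [lintegral_add_left hgam, ENNReal.toReal_add hgam_fin.ne hrate_fin.ne]

theorem surv_some (h : RegularRates ν gam eps lam) {k j : ℕ} {ω : Ω} {t : ℝ≥0} (hj : j < k)
    (hL : M.lastTime k ω ≤ t) :
    (M.surv ν gam eps lam k (some j) ω t : ℝ)
      = M.decay ν eps lam k j t ω * M.surv ν gam eps lam k none ω t := by
  have hsome : some j ∈ states k := by simp [states, hj]
  have hnone : none ∈ states k := by simp [states]
  have hlam := M.integrableOn_integral_clusterRate h hsome hL
  have heps := M.integrableOn_integral_clusterRate h hnone hL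
  rw [coe_surv, coe_surv, decay, M.measureReal_hazard h hsome hL, M.measureReal_hazard h hnone hL,
    ← Real.exp_add]
  simp only [clusterRate] at hlam heps ⊢
  rw [integral_sub hlam heps]
  congr 1
  ring

end CadlagVersion

section FilterEquations

theorem explicitFilter_lastTime {k i : ℕ} {ω : Ω} (hi : i < k) (hL : M.lastTime k ω ≠ ∞)
    (hw : ∑ m ∈ states k, M.weight ν gam eps lam p k m ω = 1) :
    M.explicitFilter ν gam eps lam p i (M.lastTime k ω).toNNReal ω
      = M.weight ν gam eps lam p k (some i) ω := by
  have hc := ENNReal.coe_toNNReal hL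
  rw [M.explicitFilter_eq_posterior hc.ge (hc.symm ▸ M.lastTime_lt_time hL),
    M.posterior_lastTime (by simp [states, hi]) hw]

theorem explicitFilter_time {k i : ℕ} {ω : Ω} (hi : i < k + 1) (ht : M.time k ω ≠ ∞)
    (hw : ∀ k, M.lastTime k ω ≠ ∞ → ∑ m ∈ states k, M.weight ν gam eps lam p k m ω = 1) :
    M.explicitFilter ν gam eps lam p i (M.time k ω).toNNReal ω
      = (∑ m ∈ states k, M.posterior ν gam eps lam p k m (M.point k ω).2 ω
          * M.jumpRate gam eps lam p k (some i) m (ω, M.point k ω) : ℝ≥0)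
        / (∑ m ∈ states k, M.posterior ν gam eps lam p k m (M.point k ω).2 ω
          * M.markRate gam eps lam m (ω, M.point k ω) : ℝ≥0) := by
  have hL : M.lastTime k ω ≠ ∞ := ne_top_of_le_ne_top ht (M.lastTime_le_time k ω)
  rw [← NNReal.coe_div, ← M.weight_succ_eq (some i) (hw k hL)]
  exact M.explicitFilter_lastTime (k := k + 1) hi ht (hw (k + 1) ht)

variable [SigmaFinite ν]

theorem sum_survWeight_eq_bDenom_mul (h : RegularRates ν gam eps lam) {ω : Ω} {k : ℕ} {t : ℝ≥0}
    (hw : ∑ m ∈ states k, M.weight ν gam eps lam p k m ω = 1) (hL : M.lastTime k ω ≤ t) :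
    (∑ m ∈ states k, M.survWeight ν gam eps lam p k m t ω : ℝ≥0)
      = M.bDenom ν eps lam (M.explicitFilter ν gam eps lam p) k t ω
        * M.surv ν gam eps lam k none ω t := by
  have hLne : M.lastTime k ω ≠ ∞ := ne_top_of_le_ne_top ENNReal.coe_ne_top hL
  have hfilter : ∀ j ∈ Finset.range k, M.explicitFilter ν gam eps lam p j
      (M.lastTime k ω).toNNReal ω = M.weight ν gam eps lam p k (some j) ω := fun j hj =>
    M.explicitFilter_lastTime (Finset.mem_range.1 hj) hLne hw
  have hsurv : ∀ j ∈ Finset.range k, (M.survWeight ν gam eps lam p k (some j) t ω : ℝ)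
      = M.weight ν gam eps lam p k (some j) ω * M.decay ν eps lam k j t ω
        * M.surv ν gam eps lam k none ω t := fun j hj => by
    rw [survWeight, NNReal.coe_mul, M.surv_some h (Finset.mem_range.1 hj) hL, mul_assoc]
  have hnone : (M.weight ν gam eps lam p k none ω : ℝ)
      = 1 - ∑ j ∈ Finset.range k, (M.weight ν gam eps lam p k (some j) ω : ℝ) := by
    rw [sum_states] at hw
    exact eq_sub_of_add_eq (by exact_mod_cast hw)
  rw [sum_states, NNReal.coe_add, NNReal.coe_sum, Finset.sum_congr rfl hsurv, ← Finset.sum_mul,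
    survWeight, NNReal.coe_mul, hnone, bDenom, Finset.sum_congr rfl hfilter,
    Finset.sum_congr rfl fun j hj => congrArg (· * M.decay ν eps lam k j t ω) (hfilter j hj)]
  ring

theorem bDenom_explicitFilter_pos (h : RegularRates ν gam eps lam) {ω : Ω} {k : ℕ} {t : ℝ≥0}
    (hw : ∑ m ∈ states k, M.weight ν gam eps lam p k m ω = 1) (hL : M.lastTime k ω ≤ t) :
    0 < M.bDenom ν eps lam (M.explicitFilter ν gam eps lam p) k t ω := by
  have hpos := NNReal.coe_pos.2 (M.sum_survWeight_pos t hw)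
  rw [M.sum_survWeight_eq_bDenom_mul h hw hL] at hpos
  exact pos_of_mul_pos_left hpos NNReal.zero_le_coe

theorem explicitFilter_between (h : RegularRates ν gam eps lam) {ω : Ω} {k i : ℕ} {t : ℝ≥0}
    (hi : i < k) (hw : ∑ m ∈ states k, M.weight ν gam eps lam p k m ω = 1)
    (hL : M.lastTime k ω ≤ t) (ht : (t : ℝ≥0∞) < M.time k ω) :
    M.explicitFilter ν gam eps lam p i t ω
      = M.explicitFilter ν gam eps lam p i (M.lastTime k ω).toNNReal ω
        * M.decay ν eps lam k i t ω
        * (1 / M.bDenom ν eps lam (M.explicitFilter ν gam eps lam p) k t ω) := by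
  have hLne : M.lastTime k ω ≠ ∞ := ne_top_of_le_ne_top ENNReal.coe_ne_top hL
  have hb := M.bDenom_explicitFilter_pos h hw hL
  have hsurv : (0 : ℝ) < M.surv ν gam eps lam k none ω t :=
    NNReal.coe_pos.2 (M.surv_pos k none ω t)
  rw [M.explicitFilter_lastTime hi hLne hw, M.explicitFilter_eq_posterior hL ht, posterior,
    if_pos (by simp [states, hi]), NNReal.coe_div, M.sum_survWeight_eq_bDenom_mul h hw hL,
    survWeight, NNReal.coe_mul, M.surv_some h hi hL]
  field_simp

theorem preJump_explicitFilter (h : RegularRates ν gam eps lam) {ω : Ω} {k : ℕ}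
    (hw : ∑ m ∈ states k, M.weight ν gam eps lam p k m ω = 1) (ht : M.time k ω ≠ ∞) (j : ℕ) :
    M.preJump (M.explicitFilter ν gam eps lam p) k j ω
      = M.posterior ν gam eps lam p k (some j) (M.point k ω).2 ω := by
  have hL : M.lastTime k ω ≠ ∞ := ne_top_of_le_ne_top ht (M.lastTime_le_time k ω)
  have hc := ENNReal.coe_toNNReal ht
  have hpos : 0 < (M.time k ω).toNNReal := ENNReal.toNNReal_pos
    ((M.time_pos ω).trans_le (M.monotone_time (Nat.zero_le k) ω)).ne' ht
  have hne : (𝓝[<] (M.time k ω).toNNReal).NeBot := nhdsLT_neBot_of_exists_lt ⟨0, hpos⟩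
  exact leftLim_eq_of_tendsto
    (M.tendsto_explicitFilter h hw (hc.symm ▸ M.lastTime_lt_time hL) hc.le j)

theorem posterior_none_eq (h : RegularRates ν gam eps lam) {ω : Ω} {k : ℕ}
    (hw : ∑ m ∈ states k, M.weight ν gam eps lam p k m ω = 1) (ht : M.time k ω ≠ ∞) :
    (M.posterior ν gam eps lam p k none (M.point k ω).2 ω : ℝ)
      = 1 - ∑ j ∈ Finset.range k, M.preJump (M.explicitFilter ν gam eps lam p) k j ω := by
  have hsum := M.sum_posterior (M.point k ω).2 hw
  rw [sum_states] at hsum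
  simp only [M.preJump_explicitFilter h hw ht]
  exact eq_sub_of_add_eq (by exact_mod_cast hsum)

theorem jumpDenom_explicitFilter (h : RegularRates ν gam eps lam) {ω : Ω} {k : ℕ}
    (hw : ∑ m ∈ states k, M.weight ν gam eps lam p k m ω = 1) (ht : M.time k ω ≠ ∞) :
    M.jumpDenom gam eps lam (M.explicitFilter ν gam eps lam p) k ω
      = (∑ m ∈ states k, M.posterior ν gam eps lam p k m (M.point k ω).2 ω
          * M.markRate gam eps lam m (ω, M.point k ω) : ℝ≥0) := by
  have hsome : ∀ j, (M.markRate gam eps lam (some j) (ω, M.point k ω) : ℝ)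
      = (M.lamAt lam k j ω - M.epsAt eps k ω) + (M.gamAt gam k ω + M.epsAt eps k ω) := fun j => by
    simp only [markRate, clusterRate, gamAt, lamAt, epsAt, point]
    push_cast
    ring
  have hnone : (M.markRate gam eps lam none (ω, M.point k ω) : ℝ)
      = M.gamAt gam k ω + M.epsAt eps k ω := by
    simp only [markRate, clusterRate, gamAt, epsAt, point]
    push_cast
    ring
  rw [sum_states]
  push_cast
  simp only [hsome, hnone, M.posterior_none_eq h hw ht, ← M.preJump_explicitFilter h hw ht,
    mul_add, Finset.sum_add_distrib, ← Finset.sum_mul, jumpDenom]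
  simp only [mul_comm (M.lamAt lam k _ ω - _)]
  ring

theorem jumpDenom_explicitFilter_pos (h : RegularRates ν gam eps lam) {ω : Ω} {k : ℕ}
    (hw : ∑ m ∈ states k, M.weight ν gam eps lam p k m ω = 1) (ht : M.time k ω ≠ ∞)
    (hmix : M.mix ν gam eps lam k (M.weight ν gam eps lam p k)
      (M.markRate gam eps lam) (ω, M.point k ω) ≠ 0) :
    0 < M.jumpDenom gam eps lam (M.explicitFilter ν gam eps lam p) k ω := by
  rw [mix_weight_eq] at hmix
  rw [M.jumpDenom_explicitFilter h hw ht, NNReal.coe_pos, pos_iff_ne_zero]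
  exact right_ne_zero_of_mul hmix

theorem explicitFilter_time_of_lt (h : RegularRates ν gam eps lam) (hp : p ≤ 1) {ω : Ω} {k i : ℕ}
    (hi : i < k) (ht : M.time k ω ≠ ∞)
    (hw : ∀ k, M.lastTime k ω ≠ ∞ → ∑ m ∈ states k, M.weight ν gam eps lam p k m ω = 1) :
    M.explicitFilter ν gam eps lam p i (M.time k ω).toNNReal ω
      = M.preJump (M.explicitFilter ν gam eps lam p) k i ω
          * (M.gamAt gam k ω + (1 - p) * M.lamAt lam k i ω)
        / M.jumpDenom gam eps lam (M.explicitFilter ν gam eps lam p) k ω := by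
  have hwk := hw k (ne_top_of_le_ne_top ht (M.lastTime_le_time k ω))
  rw [M.explicitFilter_time (hi.trans k.lt_succ_self) ht hw, M.sum_mul_jumpRate_of_lt hi,
    M.preJump_explicitFilter h hwk ht, M.jumpDenom_explicitFilter h hwk ht]
  push_cast [NNReal.coe_sub hp]
  rfl

theorem explicitFilter_time_self (h : RegularRates ν gam eps lam) (hp : p ≤ 1) {ω : Ω} {k : ℕ}
    (ht : M.time k ω ≠ ∞)
    (hw : ∀ k, M.lastTime k ω ≠ ∞ → ∑ m ∈ states k, M.weight ν gam eps lam p k m ω = 1) :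
    M.explicitFilter ν gam eps lam p k (M.time k ω).toNNReal ω
      = (M.epsAt eps k ω - ∑ j ∈ Finset.range k, M.epsAt eps k ω
          * M.preJump (M.explicitFilter ν gam eps lam p) k j ω)
        / M.jumpDenom gam eps lam (M.explicitFilter ν gam eps lam p) k ω := by
  have hwk := hw k (ne_top_of_le_ne_top ht (M.lastTime_le_time k ω))
  rw [M.explicitFilter_time k.lt_succ_self ht hw, M.sum_mul_jumpRate_self hp,
    ← M.jumpDenom_explicitFilter h hwk ht, NNReal.coe_mul, M.posterior_none_eq h hwk ht,
    ← Finset.mul_sum, ← mul_one_sub, mul_comm]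
  rfl

theorem _root_.IsMotherQuakeModel.intensityModel {M : QuakeProcess Ω E} {P : Measure Ω}
    [IsProbabilityMeasure P] {p : ℝ} (h : RegularRates ν gam eps lam) (hp1 : p ≤ 1)
    (hM : IsMotherQuakeModel M P ν gam eps lam p) :
    M.IntensityModel P ν gam eps lam p.toNNReal where
  rates := h
  single := M.hasIntensity_single h.gam_meas h.gam_int hM.poisson hM.compatible
  cluster := hM.intensity
  coin_prob := hM.kill_prob
  coin_indep := hM.kill_indep
  prob_le_one := Real.toNNReal_le_one.2 hp1

end FilterEquations

end QuakeProcess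

theorem theorem3p1 {Ω E : Type*} [MeasurableSpace Ω] [MeasurableSpace E]
    (P : Measure Ω) [IsProbabilityMeasure P] (ν : Measure E) [SigmaFinite ν]
    (gam eps : E → ℝ≥0 → ℝ≥0) (lam : E → ℝ≥0 → E × ℝ≥0 → ℝ≥0)
    (p q : ℝ) (hp0 : 0 ≤ p) (hp1 : p ≤ 1) (hq : q = 1 - p)
    (hgam : Measurable fun x : E × ℝ≥0 => gam x.1 x.2)
    (heps : Measurable fun x : E × ℝ≥0 => eps x.1 x.2)
    (hlam : Measurable fun x : E × ℝ≥0 × (E × ℝ≥0) => lam x.1 x.2.1 x.2.2)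
    (hgam_int : ∀ T : ℝ≥0, ∫⁻ s in Iic T, ∫⁻ u, (gam u s : ℝ≥0∞) ∂ν ∂lebesgueNN < ∞)
    (heps_int : ∀ T : ℝ≥0, ∫⁻ s in Iic T, ∫⁻ u, (eps u s : ℝ≥0∞) ∂ν ∂lebesgueNN < ∞)
    (hlam_int : ∀ (y : E × ℝ≥0) (T : ℝ≥0),
      ∫⁻ s in Ioc y.2 T, ∫⁻ u, (lam u s y : ℝ≥0∞) ∂ν ∂lebesgueNN < ∞)
    (M : QuakeProcess Ω E) (hM : IsMotherQuakeModel M P ν gam eps lam p) :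
    (∃ π : ℕ → ℝ≥0 → Ω → ℝ, ∀ i, IsFilterOf M P (M.thetaAlpha i) (π i)) ∧
    ∀ π : ℕ → ℝ≥0 → Ω → ℝ, (∀ i, IsFilterOf M P (M.thetaAlpha i) (π i)) →
      ∀ᵐ ω ∂P,
        (∀ (k : ℕ) (t : ℝ≥0), M.lastTime k ω ≤ t → (t : ℝ≥0∞) < M.time k ω →
          0 < M.bDenom ν eps lam π k t ω ∧
          ∀ i < k, π i t ω = π i (M.lastTime k ω).toNNReal ω * M.decay ν eps lam k i t ω
            * (1 / M.bDenom ν eps lam π k t ω)) ∧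
        (∀ k : ℕ, M.time k ω < ∞ →
          0 < M.jumpDenom gam eps lam π k ω ∧
          (∀ i < k, π i (M.time k ω).toNNReal ω =
            M.preJump π k i ω * (M.gamAt gam k ω + q * M.lamAt lam k i ω)
              / M.jumpDenom gam eps lam π k ω) ∧
          π k (M.time k ω).toNNReal ω =
            (M.epsAt eps k ω - ∑ j ∈ Finset.range k, M.epsAt eps k ω * M.preJump π k j ω)
              / M.jumpDenom gam eps lam π k ω) := by
  have hR : RegularRates ν gam eps lam := ⟨hgam, heps, hlam, hgam_int, heps_int, hlam_int⟩
  have hI := hM.intensityModel hR hp1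
  have hF := M.isFilterOf_explicitFilter hI
  obtain rfl : 1 - (p.toNNReal : ℝ) = q := by rw [Real.coe_toNNReal p hp0, hq]
  refine ⟨⟨_, hF⟩, fun π hπ => ?_⟩
  filter_upwards [ae_all_iff.2 (QuakeProcess.ae_sum_weight hI),
    ae_all_iff.2 (QuakeProcess.ae_mix_markRate_ne_zero hI),
    ae_all_iff.2 fun i => (hπ i).ae_forall_eq (hF i)] with ω hw hmix heq
  have hpre : ∀ k j, M.preJump π k j ω
      = M.preJump (M.explicitFilter ν gam eps lam p.toNNReal) k j ω := fun k j => by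
    simp only [QuakeProcess.preJump, heq]
  simp only [QuakeProcess.bDenom, QuakeProcess.jumpDenom, hpre, heq]
  refine ⟨fun k t hL ht => ?_, fun k ht => ?_⟩
  · have hwk := hw k (ne_top_of_le_ne_top ENNReal.coe_ne_top hL)
    exact ⟨M.bDenom_explicitFilter_pos hR hwk hL,
      fun i hi => M.explicitFilter_between hR hi hwk hL ht⟩
  · have hwk := hw k (ne_top_of_le_ne_top ht.ne (M.lastTime_le_time k ω))
    exact ⟨M.jumpDenom_explicitFilter_pos hR hwk ht.ne (hmix k ht.ne),
      fun i hi => M.explicitFilter_time_of_lt hR hI.prob_le_one hi ht.ne hw,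
      M.explicitFilter_time_self hR hI.prob_le_one ht.ne hw⟩
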